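/- Let $G=C_n$ be a finite cyclic group with a chosen generator $g$. A $G$-Mackey functor is an additive functor from the Burnside category of finite $G$-sets to abelian groups, $\Box$ is the box product of Mackey functors, $\underline{A}$ is the Burnside Mackey functor, and a $G$-Green functor is an associative unital monoid for $\Box$. For a Mackey functor $\underline{N}$ and a finite $G$-set $X$ write $\underline{N}_X(S)=\underline{N}(X\times S)$; for an arbitrary $G$-set $X$ let $\underline{N}_X$ be the direct sum of the $\underline{N}_O$ over the orbits $O$ of $X$. For a $G$-Green functor $\underline{R}$ let $HC^G_*(\underline{R})$ be the normalized chain complex of the simplicial Mackey functor with $k$-simplices $\underline{R}^{\Box(k+1)}$, in which $d_i$ for $i<k$ multiplies the $i$-th and $(i+1)$-st factors ($0\le i<k$), the last face $d_k$ moves the last factor to the front, lets $g$ act on it, and then multiplies it with the next factor, and the degeneracies insert the unit. Here $g$ acts on $\underline{R}(S)$ by restriction along the translation $g\colon S\to S$. Let $M$ be a pointed monoid in $G$-sets, that is, a (possibly infinite) monoid with zero on which $G$ acts by automorphisms of monoids with zero. Let $\underline{R}[M]=\underline{R}_M/\underline{R}_*$ be the pointed monoid Green functor, with multiplication $(r\cdot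 m)(r'\cdot m')=rr'\cdot mm'$. Let $N^{\mathrm{cyc}}_G M$ be the relative cyclic nerve, regarded as a simplicial pointed $G$-set: its $k$-simplices are $M^{\wedge(k+1)}$ with the diagonal action, $d_i$ for $i<k$ multiplies adjacent factors, $d_k$ moves the last factor to the front, lets $g$ act on it, and multiplies it with the next factor, and the degeneracies insert the unit. For a simplicial pointed $G$-set $X_\bullet$ let $C^{cell}_*(X_\bullet;\underline{A})$ be the Mackey-functor-valued reduced Bredon cellular chains, i.e. the normalized chain complex of the simplicial Mackey functor $k\mapsto \underline{A}_{X_k}/\underline{A}_*$. Then there is a map of nonnegatively graded chain complexes of Mackey functors $$HC^G_*(\underline{R})\,\Box\, C^{cell}_*(N^{\mathrm{cyc}}_G M;\underline{A})\longrightarrow HC^G_*(\underline{R}[M]),$$ where $\Box$ on the left is the (total) box product of chain complexes, which is natural in both the Green functor $\underline{R}$ and the pointed monoid $M$ in $G$-sets, and which is a weak equivalence, i.e. a quasi-isomorphism, for all $\underline{R}$ and $M$. -/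

import Mathlib

open CategoryTheory CategoryTheory.Limits

universe u

namespace EquivariantHH

/-! ### Finite `G`-sets -/

section FiniteGSets

/-- A finite `G`-set, modelled as an action of `G` on `{0, …, card - 1}`.  Every finite `G`-set
is isomorphic to one of this form, and this way there is only a set of them. -/
structure FinGSet (G : Type) [Group G] where
  card : ℕ
  act : MulAction G (Fin card)

variable {G : Type} [Group G]

/-- The underlying set of a finite `G`-set. -/
def FinGSet.carrier (S : FinGSet G) : Type := Fin S.card

instance : CoeSort (FinGSet G) Type := ⟨FinGSet.carrier⟩

instance (S : FinGSet G) : MulAction G S := S.act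

instance (S : FinGSet G) : Finite S := inferInstanceAs (Finite (Fin S.card))

/-- A copy of an arbitrary finite `G`-set. -/
noncomputable def FinGSet.ofFinite (X : Type) [Finite X] [MulAction G X] : FinGSet G where
  card := Nat.card X
  act := (Finite.equivFin X).symm.mulAction G

/-- The bijection between a finite `G`-set and its copy. -/
noncomputable def FinGSet.equiv (X : Type) [Finite X] [MulAction G X] :
    (FinGSet.ofFinite (G := G) X : Type) ≃ X :=
  (Finite.equivFin X).symm

lemma FinGSet.equiv_smul (X : Type) [Finite X] [MulAction G X] (g : G)
    (x : FinGSet.ofFinite (G := G) X) :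
    FinGSet.equiv X (g • x) = g • FinGSet.equiv (G := G) X x :=
  (Finite.equivFin X).symm.apply_symm_apply _

/-- The fibre product of two maps of finite `G`-sets, as a set of pairs. -/
def FinGSet.fib {S T U : FinGSet G} (f : S →[G] U) (h : T →[G] U) : SubMulAction G (S × T) where
  carrier := {p | f p.1 = h p.2}
  smul_mem' g p hp := by
    have hp' : f p.1 = h p.2 := hp
    show f (g • p.1) = h (g • p.2)
    rw [map_smul, map_smul, hp']

/-- The fibre product of two maps of finite `G`-sets. -/
noncomputable def FinGSet.pb {S T U : FinGSet G} (f : S →[G] U) (h : T →[G] U) : FinGSet G :=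
  FinGSet.ofFinite (FinGSet.fib f h)

section

variable {S T U W : FinGSet G} (f : S →[G] U) (h : T →[G] U)

/-- First projection of a fibre product. -/
noncomputable def FinGSet.fst : FinGSet.pb f h →[G] S where
  toFun w := (FinGSet.equiv (FinGSet.fib f h) w).1.1
  map_smul' g w :=
    congrArg (fun z : FinGSet.fib f h => z.1.1) (FinGSet.equiv_smul (FinGSet.fib f h) g w)

/-- Second projection of a fibre product. -/
noncomputable def FinGSet.snd : FinGSet.pb f h →[G] T where
  toFun w := (FinGSet.equiv (FinGSet.fib f h) w).1.2
  map_smul' g w :=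
    congrArg (fun z : FinGSet.fib f h => z.1.2) (FinGSet.equiv_smul (FinGSet.fib f h) g w)

variable {f h}

lemma FinGSet.pb_comm (w : FinGSet.pb f h) :
    f (FinGSet.fst f h w) = h (FinGSet.snd f h w) :=
  (FinGSet.equiv (FinGSet.fib f h) w).2

lemma FinGSet.pb_ext {w w' : FinGSet.pb f h}
    (h₁ : FinGSet.fst f h w = FinGSet.fst f h w')
    (h₂ : FinGSet.snd f h w = FinGSet.snd f h w') : w = w' :=
  (FinGSet.equiv (FinGSet.fib f h)).injective (Subtype.ext (Prod.ext h₁ h₂))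

/-- The point of a fibre product given by a pair of points. -/
noncomputable def FinGSet.pbMk (s : S) (t : T) (e : f s = h t) : FinGSet.pb f h :=
  (FinGSet.equiv (FinGSet.fib f h)).symm ⟨(s, t), e⟩

@[simp] lemma FinGSet.fst_pbMk (s : S) (t : T) (e : f s = h t) :
    FinGSet.fst f h (FinGSet.pbMk s t e) = s := by
  show (FinGSet.equiv (FinGSet.fib f h) ((FinGSet.equiv (FinGSet.fib f h)).symm _)).1.1 = s
  rw [Equiv.apply_symm_apply]

@[simp] lemma FinGSet.snd_pbMk (s : S) (t : T) (e : f s = h t) :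
    FinGSet.snd f h (FinGSet.pbMk s t e) = t := by
  show (FinGSet.equiv (FinGSet.fib f h) ((FinGSet.equiv (FinGSet.fib f h)).symm _)).1.2 = t
  rw [Equiv.apply_symm_apply]

/-- The map into a fibre product given by a commutative square. -/
noncomputable def FinGSet.pbLift (a : W →[G] S) (b : W →[G] T) (e : ∀ w, f (a w) = h (b w)) :
    W →[G] FinGSet.pb f h where
  toFun w := FinGSet.pbMk (a w) (b w) (e w)
  map_smul' g w := by
    apply FinGSet.pb_ext <;> simp

@[simp] lemma FinGSet.fst_pbLift (a : W →[G] S) (b : W →[G] T) (e) (w : W) :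
    FinGSet.fst f h (FinGSet.pbLift a b e w) = a w := FinGSet.fst_pbMk _ _ _

@[simp] lemma FinGSet.snd_pbLift (a : W →[G] S) (b : W →[G] T) (e) (w : W) :
    FinGSet.snd f h (FinGSet.pbLift a b e w) = b w := FinGSet.snd_pbMk _ _ _

end

/-- The square `f ∘ p = h ∘ q` of finite `G`-sets is a pullback square. -/
structure IsPb {W S T U : FinGSet G} (p : W →[G] S) (q : W →[G] T) (f : S →[G] U)
    (h : T →[G] U) : Prop where
  comm : ∀ w, f (p w) = h (q w)
  existsUnique : ∀ s t, f s = h t → ∃! w, p w = s ∧ q w = t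

/-- The maps `i` and `j` exhibit `U` as the disjoint union of `S` and `T`. -/
def IsCoprod {S T U : FinGSet G} (i : S →[G] U) (j : T →[G] U) : Prop :=
  Function.Bijective (Sum.elim i j)

lemma isPb_pb {S T U : FinGSet G} (f : S →[G] U) (h : T →[G] U) :
    IsPb (FinGSet.fst f h) (FinGSet.snd f h) f h where
  comm := FinGSet.pb_comm
  existsUnique s t e := ⟨FinGSet.pbMk s t e, by simp, fun w hw => FinGSet.pb_ext
    (by simp [hw.1]) (by simp [hw.2])⟩

/-- The empty `G`-set. -/
noncomputable def FinGSet.empty : FinGSet G where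
  card := 0
  act := { smul := fun _ x => x.elim0, one_smul := fun x => x.elim0, mul_smul := fun _ _ x => x.elim0 }

instance : IsEmpty (FinGSet.empty (G := G)) := inferInstanceAs (IsEmpty (Fin 0))

/-- The map out of an empty `G`-set. -/
def emptyMap (S T : FinGSet G) [IsEmpty S] : S →[G] T where
  toFun x := isEmptyElim x
  map_smul' _ x := isEmptyElim x

lemma IsCoprod.pb {S T U V : FinGSet G} {i : S →[G] U} {j : T →[G] U} (hij : IsCoprod i j)
    (f : V →[G] U) : IsCoprod (FinGSet.fst f i) (FinGSet.fst f j) := by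
  constructor
  · rintro (a | a) (b | b) hab <;> simp only [Sum.elim_inl, Sum.elim_inr] at hab
    · congr 1
      refine FinGSet.pb_ext hab ?_
      have : i (FinGSet.snd f i a) = i (FinGSet.snd f i b) := by
        rw [← FinGSet.pb_comm, ← FinGSet.pb_comm, hab]
      exact Sum.inl_injective (hij.1 (a₁ := Sum.inl _) (a₂ := Sum.inl _) this)
    · have : i (FinGSet.snd f i a) = j (FinGSet.snd f j b) := by
        rw [← FinGSet.pb_comm, ← FinGSet.pb_comm, hab]
      exact absurd (hij.1 (a₁ := Sum.inl _) (a₂ := Sum.inr _) this) (by simp)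
    · have : j (FinGSet.snd f j a) = i (FinGSet.snd f i b) := by
        rw [← FinGSet.pb_comm, ← FinGSet.pb_comm, hab]
      exact absurd (hij.1 (a₁ := Sum.inr _) (a₂ := Sum.inl _) this) (by simp)
    · congr 1
      refine FinGSet.pb_ext hab ?_
      have : j (FinGSet.snd f j a) = j (FinGSet.snd f j b) := by
        rw [← FinGSet.pb_comm, ← FinGSet.pb_comm, hab]
      exact Sum.inr_injective (hij.1 (a₁ := Sum.inr _) (a₂ := Sum.inr _) this)
  · intro v
    obtain ⟨s | t, hs⟩ := hij.2 (f v)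
    · exact ⟨Sum.inl (FinGSet.pbMk v s hs.symm), FinGSet.fst_pbMk _ _ _⟩
    · exact ⟨Sum.inr (FinGSet.pbMk v t hs.symm), FinGSet.fst_pbMk _ _ _⟩

lemma isCoprod_of_bijective {S S' : FinGSet G} (σ : S' →[G] S) (hσ : Function.Bijective σ)
    (T : FinGSet G) [IsEmpty T] : IsCoprod σ (emptyMap T S) := by
  constructor
  · rintro (a | a) (b | b) hab
    · exact congrArg _ (hσ.1 hab)
    · exact isEmptyElim b
    · exact isEmptyElim a
    · exact isEmptyElim a
  · intro s
    obtain ⟨t, ht⟩ := hσ.2 s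
    exact ⟨Sum.inl t, ht⟩

lemma isCoprod_of_isEmpty {S : FinGSet G} [IsEmpty S] :
    IsCoprod (MulActionHom.id G : S →[G] S) (MulActionHom.id G : S →[G] S) := by
  constructor
  · rintro (a | a) _ _ <;> exact isEmptyElim a
  · exact fun s => isEmptyElim s

end FiniteGSets

/-! ### Mackey functors -/

/-- A Mackey functor for the finite group `G`: an additive functor on the Burnside category of
finite `G`-sets, given by its values on finite `G`-sets and its values on the forward spans
(`tr`, transfers) and on the backward spans (`res`, restrictions).  Functoriality for composite
spans is the double coset formula `mackey` for pullback squares, and `additive` says that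
disjoint unions go to direct sums (in particular the value on the empty set is zero). -/
structure MackeyFunctor (G : Type) [Group G] where
  obj : FinGSet G → Type u
  [grp : ∀ S, AddCommGroup (obj S)]
  tr : ∀ {S T : FinGSet G}, (S →[G] T) → (obj S →+ obj T)
  res : ∀ {S T : FinGSet G}, (S →[G] T) → (obj T →+ obj S)
  tr_id : ∀ {S : FinGSet G} (x : obj S), tr (MulActionHom.id G) x = x
  res_id : ∀ {S : FinGSet G} (x : obj S), res (MulActionHom.id G) x = x
  tr_comp : ∀ {S T U : FinGSet G} (f : S →[G] T) (h : T →[G] U) (x : obj S),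
    tr (h.comp f) x = tr h (tr f x)
  res_comp : ∀ {S T U : FinGSet G} (f : S →[G] T) (h : T →[G] U) (x : obj U),
    res (h.comp f) x = res f (res h x)
  mackey : ∀ {W S T U : FinGSet G} {p : W →[G] S} {q : W →[G] T} {f : S →[G] U} {h : T →[G] U},
    IsPb p q f h → ∀ x : obj S, res h (tr f x) = tr q (res p x)
  additive : ∀ {S T U : FinGSet G} {i : S →[G] U} {j : T →[G] U}, IsCoprod i j →
    Function.Bijective (fun x : obj U => (res i x, res j x))

attribute [instance] MackeyFunctor.grp

namespace MackeyFunctor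

variable {G : Type} [Group G]

lemma subsingleton_of_isEmpty (M : MackeyFunctor.{u} G) (S : FinGSet G) [IsEmpty S] :
    Subsingleton (M.obj S) := by
  refine ⟨fun a b => ?_⟩
  obtain ⟨x, hx⟩ := (M.additive (isCoprod_of_isEmpty (S := S))).2 (a, b)
  have h₁ := congrArg Prod.fst hx
  have h₂ := congrArg Prod.snd hx
  simp only [M.res_id] at h₁ h₂
  rw [← h₁, ← h₂]

lemma isPb_self_of_injective {S U : FinGSet G} {i : S →[G] U} (hi : Function.Injective i) :
    IsPb (MulActionHom.id G : S →[G] S) (MulActionHom.id G) i i where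
  comm _ := rfl
  existsUnique s _ e := ⟨s, ⟨rfl, hi e⟩, fun _ hw => hw.1⟩

lemma isPb_empty {S T U : FinGSet G} {i : S →[G] U} {j : T →[G] U} (hij : IsCoprod i j) :
    IsPb (emptyMap FinGSet.empty S) (emptyMap FinGSet.empty T) i j where
  comm w := isEmptyElim w
  existsUnique s t e :=
    absurd (hij.1 (a₁ := Sum.inl s) (a₂ := Sum.inr t) e) (by simp)

lemma IsCoprod.symm' {S T U : FinGSet G} {i : S →[G] U} {j : T →[G] U} (hij : IsCoprod i j) :
    IsCoprod j i := by
  have : (Sum.elim j i : T ⊕ S → U) = Sum.elim i j ∘ Sum.swap := by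
    funext x; rcases x with x | x <;> rfl
  unfold IsCoprod
  rw [this]
  exact hij.comp (Equiv.sumComm _ _).bijective

lemma IsCoprod.inl_injective {S T U : FinGSet G} {i : S →[G] U} {j : T →[G] U}
    (hij : IsCoprod i j) : Function.Injective i := fun _ _ e =>
  Sum.inl_injective (hij.1 (a₁ := Sum.inl _) (a₂ := Sum.inl _) e)

/-- The projector form of additivity. -/
lemma decomp (M : MackeyFunctor.{u} G) {S T U : FinGSet G} {i : S →[G] U} {j : T →[G] U}
    (hij : IsCoprod i j) (x : M.obj U) : x = M.tr i (M.res i x) + M.tr j (M.res j x) := by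
  have := M.subsingleton_of_isEmpty FinGSet.empty
  apply (M.additive hij).1
  have hi := isPb_self_of_injective (IsCoprod.inl_injective hij)
  have hj := isPb_self_of_injective (IsCoprod.inl_injective (IsCoprod.symm' hij))
  simp only [map_add, M.mackey hi, M.mackey hj, M.mackey (isPb_empty hij),
    M.mackey (isPb_empty (IsCoprod.symm' hij)), M.tr_id, M.res_id, Prod.mk.injEq]
  constructor
  · rw [Subsingleton.elim (M.res (emptyMap FinGSet.empty T) _) 0, map_zero, add_zero]
  · rw [Subsingleton.elim (M.res (emptyMap FinGSet.empty S) _) 0, map_zero, zero_add]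

/-- The projector form of additivity implies additivity. -/
lemma bijective_of_decomp {obj : FinGSet G → Type u} [∀ S, AddCommGroup (obj S)]
    {tr : ∀ {S T : FinGSet G}, (S →[G] T) → (obj S →+ obj T)}
    {res : ∀ {S T : FinGSet G}, (S →[G] T) → (obj T →+ obj S)}
    (tr_id : ∀ {S : FinGSet G} (x : obj S), tr (MulActionHom.id G) x = x)
    (res_id : ∀ {S : FinGSet G} (x : obj S), res (MulActionHom.id G) x = x)
    (mackey : ∀ {W S T U : FinGSet G} {p : W →[G] S} {q : W →[G] T} {f : S →[G] U}
      {h : T →[G] U}, IsPb p q f h → ∀ x : obj S, res h (tr f x) = tr q (res p x))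
    (dec : ∀ {S T U : FinGSet G} {i : S →[G] U} {j : T →[G] U}, IsCoprod i j →
      ∀ x : obj U, x = tr i (res i x) + tr j (res j x))
    {S T U : FinGSet G} {i : S →[G] U} {j : T →[G] U} (hij : IsCoprod i j) :
    Function.Bijective (fun x : obj U => (res i x, res j x)) := by
  have hE : ∀ y : obj (FinGSet.empty (G := G)), y = 0 := fun y => by
    have := dec (isCoprod_of_isEmpty (S := FinGSet.empty (G := G))) y
    rw [res_id, tr_id] at this
    exact left_eq_add.mp this
  constructor
  · intro x y hxy
    simp only [Prod.mk.injEq] at hxy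
    rw [dec hij x, dec hij y, hxy.1, hxy.2]
  · rintro ⟨a, b⟩
    refine ⟨tr i a + tr j b, ?_⟩
    have hi := isPb_self_of_injective (IsCoprod.inl_injective hij)
    have hj := isPb_self_of_injective (IsCoprod.inl_injective (IsCoprod.symm' hij))
    simp only [map_add, mackey hi, mackey hj, mackey (isPb_empty hij),
      mackey (isPb_empty (IsCoprod.symm' hij)), tr_id, res_id, hE, map_zero, add_zero, zero_add]

/-- Constructor with the projector form of additivity. -/
def ofDecomp (obj : FinGSet G → Type u) [grp : ∀ S, AddCommGroup (obj S)]
    (tr : ∀ {S T : FinGSet G}, (S →[G] T) → (obj S →+ obj T))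
    (res : ∀ {S T : FinGSet G}, (S →[G] T) → (obj T →+ obj S))
    (tr_id : ∀ {S : FinGSet G} (x : obj S), tr (MulActionHom.id G) x = x)
    (res_id : ∀ {S : FinGSet G} (x : obj S), res (MulActionHom.id G) x = x)
    (tr_comp : ∀ {S T U : FinGSet G} (f : S →[G] T) (h : T →[G] U) (x : obj S),
      tr (h.comp f) x = tr h (tr f x))
    (res_comp : ∀ {S T U : FinGSet G} (f : S →[G] T) (h : T →[G] U) (x : obj U),
      res (h.comp f) x = res f (res h x))
    (mackey : ∀ {W S T U : FinGSet G} {p : W →[G] S} {q : W →[G] T} {f : S →[G] U}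
      {h : T →[G] U}, IsPb p q f h → ∀ x : obj S, res h (tr f x) = tr q (res p x))
    (dec : ∀ {S T U : FinGSet G} {i : S →[G] U} {j : T →[G] U}, IsCoprod i j →
      ∀ x : obj U, x = tr i (res i x) + tr j (res j x)) : MackeyFunctor.{u} G where
  obj := obj
  tr := tr
  res := res
  tr_id := tr_id
  res_id := res_id
  tr_comp := tr_comp
  res_comp := res_comp
  mackey := mackey
  additive hij := bijective_of_decomp tr_id res_id mackey dec hij

lemma res_eq (M : MackeyFunctor.{u} G) {S T : FinGSet G} {f f' : S →[G] T}
    (h : ∀ s, f s = f' s) (x : M.obj T) : M.res f x = M.res f' x := by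
  rw [MulActionHom.ext h]

lemma tr_eq (M : MackeyFunctor.{u} G) {S T : FinGSet G} {f f' : S →[G] T}
    (h : ∀ s, f s = f' s) (x : M.obj S) : M.tr f x = M.tr f' x := by
  rw [MulActionHom.ext h]

/-- A morphism of Mackey functors. -/
@[ext]
structure Hom (M N : MackeyFunctor.{u} G) where
  app : ∀ S, M.obj S →+ N.obj S
  app_tr : ∀ {S T : FinGSet G} (f : S →[G] T) (x : M.obj S),
    app T (M.tr f x) = N.tr f (app S x)
  app_res : ∀ {S T : FinGSet G} (f : S →[G] T) (x : M.obj T),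
    app S (M.res f x) = N.res f (app T x)

@[simps]
instance : Category (MackeyFunctor.{u} G) where
  Hom := Hom
  id M := ⟨fun _ => AddMonoidHom.id _, fun _ _ => rfl, fun _ _ => rfl⟩
  comp φ ψ := ⟨fun S => (ψ.app S).comp (φ.app S),
    fun f x => by simp [φ.app_tr, ψ.app_tr], fun f x => by simp [φ.app_res, ψ.app_res]⟩

variable {M N P : MackeyFunctor.{u} G}

lemma hom_ext {φ ψ : M ⟶ N} (h : ∀ S x, φ.app S x = ψ.app S x) : φ = ψ :=
  Hom.ext (funext fun S => AddMonoidHom.ext (h S))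

lemma comp_apply (φ : M ⟶ N) (ψ : N ⟶ P) (S : FinGSet G) (x : M.obj S) :
    (φ ≫ ψ).app S x = ψ.app S (φ.app S x) := rfl

lemma id_apply (S : FinGSet G) (x : M.obj S) : Hom.app (𝟙 M) S x = x := rfl

lemma app_tr' (φ : M ⟶ N) {S T : FinGSet G} (f : S →[G] T) (x : M.obj S) :
    φ.app T (M.tr f x) = N.tr f (φ.app S x) := Hom.app_tr φ f x

lemma app_res' (φ : M ⟶ N) {S T : FinGSet G} (f : S →[G] T) (x : M.obj T) :
    φ.app S (M.res f x) = N.res f (φ.app T x) := Hom.app_res φ f x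

instance : Add (M ⟶ N) := ⟨fun φ ψ => ⟨fun S => φ.app S + ψ.app S,
  fun f x => by simp [Hom.app_tr], fun f x => by simp [Hom.app_res]⟩⟩

instance : Zero (M ⟶ N) := ⟨⟨fun _ => 0, fun f x => by simp, fun f x => by simp⟩⟩

instance : Neg (M ⟶ N) := ⟨fun φ => ⟨fun S => -φ.app S,
  fun f x => by simp [Hom.app_tr], fun f x => by simp [Hom.app_res]⟩⟩

lemma add_apply (φ ψ : M ⟶ N) (S : FinGSet G) (x : M.obj S) :
    (φ + ψ).app S x = φ.app S x + ψ.app S x := rfl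

lemma zero_apply (S : FinGSet G) (x : M.obj S) : Hom.app (0 : M ⟶ N) S x = 0 := rfl

lemma neg_apply (φ : M ⟶ N) (S : FinGSet G) (x : M.obj S) :
    (-φ).app S x = -φ.app S x := rfl

instance : AddCommGroup (M ⟶ N) where
  add_assoc a b c := hom_ext fun S x => by simp only [add_apply, add_assoc]
  zero_add a := hom_ext fun S x => by simp only [add_apply, zero_apply, zero_add]
  add_zero a := hom_ext fun S x => by simp only [add_apply, zero_apply, add_zero]
  neg_add_cancel a := hom_ext fun S x => by
    simp only [add_apply, zero_apply, neg_apply, neg_add_cancel]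
  add_comm a b := hom_ext fun S x => by simp only [add_apply, add_comm]
  nsmul := nsmulRec
  zsmul := zsmulRec

instance : Preadditive (MackeyFunctor.{u} G) where
  add_comp _ _ _ _ _ _ := hom_ext fun S x => by simp only [add_apply, comp_apply, map_add]
  comp_add _ _ _ _ _ _ := hom_ext fun S x => by simp only [add_apply, comp_apply]

/-! #### The abelian category of Mackey functors -/

/-- The product of a family of Mackey functors. -/
def pi {J : Type} (F : J → MackeyFunctor.{u} G) : MackeyFunctor.{u} G :=
  ofDecomp (fun S => ∀ j, (F j).obj S)
    (fun f => AddMonoidHom.mk' (fun x j => (F j).tr f (x j)) fun x y => by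
      funext j; simp)
    (fun f => AddMonoidHom.mk' (fun x j => (F j).res f (x j)) fun x y => by
      funext j; simp)
    (fun _ => funext fun j => (F j).tr_id _)
    (fun _ => funext fun j => (F j).res_id _)
    (fun _ _ _ => funext fun j => (F j).tr_comp _ _ _)
    (fun _ _ _ => funext fun j => (F j).res_comp _ _ _)
    (fun hp _ => funext fun j => (F j).mackey hp _)
    (fun hij _ => funext fun j => (F j).decomp hij _)

/-- The kernel of a morphism of Mackey functors. -/
def ker (φ : M ⟶ N) : MackeyFunctor.{u} G :=
  ofDecomp (fun S => (φ.app S).ker)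
    (fun f => ((M.tr f).comp (AddSubgroup.subtype _)).codRestrict _ fun x => by
      show φ.app _ (M.tr f x) = 0
      rw [app_tr', show φ.app _ x.1 = 0 from x.2, map_zero])
    (fun f => ((M.res f).comp (AddSubgroup.subtype _)).codRestrict _ fun x => by
      show φ.app _ (M.res f x) = 0
      rw [app_res', show φ.app _ x.1 = 0 from x.2, map_zero])
    (fun _ => Subtype.ext (M.tr_id _))
    (fun _ => Subtype.ext (M.res_id _))
    (fun _ _ _ => Subtype.ext (M.tr_comp _ _ _))
    (fun _ _ _ => Subtype.ext (M.res_comp _ _ _))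
    (fun hp _ => Subtype.ext (M.mackey hp _))
    (fun hij _ => Subtype.ext (M.decomp hij _))

/-- The inclusion of the kernel. -/
def kerι (φ : M ⟶ N) : ker φ ⟶ M where
  app S := AddSubgroup.subtype (φ.app S).ker
  app_tr _ _ := rfl
  app_res _ _ := rfl

lemma kerι_comp (φ : M ⟶ N) : kerι φ ≫ φ = 0 := hom_ext fun S x => (show (φ.app S).ker from x).2

/-- The cokernel of a morphism of Mackey functors. -/
def coker (φ : M ⟶ N) : MackeyFunctor.{u} G :=
  ofDecomp (fun S => N.obj S ⧸ (φ.app S).range)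
    (fun f => QuotientAddGroup.map _ _ (N.tr f) (by
      rintro _ ⟨x, rfl⟩
      exact ⟨M.tr f x, app_tr' φ f x⟩))
    (fun f => QuotientAddGroup.map _ _ (N.res f) (by
      rintro _ ⟨x, rfl⟩
      exact ⟨M.res f x, app_res' φ f x⟩))
    (by rintro _ ⟨x⟩; exact congrArg (QuotientAddGroup.mk' _) (N.tr_id x))
    (by rintro _ ⟨x⟩; exact congrArg (QuotientAddGroup.mk' _) (N.res_id x))
    (by rintro _ _ _ f h ⟨x⟩; exact congrArg (QuotientAddGroup.mk' _) (N.tr_comp f h x))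
    (by rintro _ _ _ f h ⟨x⟩; exact congrArg (QuotientAddGroup.mk' _) (N.res_comp f h x))
    (by rintro _ _ _ _ _ _ _ _ hp ⟨x⟩; exact congrArg (QuotientAddGroup.mk' _) (N.mackey hp x))
    (by rintro _ _ _ _ _ hij ⟨x⟩; exact congrArg (QuotientAddGroup.mk' _) (N.decomp hij x))

/-- The projection to the cokernel. -/
def cokerπ (φ : M ⟶ N) : N ⟶ coker φ where
  app S := QuotientAddGroup.mk' (φ.app S).range
  app_tr _ _ := rfl
  app_res _ _ := rfl

lemma comp_cokerπ (φ : M ⟶ N) : φ ≫ cokerπ φ = 0 :=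
  hom_ext fun _ x => (QuotientAddGroup.eq_zero_iff _).mpr (⟨x, rfl⟩ : _ ∈ (φ.app _).range)

lemma app_eq_zero_of_comp {φ : M ⟶ N} {ψ : N ⟶ P} (w : φ ≫ ψ = 0) (S : FinGSet G)
    (x : M.obj S) : ψ.app S (φ.app S x) = 0 := by
  rw [← comp_apply, w, zero_apply]

/-- A levelwise injective morphism with levelwise exactness is a kernel. -/
noncomputable def isLimitOfInjective {φ : M ⟶ N} {ψ : N ⟶ P} (w : φ ≫ ψ = 0)
    (inj : ∀ S, Function.Injective (φ.app S))
    (ex : ∀ S y, ψ.app S y = 0 → ∃ x, φ.app S x = y) :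
    IsLimit (KernelFork.ofι φ w) := by
  have key : ∀ {Z : MackeyFunctor.{u} G} (k : Z ⟶ N), k ≫ ψ = 0 →
      ∃ l : Z ⟶ M, l ≫ φ = k := fun {Z} k hk => by
    choose l hl using fun S (z : Z.obj S) => ex S (k.app S z) (app_eq_zero_of_comp hk S z)
    refine ⟨⟨fun S => AddMonoidHom.mk' (l S) fun a b => inj S ?_, fun f x => inj _ ?_,
      fun f x => inj _ ?_⟩, hom_ext fun S x => hl S x⟩
    · simp only [map_add, hl]
    · show φ.app _ (l _ _) = φ.app _ (M.tr f (l _ x))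
      rw [app_tr', hl, hl, app_tr']
    · show φ.app _ (l _ _) = φ.app _ (M.res f (l _ x))
      rw [app_res', hl, hl, app_res']
  choose l hl using @key
  refine KernelFork.IsLimit.ofι φ w (fun k hk => l k hk) (fun k hk => hl k hk) ?_
  intro Z k hk m hm
  refine hom_ext fun S x => inj S ?_
  rw [← comp_apply, ← comp_apply, hm, hl]

/-- A levelwise surjective morphism with levelwise exactness is a cokernel. -/
noncomputable def isColimitOfSurjective {φ : M ⟶ N} {ψ : N ⟶ P} (w : φ ≫ ψ = 0)
    (surj : ∀ S, Function.Surjective (ψ.app S))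
    (ex : ∀ S y, ψ.app S y = 0 → ∃ x, φ.app S x = y) :
    IsColimit (CokernelCofork.ofπ ψ w) := by
  have key : ∀ {Z : MackeyFunctor.{u} G} (k : N ⟶ Z), φ ≫ k = 0 →
      ∃ l : P ⟶ Z, ψ ≫ l = k := fun {Z} k hk => by
    have hk' : ∀ S y y', ψ.app S y = ψ.app S y' → k.app S y = k.app S y' := fun S y y' h => by
      obtain ⟨x, hx⟩ := ex S (y - y') (by rw [map_sub, h, sub_self])
      have := app_eq_zero_of_comp hk S x
      rw [hx, map_sub, sub_eq_zero] at this
      exact this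
    choose s hs using surj
    refine ⟨⟨fun S => AddMonoidHom.mk' (fun p => k.app S (s S p)) fun a b => ?_,
      fun f x => ?_, fun f x => ?_⟩, hom_ext fun S x => ?_⟩
    · rw [← map_add]
      exact hk' _ _ _ (by simp only [map_add, hs])
    · show k.app _ (s _ _) = Z.tr f (k.app _ (s _ x))
      rw [← app_tr']
      exact hk' _ _ _ (by rw [hs, app_tr', hs])
    · show k.app _ (s _ _) = Z.res f (k.app _ (s _ x))
      rw [← app_res']
      exact hk' _ _ _ (by rw [hs, app_res', hs])
    · exact hk' _ _ _ (by rw [hs])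
  choose l hl using @key
  refine CokernelCofork.IsColimit.ofπ ψ w (fun k hk => l k hk) (fun k hk => hl k hk) ?_
  intro Z k hk m hm
  refine hom_ext fun S x => ?_
  obtain ⟨y, rfl⟩ := surj S x
  rw [← comp_apply, ← comp_apply, hm, hl]

instance : HasKernels (MackeyFunctor.{u} G) where
  has_limit φ := ⟨⟨_, isLimitOfInjective (kerι_comp φ) (fun _ => Subtype.val_injective)
    (fun _ y hy => ⟨⟨y, hy⟩, rfl⟩)⟩⟩

instance : HasCokernels (MackeyFunctor.{u} G) where
  has_colimit φ := ⟨⟨_, isColimitOfSurjective (comp_cokerπ φ)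
    (fun _ => QuotientAddGroup.mk'_surjective _)
    (fun _ _ hy => (QuotientAddGroup.eq_zero_iff _).mp hy)⟩⟩

lemma injective_of_mono (φ : M ⟶ N) [Mono φ] (S : FinGSet G) : Function.Injective (φ.app S) := by
  have h : kerι φ = 0 := by
    rw [← cancel_mono φ, kerι_comp, zero_comp]
  refine (injective_iff_map_eq_zero _).mpr fun x hx => ?_
  exact congrArg (fun k : ker φ ⟶ M => k.app S ⟨x, hx⟩) h

lemma surjective_of_epi (φ : M ⟶ N) [Epi φ] (S : FinGSet G) : Function.Surjective (φ.app S) := by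
  have h : cokerπ φ = 0 := by
    rw [← cancel_epi φ, comp_cokerπ, comp_zero]
  intro y
  have := congrArg (fun k : N ⟶ coker φ => k.app S y) h
  exact (QuotientAddGroup.eq_zero_iff y).mp this

instance : IsNormalMonoCategory (MackeyFunctor.{u} G) where
  normalMonoOfMono φ _ := ⟨⟨_, cokerπ φ, comp_cokerπ φ,
    isLimitOfInjective _ (injective_of_mono φ)
      (fun _ _ hy => (QuotientAddGroup.eq_zero_iff _).mp hy)⟩⟩

instance : IsNormalEpiCategory (MackeyFunctor.{u} G) where
  normalEpiOfEpi φ _ := ⟨⟨_, kerι φ, kerι_comp φ,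
    isColimitOfSurjective _ (surjective_of_epi φ) (fun _ y hy => ⟨⟨y, hy⟩, rfl⟩)⟩⟩

lemma hasProduct_pi {J : Type} (F : J → MackeyFunctor.{u} G) : HasProduct F :=
  ⟨⟨⟨Fan.mk (pi F) fun j => ⟨fun _ => Pi.evalAddMonoidHom _ j, fun _ _ => rfl, fun _ _ => rfl⟩,
    Fan.IsLimit.mk _
      (fun s => ⟨fun S => AddMonoidHom.mk' (fun x j => (s.proj j).app S x)
          fun _ _ => funext fun _ => map_add _ _ _,
        fun f x => funext fun j => app_tr' (s.proj j) f x,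
        fun f x => funext fun j => app_res' (s.proj j) f x⟩)
      (fun _ _ => rfl)
      (fun s _ hm => hom_ext fun S x => funext fun j =>
        congrArg (fun k : s.pt ⟶ F j => k.app S x) (hm j))⟩⟩⟩

instance : HasFiniteProducts (MackeyFunctor.{u} G) where
  out _ := ⟨fun F => by
    have : HasLimit (Discrete.functor (F.obj ∘ Discrete.mk)) := hasProduct_pi _
    exact hasLimit_of_iso Discrete.natIsoFunctor.symm⟩

instance : Abelian (MackeyFunctor.{u} G) where

end MackeyFunctor

/-! ### Mackey functors given by generators and relations -/

/-- A contravariant set-valued functor on finite `G`-sets. -/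
structure GCoeff (G : Type) [Group G] where
  obj : FinGSet G → Type u
  res : ∀ {S T : FinGSet G}, (S →[G] T) → obj T → obj S
  res_id : ∀ {S : FinGSet G} (x : obj S), res (MulActionHom.id G) x = x
  res_comp : ∀ {S T U : FinGSet G} (f : S →[G] T) (h : T →[G] U) (x : obj U),
    res (h.comp f) x = res f (res h x)

namespace GCoeff

variable {G : Type} [Group G] (D : GCoeff.{u} G)

/-- The generators over `S`: pairs of `f : T → S` and `d ∈ D(T)`, written `tr_f d`. -/
abbrev Gen (S : FinGSet G) : Type u := Σ T : FinGSet G, (T →[G] S) × D.obj T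

variable {D}

/-- The generator `tr_f d` in the free abelian group. -/
def gen {S T : FinGSet G} (f : T →[G] S) (d : D.obj T) : FreeAbelianGroup (D.Gen S) :=
  FreeAbelianGroup.of ⟨T, f, d⟩

/-- The homomorphism out of the free abelian group given by its values on generators. -/
def ev {S : FinGSet G} {A : Type*} [AddCommGroup A]
    (φ : ∀ T : FinGSet G, (T →[G] S) → D.obj T → A) : FreeAbelianGroup (D.Gen S) →+ A :=
  FreeAbelianGroup.lift fun x => φ x.1 x.2.1 x.2.2

@[simp] lemma ev_gen {S T : FinGSet G} {A : Type*} [AddCommGroup A]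
    (φ : ∀ T : FinGSet G, (T →[G] S) → D.obj T → A) (f : T →[G] S) (d : D.obj T) :
    ev φ (gen f d) = φ T f d := FreeAbelianGroup.lift_apply_of _ _

lemma map_ev {S : FinGSet G} {A B : Type*} [AddCommGroup A] [AddCommGroup B] (χ : A →+ B)
    (φ : ∀ T : FinGSet G, (T →[G] S) → D.obj T → A) (e : FreeAbelianGroup (D.Gen S)) :
    χ (ev φ e) = ev (fun T f d => χ (φ T f d)) e :=
  DFunLike.congr_fun (f := χ.comp (ev φ)) (FreeAbelianGroup.lift_ext _ _ fun ⟨_, f, d⟩ =>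
    (congrArg χ (ev_gen φ f d)).trans (ev_gen (fun T f d => χ (φ T f d)) f d).symm) e

lemma ev_apply {S : FinGSet G} {A B : Type*} [AddCommGroup A] [AddCommGroup B]
    (φ : ∀ T : FinGSet G, (T →[G] S) → D.obj T → (A →+ B)) (e : FreeAbelianGroup (D.Gen S))
    (x : A) : ev φ e x = ev (fun T f d => φ T f d x) e :=
  map_ev (AddMonoidHom.mk' (fun ψ : A →+ B => ψ x) fun _ _ => rfl) φ e

variable (D) in
/-- Transfer on the free abelian groups: `tr_h (tr_f d) = tr_{h ∘ f} d`. -/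
def freeTr {S S' : FinGSet G} (h : S →[G] S') :
    FreeAbelianGroup (D.Gen S) →+ FreeAbelianGroup (D.Gen S') :=
  ev fun _ f d => gen (h.comp f) d

variable (D) in
/-- Restriction on the free abelian groups, by the double coset formula. -/
noncomputable def freeRes {S S' : FinGSet G} (h : S' →[G] S) :
    FreeAbelianGroup (D.Gen S) →+ FreeAbelianGroup (D.Gen S') :=
  ev fun _ f d => gen (FinGSet.snd f h) (D.res (FinGSet.fst f h) d)

@[simp] lemma freeTr_gen {S S' T : FinGSet G} (h : S →[G] S') (f : T →[G] S) (d : D.obj T) :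
    D.freeTr h (gen f d) = gen (h.comp f) d := ev_gen _ _ _

@[simp] lemma freeRes_gen {S S' T : FinGSet G} (h : S' →[G] S) (f : T →[G] S) (d : D.obj T) :
    D.freeRes h (gen f d) = gen (FinGSet.snd f h) (D.res (FinGSet.fst f h) d) := ev_gen _ _ _

lemma free_hom_ext {S : FinGSet G} {A : Type*} [AddCommGroup A]
    {φ ψ : FreeAbelianGroup (D.Gen S) →+ A}
    (h : ∀ (T : FinGSet G) (f : T →[G] S) (d : D.obj T), φ (gen f d) = ψ (gen f d)) : φ = ψ :=
  FreeAbelianGroup.lift_ext _ _ fun ⟨T, f, d⟩ => h T f d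

/-- The relation that a generator over a disjoint union is the sum of its two restrictions. -/
inductive Split : ∀ T : FinGSet G, FreeAbelianGroup (D.Gen T) → Prop
  | mk {T T₁ T₂ : FinGSet G} (i : T₁ →[G] T) (j : T₂ →[G] T) (hij : IsCoprod i j) (d : D.obj T) :
    Split T (gen (MulActionHom.id G) d - gen i (D.res i d) - gen j (D.res j d))

variable (D) in
/-- The subgroup of relations over `S`: all transfers to `S` of the relations `E` and of the
relations for disjoint unions. -/
def rel (E : ∀ T : FinGSet G, FreeAbelianGroup (D.Gen T) → Prop) (S : FinGSet G) :
    AddSubgroup (FreeAbelianGroup (D.Gen S)) :=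
  AddSubgroup.closure
    {x | ∃ (T : FinGSet G) (f : T →[G] S) (e : _), (E T e ∨ Split T e) ∧ x = D.freeTr f e}

end GCoeff

/-- Generators and relations for a Mackey functor: the generators over `S` are the transfers of
the elements of `D`, and the relations are closed under restriction. -/
structure Presentation (G : Type) [Group G] where
  D : GCoeff.{u} G
  E : ∀ T : FinGSet G, FreeAbelianGroup (D.Gen T) → Prop
  res_mem : ∀ {T T' : FinGSet G} (h : T' →[G] T) (e : _), E T e → D.freeRes h e ∈ D.rel E T'

namespace Presentation

open GCoeff

variable {G : Type} [Group G] (Q : Presentation.{u} G)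

/-- The group presented over `S`. -/
def Obj (S : FinGSet G) : Type u := FreeAbelianGroup (Q.D.Gen S) ⧸ Q.D.rel Q.E S

instance (S : FinGSet G) : AddCommGroup (Q.Obj S) :=
  inferInstanceAs (AddCommGroup (FreeAbelianGroup (Q.D.Gen S) ⧸ Q.D.rel Q.E S))

/-- The class of an element of the free abelian group. -/
def proj (S : FinGSet G) : FreeAbelianGroup (Q.D.Gen S) →+ Q.Obj S :=
  QuotientAddGroup.mk' (Q.D.rel Q.E S)

variable {Q}

/-- The class of the generator `tr_f d`. -/
def cls {S T : FinGSet G} (f : T →[G] S) (d : Q.D.obj T) : Q.Obj S := Q.proj S (gen f d)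

lemma proj_eq_zero {S : FinGSet G} {x : FreeAbelianGroup (Q.D.Gen S)} :
    Q.proj S x = 0 ↔ x ∈ Q.D.rel Q.E S := QuotientAddGroup.eq_zero_iff x

lemma proj_surjective (S : FinGSet G) : Function.Surjective (Q.proj S) :=
  QuotientAddGroup.mk'_surjective _

lemma obj_hom_ext {S : FinGSet G} {A : Type*} [AddCommGroup A] {φ ψ : Q.Obj S →+ A}
    (h : ∀ (T : FinGSet G) (f : T →[G] S) (d : Q.D.obj T), φ (cls f d) = ψ (cls f d)) :
    φ = ψ := by
  have : φ.comp (Q.proj S) = ψ.comp (Q.proj S) := free_hom_ext h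
  ext x
  obtain ⟨y, rfl⟩ := Q.proj_surjective S x
  exact DFunLike.congr_fun this y

lemma freeTr_comp {S T U : FinGSet G} (f : S →[G] T) (h : T →[G] U)
    (x : FreeAbelianGroup (Q.D.Gen S)) :
    Q.D.freeTr (h.comp f) x = Q.D.freeTr h (Q.D.freeTr f x) := by
  refine DFunLike.congr_fun (f := Q.D.freeTr (h.comp f))
    (g := (Q.D.freeTr h).comp (Q.D.freeTr f)) (free_hom_ext fun V k d => ?_) x
  simp only [AddMonoidHom.comp_apply, freeTr_gen]
  rfl

lemma freeTr_mem {S S' : FinGSet G} (h : S →[G] S') {x : FreeAbelianGroup (Q.D.Gen S)}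
    (hx : x ∈ Q.D.rel Q.E S) : Q.D.freeTr h x ∈ Q.D.rel Q.E S' := by
  induction hx using AddSubgroup.closure_induction with
  | mem x hx =>
    obtain ⟨T, f, e, he, rfl⟩ := hx
    exact AddSubgroup.subset_closure ⟨T, h.comp f, e, he, (freeTr_comp _ _ _).symm⟩
  | zero => simp
  | add x y _ _ hx hy => rw [map_add]; exact add_mem hx hy
  | neg x _ hx => rw [map_neg]; exact neg_mem hx

/-- To define a homomorphism on the presented group, give it on generators and check the
relations. -/
def liftAt {S : FinGSet G} {A : Type*} [AddCommGroup A]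
    (φ : ∀ T : FinGSet G, (T →[G] S) → Q.D.obj T → A)
    (split : ∀ {T T₁ T₂ : FinGSet G} (f : T →[G] S) {i : T₁ →[G] T} {j : T₂ →[G] T},
      IsCoprod i j → ∀ d : Q.D.obj T,
        φ T f d = φ T₁ (f.comp i) (Q.D.res i d) + φ T₂ (f.comp j) (Q.D.res j d))
    (rel : ∀ {T : FinGSet G} (f : T →[G] S) (e : _), Q.E T e →
      ev (fun V k d => φ V (f.comp k) d) e = 0) :
    Q.Obj S →+ A :=
  QuotientAddGroup.lift _ (ev φ) (by
    have key : ∀ {T : FinGSet G} (f : T →[G] S) (e : FreeAbelianGroup (Q.D.Gen T)),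
        ev φ (Q.D.freeTr f e) = ev (fun V k d => φ V (f.comp k) d) e := by
      intro T f e
      refine DFunLike.congr_fun (f := (ev φ).comp (Q.D.freeTr f))
        (free_hom_ext fun V k d => ?_) e
      rw [AddMonoidHom.comp_apply, freeTr_gen, ev_gen, ev_gen]
    rw [GCoeff.rel, AddSubgroup.closure_le]
    rintro _ ⟨T, f, e, he | he, rfl⟩
    · exact (key f e).trans (rel f e he)
    · refine (key f e).trans ?_
      obtain ⟨i, j, hij, d⟩ := he
      simp only [map_sub, ev_gen]
      rw [show f.comp (MulActionHom.id G) = f from rfl, split f hij d]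
      abel)

@[simp] lemma liftAt_cls {S : FinGSet G} {A : Type*} [AddCommGroup A]
    (φ : ∀ T : FinGSet G, (T →[G] S) → Q.D.obj T → A) (split) (rel)
    {T : FinGSet G} (f : T →[G] S) (d : Q.D.obj T) :
    liftAt φ split rel (cls f d) = φ T f d :=
  ev_gen _ _ _

lemma cls_split {S T T₁ T₂ : FinGSet G} (f : T →[G] S) {i : T₁ →[G] T} {j : T₂ →[G] T}
    (hij : IsCoprod i j) (d : Q.D.obj T) :
    cls f d = cls (f.comp i) (Q.D.res i d) + cls (f.comp j) (Q.D.res j d) := by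
  have h : Q.proj S (Q.D.freeTr f
      (gen (MulActionHom.id G) d - gen i (Q.D.res i d) - gen j (Q.D.res j d))) = 0 :=
    proj_eq_zero.mpr (AddSubgroup.subset_closure ⟨T, f, _, Or.inr ⟨i, j, hij, d⟩, rfl⟩)
  simp only [map_sub, freeTr_gen] at h
  rw [sub_sub, sub_eq_zero] at h
  exact h

lemma cls_empty {S T : FinGSet G} [IsEmpty T] (f : T →[G] S) (d : Q.D.obj T) :
    cls f d = 0 := by
  have h := cls_split f (isCoprod_of_isEmpty (S := T)) d
  rw [show f.comp (MulActionHom.id G) = f from rfl, Q.D.res_id] at h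
  exact left_eq_add.mp h

lemma cls_iso {S T T' : FinGSet G} (σ : T' →[G] T) (hσ : Function.Bijective σ)
    {f : T →[G] S} {f' : T' →[G] S} {d : Q.D.obj T} {d' : Q.D.obj T'}
    (hf : ∀ t, f (σ t) = f' t) (hd : Q.D.res σ d = d') : cls f d = cls f' d' := by
  rw [cls_split f (isCoprod_of_bijective σ hσ FinGSet.empty) d,
    cls_empty (f.comp (emptyMap FinGSet.empty T)), add_zero, hd,
    show f.comp σ = f' from MulActionHom.ext hf]

lemma cls_eq_zero_of_rel {S T : FinGSet G} (f : T →[G] S) {e : FreeAbelianGroup (Q.D.Gen T)}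
    (he : Q.E T e) : Q.proj S (Q.D.freeTr f e) = 0 :=
  proj_eq_zero.mpr (AddSubgroup.subset_closure ⟨T, f, e, Or.inl he, rfl⟩)

lemma res_congr {S T : FinGSet G} {f f' : S →[G] T} (h : ∀ s, f s = f' s) (d : Q.D.obj T) :
    Q.D.res f d = Q.D.res f' d := by rw [MulActionHom.ext h]

lemma proj_freeRes_freeTr {W S T U : FinGSet G} {p : W →[G] S} {q : W →[G] T} {f : S →[G] U}
    {h : T →[G] U} (hp : IsPb p q f h) (x : FreeAbelianGroup (Q.D.Gen S)) :
    Q.proj T (Q.D.freeRes h (Q.D.freeTr f x)) = Q.proj T (Q.D.freeTr q (Q.D.freeRes p x)) := by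
  refine DFunLike.congr_fun (f := (Q.proj T).comp ((Q.D.freeRes h).comp (Q.D.freeTr f)))
    (g := (Q.proj T).comp ((Q.D.freeTr q).comp (Q.D.freeRes p)))
    (free_hom_ext fun V k d => ?_) x
  simp only [AddMonoidHom.comp_apply, freeTr_gen, freeRes_gen]
  refine cls_iso (FinGSet.pbLift (FinGSet.fst k p) (q.comp (FinGSet.snd k p)) fun w => ?_)
    ⟨fun a b hab => ?_, fun z => ?_⟩ (fun t => ?_) ?_
  · show f (k _) = h (q _)
    rw [FinGSet.pb_comm, hp.comm]
  · have h₁ := congrArg (FinGSet.fst _ _) hab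
    have h₂ := congrArg (FinGSet.snd _ _) hab
    simp only [FinGSet.fst_pbLift, FinGSet.snd_pbLift] at h₁ h₂
    refine FinGSet.pb_ext h₁ ?_
    refine (hp.existsUnique (k (FinGSet.fst k p a)) (q (FinGSet.snd k p a)) ?_).unique
      ⟨(FinGSet.pb_comm a).symm, rfl⟩ ⟨?_, h₂.symm⟩
    · rw [FinGSet.pb_comm, hp.comm]
    · rw [h₁, FinGSet.pb_comm]
  · obtain ⟨w, ⟨hw₁, hw₂⟩, -⟩ := hp.existsUnique (k (FinGSet.fst _ _ z)) (FinGSet.snd _ _ z)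
      (FinGSet.pb_comm z)
    refine ⟨FinGSet.pbMk (FinGSet.fst _ _ z) w hw₁.symm, FinGSet.pb_ext ?_ ?_⟩
    · rw [FinGSet.fst_pbLift, FinGSet.fst_pbMk]
    · rw [FinGSet.snd_pbLift]
      show q (FinGSet.snd k p _) = _
      rw [FinGSet.snd_pbMk, hw₂]
  · rw [FinGSet.snd_pbLift]
  · rw [← Q.D.res_comp]
    exact res_congr (fun s => FinGSet.fst_pbLift _ _ _ _) d

/-- Interchanging the two factors of a fibre product. -/
lemma cls_swap {S T U V : FinGSet G} (f : T →[G] S) (k : V →[G] S)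
    {d : Q.D.obj (FinGSet.pb f k)} {d' : Q.D.obj (FinGSet.pb k f)}
    (hd : Q.D.res (FinGSet.pbLift (FinGSet.snd k f) (FinGSet.fst k f)
      fun w => (FinGSet.pb_comm w).symm) d = d')
    {a : FinGSet.pb f k →[G] U} {b : FinGSet.pb k f →[G] U}
    (hab : ∀ w, a (FinGSet.pbLift (FinGSet.snd k f) (FinGSet.fst k f)
      (fun w => (FinGSet.pb_comm w).symm) w) = b w) : cls a d = cls b d' := by
  refine cls_iso (FinGSet.pbLift (FinGSet.snd k f) (FinGSet.fst k f)
    fun w => (FinGSet.pb_comm w).symm) ⟨fun a b hab => ?_, fun z => ?_⟩ hab hd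
  · have h₁ := congrArg (FinGSet.fst _ _) hab
    have h₂ := congrArg (FinGSet.snd _ _) hab
    simp only [FinGSet.fst_pbLift, FinGSet.snd_pbLift] at h₁ h₂
    exact FinGSet.pb_ext h₂ h₁
  · refine ⟨FinGSet.pbMk (FinGSet.snd _ _ z) (FinGSet.fst _ _ z)
      (FinGSet.pb_comm z).symm, FinGSet.pb_ext ?_ ?_⟩ <;> simp

lemma freeRes_mem {S S' : FinGSet G} (h : S' →[G] S) {x : FreeAbelianGroup (Q.D.Gen S)}
    (hx : x ∈ Q.D.rel Q.E S) : Q.D.freeRes h x ∈ Q.D.rel Q.E S' := by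
  induction hx using AddSubgroup.closure_induction with
  | mem x hx =>
    obtain ⟨T, f, e, he, rfl⟩ := hx
    rw [← proj_eq_zero, proj_freeRes_freeTr (isPb_pb f h), proj_eq_zero]
    apply freeTr_mem
    rcases he with he | he
    · exact Q.res_mem _ _ he
    · obtain ⟨i, j, hij, d⟩ := he
      generalize FinGSet.fst f h = k
      rw [← proj_eq_zero]
      simp only [map_sub, freeRes_gen]
      rw [sub_sub, sub_eq_zero]
      refine (cls_iso (Q := Q) (FinGSet.pbLift (f := MulActionHom.id G) (h := k) k
        (MulActionHom.id G) fun _ => rfl)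
        ⟨fun a b hab => ?_, fun z => ⟨FinGSet.snd _ _ z, FinGSet.pb_ext ?_ ?_⟩⟩
        (f' := MulActionHom.id G) (d' := Q.D.res k d) (fun t => ?_) ?_).trans ?_
      · have := congrArg (FinGSet.snd _ _) hab
        rw [FinGSet.snd_pbLift, FinGSet.snd_pbLift] at this
        exact this
      · rw [FinGSet.fst_pbLift, ← FinGSet.pb_comm]; rfl
      · rw [FinGSet.snd_pbLift]; rfl
      · rw [FinGSet.snd_pbLift]
      · rw [← Q.D.res_comp]
        exact res_congr (fun s => FinGSet.fst_pbLift _ _ _ _) d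
      · have swap : ∀ {V : FinGSet G} (m : V →[G] T), 
            cls (Q := Q) (FinGSet.snd m k) (Q.D.res (FinGSet.fst m k) (Q.D.res m d)) =
            cls (FinGSet.fst k m) (Q.D.res (FinGSet.fst k m) (Q.D.res k d)) := by
          intro V m
          refine cls_swap m k ?_ fun w => FinGSet.snd_pbLift _ _ _ _
          rw [← Q.D.res_comp, ← Q.D.res_comp, ← Q.D.res_comp]
          refine res_congr (fun s => ?_) d
          show m (FinGSet.fst _ _ _) = k _
          rw [FinGSet.fst_pbLift, FinGSet.pb_comm]
        show _ = cls (Q := Q) (FinGSet.snd i k) _ + cls (FinGSet.snd j k) _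
        rw [swap i, swap j]
        exact cls_split (MulActionHom.id G) (hij.pb k) _
  | zero => simp
  | add x y _ _ hx hy => rw [map_add]; exact add_mem hx hy
  | neg x _ hx => rw [map_neg]; exact neg_mem hx

/-- Transfer on the presented groups. -/
def trHom {S S' : FinGSet G} (h : S →[G] S') : Q.Obj S →+ Q.Obj S' :=
  QuotientAddGroup.map _ _ (Q.D.freeTr h) fun _ hx => freeTr_mem h hx

/-- Restriction on the presented groups. -/
noncomputable def resHom {S S' : FinGSet G} (h : S' →[G] S) : Q.Obj S →+ Q.Obj S' :=
  QuotientAddGroup.map _ _ (Q.D.freeRes h) fun _ hx => freeRes_mem h hx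

@[simp] lemma trHom_cls {S S' T : FinGSet G} (h : S →[G] S') (f : T →[G] S) (d : Q.D.obj T) :
    trHom h (cls f d) = cls (h.comp f) d := congrArg (Q.proj _) (freeTr_gen h f d)

@[simp] lemma resHom_cls {S S' T : FinGSet G} (h : S' →[G] S) (f : T →[G] S) (d : Q.D.obj T) :
    resHom h (cls f d) = cls (FinGSet.snd f h) (Q.D.res (FinGSet.fst f h) d) :=
  congrArg (Q.proj _) (freeRes_gen h f d)

lemma resHom_cls_of_isPb {S S' T W : FinGSet G} {h : S' →[G] S} {f : T →[G] S} {p : W →[G] T}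
    {q : W →[G] S'} (hp : IsPb p q f h) (d : Q.D.obj T) :
    resHom h (cls f d) = cls q (Q.D.res p d) := by
  rw [resHom_cls]
  refine cls_iso (FinGSet.pbLift p q hp.comm) ⟨fun a b hab => ?_, fun z => ?_⟩
    (fun t => FinGSet.snd_pbLift _ _ _ _) ?_
  · have h₁ := congrArg (FinGSet.fst _ _) hab
    have h₂ := congrArg (FinGSet.snd _ _) hab
    simp only [FinGSet.fst_pbLift, FinGSet.snd_pbLift] at h₁ h₂
    exact (hp.existsUnique (p a) (q a) (hp.comm a)).unique ⟨rfl, rfl⟩ ⟨h₁.symm, h₂.symm⟩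
  · obtain ⟨w, ⟨hw₁, hw₂⟩, -⟩ := hp.existsUnique (FinGSet.fst _ _ z) (FinGSet.snd _ _ z)
      (FinGSet.pb_comm z)
    exact ⟨w, FinGSet.pb_ext (by simpa using hw₁) (by simpa using hw₂)⟩
  · rw [← Q.D.res_comp]
    exact res_congr (fun s => FinGSet.fst_pbLift _ _ _ _) d

lemma isPb_id_right {S T : FinGSet G} (f : S →[G] T) :
    IsPb (MulActionHom.id G) f f (MulActionHom.id G) where
  comm _ := rfl
  existsUnique s _ e := ⟨s, ⟨rfl, e⟩, fun _ hw => hw.1⟩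

lemma isPb_id_left {S T : FinGSet G} (f : S →[G] T) :
    IsPb f (MulActionHom.id G) (MulActionHom.id G) f where
  comm _ := rfl
  existsUnique _ t e := ⟨t, ⟨e.symm, rfl⟩, fun _ hw => hw.2⟩

variable (Q) in
/-- The Mackey functor with the given generators and relations. -/
noncomputable def mackey : MackeyFunctor.{u} G :=
  MackeyFunctor.ofDecomp Q.Obj (fun h => trHom h) (fun h => resHom h)
    (fun x => DFunLike.congr_fun (f := trHom (Q := Q) _) (g := AddMonoidHom.id _)
      (obj_hom_ext fun _ _ _ => trHom_cls _ _ _) x)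
    (fun x => DFunLike.congr_fun (f := resHom (Q := Q) _) (g := AddMonoidHom.id _)
      (obj_hom_ext fun _ f d => by
        rw [resHom_cls_of_isPb (isPb_id_right f), Q.D.res_id]; rfl) x)
    (fun f h x => DFunLike.congr_fun (f := trHom (Q := Q) _) (g := (trHom h).comp (trHom f))
      (obj_hom_ext fun _ _ _ => by
        simp only [AddMonoidHom.comp_apply, trHom_cls]; rfl) x)
    (fun f h x => DFunLike.congr_fun (f := resHom (Q := Q) _) (g := (resHom f).comp (resHom h))
      (obj_hom_ext fun _ k d => by
        simp only [AddMonoidHom.comp_apply]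
        rw [resHom_cls h, resHom_cls f, ← Q.D.res_comp]
        refine resHom_cls_of_isPb ⟨fun w => ?_, fun s t e => ?_⟩ d
        · show k (FinGSet.fst _ _ _) = h (f _)
          rw [FinGSet.pb_comm, FinGSet.pb_comm]
        · refine ⟨FinGSet.pbMk (FinGSet.pbMk s (f t) e) t (FinGSet.snd_pbMk _ _ _),
            ⟨?_, FinGSet.snd_pbMk _ _ _⟩, fun w hw => FinGSet.pb_ext (FinGSet.pb_ext ?_ ?_) ?_⟩
          · show FinGSet.fst _ _ (FinGSet.fst _ _ _) = s
            simp
          · rw [FinGSet.fst_pbMk, FinGSet.fst_pbMk]; exact hw.1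
          · rw [FinGSet.fst_pbMk, FinGSet.snd_pbMk, FinGSet.pb_comm]
            exact congrArg f hw.2
          · rw [FinGSet.snd_pbMk]; exact hw.2) x)
    (fun {_ S _ _ p q f h} hp x => by
      obtain ⟨y, rfl⟩ := Q.proj_surjective S x
      exact proj_freeRes_freeTr hp y)
    (fun {_ _ _ i j} hij x => DFunLike.congr_fun (f := AddMonoidHom.id _)
      (g := (trHom (Q := Q) i).comp (resHom i) + (trHom j).comp (resHom j))
      (obj_hom_ext fun _ f d => by
        simp only [AddMonoidHom.add_apply, AddMonoidHom.comp_apply, resHom_cls, trHom_cls,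
          AddMonoidHom.id_apply]
        rw [cls_split f (hij.pb f) d]
        congr 1 <;>
        · congr 1
          exact MulActionHom.ext fun w => FinGSet.pb_comm w) x)

/-- The element `tr_f d` of the presented Mackey functor. -/
noncomputable def elt {S T : FinGSet G} (f : T →[G] S) (d : Q.D.obj T) : Q.mackey.obj S := cls f d

/-- The element of the presented Mackey functor given by an element of `D`. -/
noncomputable def ιelt {T : FinGSet G} (d : Q.D.obj T) : Q.mackey.obj T :=
  elt (MulActionHom.id G) d

lemma tr_elt {S S' T : FinGSet G} (h : S →[G] S') (f : T →[G] S) (d : Q.D.obj T) :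
    Q.mackey.tr h (elt f d) = elt (h.comp f) d := trHom_cls h f d

lemma res_elt {S S' T : FinGSet G} (h : S' →[G] S) (f : T →[G] S) (d : Q.D.obj T) :
    Q.mackey.res h (elt f d) =
      elt (FinGSet.snd f h) (Q.D.res (FinGSet.fst f h) d) := resHom_cls h f d

lemma elt_eq_tr {S T : FinGSet G} (f : T →[G] S) (d : Q.D.obj T) :
    elt f d = Q.mackey.tr f (ιelt d) := (tr_elt f (MulActionHom.id G) d).symm

lemma res_ιelt {S T : FinGSet G} (h : S →[G] T) (d : Q.D.obj T) :
    Q.mackey.res h (ιelt d) = ιelt (Q.D.res h d) :=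
  resHom_cls_of_isPb (isPb_id_left h) d

lemma elt_hom_ext {S : FinGSet G} {A : Type*} [AddCommGroup A] {φ ψ : Q.mackey.obj S →+ A}
    (h : ∀ (T : FinGSet G) (f : T →[G] S) (d : Q.D.obj T), φ (elt f d) = ψ (elt f d)) :
    φ = ψ := obj_hom_ext (Q := Q) h

/-- The relations hold in the presented Mackey functor. -/
lemma ev_elt_eq_zero {T : FinGSet G} {e : FreeAbelianGroup (Q.D.Gen T)} (he : Q.E T e) :
    ev (fun _ k d => elt (Q := Q) k d) e = 0 := by
  refine Eq.trans ?_ (cls_eq_zero_of_rel (MulActionHom.id G) he)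
  refine DFunLike.congr_fun (g := (Q.proj T).comp (Q.D.freeTr (MulActionHom.id G)))
    (free_hom_ext fun V k d => ?_) e
  exact (ev_gen (fun _ k d => elt (Q := Q) k d) k d).trans
    (congrArg (Q.proj T) (freeTr_gen (MulActionHom.id G) k d)).symm

/-- To define a homomorphism on the value at `S`, give it on generators and check relations. -/
noncomputable def lift {S : FinGSet G} {A : Type*} [AddCommGroup A]
    (φ : ∀ T : FinGSet G, (T →[G] S) → Q.D.obj T → A)
    (split : ∀ {T T₁ T₂ : FinGSet G} (f : T →[G] S) {i : T₁ →[G] T} {j : T₂ →[G] T},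
      IsCoprod i j → ∀ d : Q.D.obj T,
        φ T f d = φ T₁ (f.comp i) (Q.D.res i d) + φ T₂ (f.comp j) (Q.D.res j d))
    (rel : ∀ {T : FinGSet G} (f : T →[G] S) (e : _), Q.E T e →
      ev (fun V k d => φ V (f.comp k) d) e = 0) : Q.mackey.obj S →+ A :=
  liftAt φ split rel

lemma lift_elt {S : FinGSet G} {A : Type*} [AddCommGroup A]
    (φ : ∀ T : FinGSet G, (T →[G] S) → Q.D.obj T → A) (split) (rel)
    {T : FinGSet G} (f : T →[G] S) (d : Q.D.obj T) :
    lift φ split rel (elt f d) = φ T f d :=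
  ev_gen φ f d

lemma elt_split {S T T₁ T₂ : FinGSet G} (f : T →[G] S) {i : T₁ →[G] T} {j : T₂ →[G] T}
    (hij : IsCoprod i j) (d : Q.D.obj T) :
    elt f d = elt (f.comp i) (Q.D.res i d) + elt (f.comp j) (Q.D.res j d) :=
  cls_split f hij d

/-- The value over `S` of the morphism `desc` below. -/
noncomputable def descAt {P : MackeyFunctor.{u} G} (φ : ∀ T : FinGSet G, Q.D.obj T → P.obj T)
    (nat : ∀ {S T : FinGSet G} (h : S →[G] T) (d : Q.D.obj T), φ S (Q.D.res h d) = P.res h (φ T d))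
    (rel : ∀ {T : FinGSet G} (e : _), Q.E T e → ev (fun _ k d => P.tr k (φ _ d)) e = 0)
    (S : FinGSet G) : Q.Obj S →+ P.obj S :=
  liftAt (fun T f d => P.tr f (φ T d))
    (fun f i j hij d => by
      rw [P.tr_comp, P.tr_comp, nat, nat, ← map_add, ← P.decomp hij])
    (fun f e he => by
      have h := congrArg (P.tr f) (rel e he)
      rw [map_zero] at h
      rw [← h]
      refine DFunLike.congr_fun (g := (P.tr f).comp (ev fun V k d => P.tr k (φ V d)))
        (free_hom_ext fun V k d => ?_) e
      rw [AddMonoidHom.comp_apply, ev_gen, ev_gen]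
      exact P.tr_comp _ _ _)

/-- The morphism out of a presented Mackey functor given by its values on the elements of `D`. -/
noncomputable def desc {P : MackeyFunctor.{u} G} (φ : ∀ T : FinGSet G, Q.D.obj T → P.obj T)
    (nat : ∀ {S T : FinGSet G} (h : S →[G] T) (d : Q.D.obj T), φ S (Q.D.res h d) = P.res h (φ T d))
    (rel : ∀ {T : FinGSet G} (e : _), Q.E T e → ev (fun _ k d => P.tr k (φ _ d)) e = 0) :
    Q.mackey ⟶ P where
  app := descAt φ nat rel
  app_tr {S T} h x := by
    refine DFunLike.congr_fun (f := (descAt φ nat rel T).comp (trHom h))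
      (g := (P.tr h).comp (descAt φ nat rel S)) (obj_hom_ext fun V k d => ?_) x
    simp only [AddMonoidHom.comp_apply, trHom_cls, descAt, liftAt_cls]
    exact P.tr_comp _ _ _
  app_res {S T} h x := by
    refine DFunLike.congr_fun (f := (descAt φ nat rel S).comp (resHom h))
      (g := (P.res h).comp (descAt φ nat rel T)) (obj_hom_ext fun V k d => ?_) x
    simp only [AddMonoidHom.comp_apply, resHom_cls, descAt, liftAt_cls]
    rw [P.mackey (isPb_pb k h), nat]

lemma desc_elt {P : MackeyFunctor.{u} G} (φ : ∀ T : FinGSet G, Q.D.obj T → P.obj T) (nat) (rel)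
    {S T : FinGSet G} (f : T →[G] S) (d : Q.D.obj T) :
    (desc φ nat rel).app S (elt f d) = P.tr f (φ T d) :=
  ev_gen (fun T f d => P.tr f (φ T d)) f d

lemma desc_ιelt {P : MackeyFunctor.{u} G} (φ : ∀ T : FinGSet G, Q.D.obj T → P.obj T) (nat) (rel)
    {T : FinGSet G} (d : Q.D.obj T) : (desc φ nat rel).app T (ιelt d) = φ T d := by
  rw [ιelt, desc_elt, P.tr_id]

lemma mackey_hom_ext {P : MackeyFunctor.{u} G} {φ ψ : Q.mackey ⟶ P}
    (h : ∀ (T : FinGSet G) (d : Q.D.obj T), φ.app T (ιelt d) = ψ.app T (ιelt d)) : φ = ψ := by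
  refine MackeyFunctor.hom_ext fun S x => DFunLike.congr_fun (f := φ.app S) (g := ψ.app S)
    (elt_hom_ext fun T f d => ?_) x
  rw [elt_eq_tr, MackeyFunctor.app_tr', MackeyFunctor.app_tr', h]

end Presentation

/-! ### Green functors -/

/-- An associative Green functor: an (associative, unital) monoid for the box product of Mackey
functors.  A multiplication `R □ R → R` is the same thing as bilinear products on all the groups
`R(S)` which are compatible with restrictions and satisfy Frobenius reciprocity for transfers. -/
structure GreenFunctor (G : Type) [Group G] extends MackeyFunctor.{u} G where
  one : ∀ S, obj S
  mul : ∀ S, obj S →+ obj S →+ obj S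
  one_mul' : ∀ {S} (x : obj S), mul S (one S) x = x
  mul_one' : ∀ {S} (x : obj S), mul S x (one S) = x
  mul_assoc' : ∀ {S} (x y z : obj S), mul S (mul S x y) z = mul S x (mul S y z)
  res_one : ∀ {S T : FinGSet G} (f : S →[G] T), res f (one T) = one S
  res_mul' : ∀ {S T : FinGSet G} (f : S →[G] T) (x y : obj T),
    res f (mul T x y) = mul S (res f x) (res f y)
  tr_mul_res' : ∀ {S T : FinGSet G} (f : S →[G] T) (x : obj S) (y : obj T),
    tr f (mul S x (res f y)) = mul T (tr f x) y
  tr_res_mul' : ∀ {S T : FinGSet G} (f : S →[G] T) (x : obj T) (y : obj S),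
    tr f (mul S (res f x) y) = mul T x (tr f y)

namespace GreenFunctor

variable {G : Type} [Group G]

instance (R : GreenFunctor.{u} G) (S : FinGSet G) : Ring (R.obj S) :=
  { R.grp S with
    mul := fun x y => R.mul S x y
    one := R.one S
    one_mul := R.one_mul'
    mul_one := R.mul_one'
    mul_assoc := R.mul_assoc'
    left_distrib := fun x y z => map_add (R.mul S x) y z
    right_distrib := fun x y z => by
      show R.mul S (x + y) z = _
      rw [map_add]; rfl
    zero_mul := fun x => by
      show R.mul S 0 x = 0
      rw [map_zero]; rfl
    mul_zero := fun x => map_zero (R.mul S x) }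

variable (R : GreenFunctor.{u} G) {S T : FinGSet G} (f : S →[G] T)

/-- Restriction as a ring homomorphism. -/
def resRing : R.obj T →+* R.obj S :=
  { R.res f with
    map_one' := R.res_one f
    map_mul' := R.res_mul' f }

lemma res_mul (x y : R.obj T) : R.res f (x * y) = R.res f x * R.res f y := R.res_mul' f x y

lemma tr_mul_res (x : R.obj S) (y : R.obj T) : R.tr f (x * R.res f y) = R.tr f x * y :=
  R.tr_mul_res' f x y

lemma tr_res_mul (x : R.obj T) (y : R.obj S) : R.tr f (R.res f x * y) = x * R.tr f y :=
  R.tr_res_mul' f x y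

/-- A morphism of Green functors. -/
@[ext]
structure Hom (R R' : GreenFunctor.{u} G) extends
    MackeyFunctor.Hom R.toMackeyFunctor R'.toMackeyFunctor where
  app_one : ∀ S, app S 1 = 1
  app_mul : ∀ {S} (x y : R.obj S), app S (x * y) = app S x * app S y

instance : Category (GreenFunctor.{u} G) where
  Hom := Hom
  id R := { MackeyFunctor.instCategory.id R.toMackeyFunctor with
    app_one := fun _ => rfl
    app_mul := fun _ _ => rfl }
  comp φ ψ := { MackeyFunctor.instCategory.comp φ.toHom ψ.toHom with
    app_one := fun S => (congrArg (ψ.app S) (φ.app_one S)).trans (ψ.app_one S)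
    app_mul := fun {S} x y => (congrArg (ψ.app S) (φ.app_mul x y)).trans (ψ.app_mul _ _) }

lemma hom_ext {R R' : GreenFunctor.{u} G} {φ ψ : R ⟶ R'} (h : ∀ S x, φ.app S x = ψ.app S x) :
    φ = ψ :=
  Hom.ext (funext fun S => AddMonoidHom.ext (h S))

/-- The underlying Mackey functor. -/
def forget : GreenFunctor.{u} G ⥤ MackeyFunctor.{u} G where
  obj R := R.toMackeyFunctor
  map φ := φ.toHom

end GreenFunctor

/-- A presentation for which `D` takes values in monoids, such that the relations are stable
under left and right multiplication by elements of `D`. -/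
structure MulPresentation (G : Type) [Group G] extends Presentation.{u} G where
  [mon : ∀ T, Monoid (D.obj T)]
  res_one : ∀ {S T : FinGSet G} (f : S →[G] T), D.res f 1 = 1
  res_mul : ∀ {S T : FinGSet G} (f : S →[G] T) (x y : D.obj T),
    D.res f (x * y) = D.res f x * D.res f y
  lmul_rel : ∀ {T : FinGSet G} (d : D.obj T) (e : _), E T e →
    GCoeff.ev (fun _ k d' => toPresentation.elt k (D.res k d * d')) e = 0
  rmul_rel : ∀ {T : FinGSet G} (d : D.obj T) (e : _), E T e →
    GCoeff.ev (fun _ k d' => toPresentation.elt k (d' * D.res k d)) e = 0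

attribute [instance] MulPresentation.mon

namespace MulPresentation

open GCoeff Presentation

variable {G : Type} [Group G] (Q : MulPresentation.{u} G)

/-- Left multiplication by an element of `D`. -/
noncomputable def lmul {S : FinGSet G} (d : Q.D.obj S) : Q.mackey.obj S →+ Q.mackey.obj S :=
  lift (fun _ f d' => elt f (Q.D.res f d * d'))
    (fun f i j hij d' => by
      rw [elt_split f hij, Q.res_mul, Q.res_mul, ← Q.D.res_comp, ← Q.D.res_comp])
    (fun f e he => by
      rw [← map_zero (Q.mackey.tr f), ← Q.lmul_rel (Q.D.res f d) e he, map_ev]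
      simp only [tr_elt, Q.D.res_comp])

/-- Right multiplication by an element of `D`. -/
noncomputable def rmul {S : FinGSet G} (d : Q.D.obj S) : Q.mackey.obj S →+ Q.mackey.obj S :=
  lift (fun _ f d' => elt f (d' * Q.D.res f d))
    (fun f i j hij d' => by
      rw [elt_split f hij, Q.res_mul, Q.res_mul, ← Q.D.res_comp, ← Q.D.res_comp])
    (fun f e he => by
      rw [← map_zero (Q.mackey.tr f), ← Q.rmul_rel (Q.D.res f d) e he, map_ev]
      simp only [tr_elt, Q.D.res_comp])

variable {Q}

lemma lmul_elt {S T : FinGSet G} (d : Q.D.obj S) (f : T →[G] S) (d' : Q.D.obj T) :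
    Q.lmul d (elt f d') = elt f (Q.D.res f d * d') := lift_elt _ _ _ _ _

lemma rmul_elt {S T : FinGSet G} (d : Q.D.obj S) (f : T →[G] S) (d' : Q.D.obj T) :
    Q.rmul d (elt f d') = elt f (d' * Q.D.res f d) := lift_elt _ _ _ _ _

lemma lmul_tr {S T : FinGSet G} (d : Q.D.obj S) (f : T →[G] S) (y : Q.mackey.obj T) :
    Q.lmul d (Q.mackey.tr f y) = Q.mackey.tr f (Q.lmul (Q.D.res f d) y) := by
  refine DFunLike.congr_fun (f := (Q.lmul d).comp (Q.mackey.tr f))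
    (g := (Q.mackey.tr f).comp (Q.lmul (Q.D.res f d))) (elt_hom_ext fun V k d' => ?_) y
  simp only [AddMonoidHom.comp_apply, tr_elt, lmul_elt, Q.D.res_comp]

lemma res_lmul {S T : FinGSet G} (d : Q.D.obj S) (f : T →[G] S) (y : Q.mackey.obj S) :
    Q.mackey.res f (Q.lmul d y) = Q.lmul (Q.D.res f d) (Q.mackey.res f y) := by
  refine DFunLike.congr_fun (f := (Q.mackey.res f).comp (Q.lmul d))
    (g := (Q.lmul (Q.D.res f d)).comp (Q.mackey.res f)) (elt_hom_ext fun V k d' => ?_) y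
  simp only [AddMonoidHom.comp_apply, res_elt, lmul_elt, Q.res_mul]
  congr 2
  rw [← Q.D.res_comp, ← Q.D.res_comp]
  exact res_congr (Q := Q.toPresentation) (fun w => FinGSet.pb_comm w) d

lemma lmul_lmul {S : FinGSet G} (d d' : Q.D.obj S) (y : Q.mackey.obj S) :
    Q.lmul (d * d') y = Q.lmul d (Q.lmul d' y) := by
  refine DFunLike.congr_fun (g := (Q.lmul d).comp (Q.lmul d')) (elt_hom_ext fun V k d' => ?_) y
  simp only [AddMonoidHom.comp_apply, lmul_elt, Q.res_mul, mul_assoc]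

lemma lmul_one {S : FinGSet G} (y : Q.mackey.obj S) : Q.lmul 1 y = y := by
  refine DFunLike.congr_fun (g := AddMonoidHom.id _) (elt_hom_ext fun V k d' => ?_) y
  simp only [AddMonoidHom.id_apply, lmul_elt, Q.res_one, one_mul]

variable (Q) in
/-- The product `(tr_f d) · y = tr_f (d · res_f y)`. -/
noncomputable def mulHom (S : FinGSet G) : Q.mackey.obj S →+ Q.mackey.obj S →+ Q.mackey.obj S :=
  lift (fun _ f d => (Q.mackey.tr f).comp ((Q.lmul d).comp (Q.mackey.res f)))
    (fun f i j hij d => AddMonoidHom.ext fun y => by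
      simp only [AddMonoidHom.comp_apply, AddMonoidHom.add_apply]
      rw [Q.mackey.decomp hij (Q.lmul d (Q.mackey.res f y)), map_add, res_lmul, res_lmul,
        Q.mackey.tr_comp, Q.mackey.tr_comp, Q.mackey.res_comp, Q.mackey.res_comp])
    (fun {T} f e he => by
      have key : ev (fun V k d =>
          (Q.mackey.tr k).comp ((Q.lmul d).comp (Q.mackey.res k))) e = 0 := by
        refine elt_hom_ext fun U f' d' => ?_
        rw [AddMonoidHom.zero_apply, ← map_zero ((Q.mackey.tr f').comp ((Q.rmul d').comp
          (Q.mackey.res f'))), ← ev_elt_eq_zero he, map_ev]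
        rw [ev_apply]
        refine congrArg (fun χ => ev χ e) ?_
        funext V k d
        simp only [AddMonoidHom.comp_apply, res_elt, lmul_elt,
          rmul_elt, tr_elt]
        refine cls_swap f' k ?_ fun w => ?_
        · rw [Q.res_mul, ← Q.D.res_comp, ← Q.D.res_comp]
          congr 1 <;> refine res_congr (Q := Q.toPresentation) (fun w => ?_) _
          · exact FinGSet.snd_pbLift _ _ _ _
          · exact FinGSet.fst_pbLift _ _ _ _
        · show k (FinGSet.snd _ _ _) = f' _
          rw [FinGSet.snd_pbLift, FinGSet.pb_comm]
      refine AddMonoidHom.ext fun y => ?_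
      have h := congrArg (Q.mackey.tr f) (DFunLike.congr_fun key (Q.mackey.res f y))
      rw [AddMonoidHom.zero_apply, map_zero] at h
      rw [AddMonoidHom.zero_apply, ← h]
      rw [ev_apply, ev_apply, map_ev]
      refine congrArg (fun χ => ev χ e) ?_
      funext V k d
      simp only [AddMonoidHom.comp_apply, Q.mackey.tr_comp,
        Q.mackey.res_comp])

lemma mulHom_elt {S T : FinGSet G} (f : T →[G] S) (d : Q.D.obj T) (y : Q.mackey.obj S) :
    Q.mulHom S (elt f d) y = Q.mackey.tr f (Q.lmul d (Q.mackey.res f y)) :=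
  DFunLike.congr_fun (lift_elt _ _ _ f d) y

lemma mulHom_ιelt {S : FinGSet G} (d : Q.D.obj S) (y : Q.mackey.obj S) :
    Q.mulHom S (ιelt d) y = Q.lmul d y := by
  rw [ιelt, mulHom_elt, Q.mackey.tr_id, Q.mackey.res_id]

lemma mackey_ind {S : FinGSet G} {A : Type*} [AddCommGroup A] (φ ψ : Q.mackey.obj S →+ A)
    (h : ∀ (T : FinGSet G) (f : T →[G] S) (d : Q.D.obj T), φ (elt f d) = ψ (elt f d))
    (x : Q.mackey.obj S) : φ x = ψ x := DFunLike.congr_fun (elt_hom_ext h) x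

lemma mulHom_tr {S T : FinGSet G} (f : S →[G] T) (x : Q.mackey.obj S) (y : Q.mackey.obj T) :
    Q.mackey.tr f (Q.mulHom S x (Q.mackey.res f y)) = Q.mulHom T (Q.mackey.tr f x) y := by
  refine mackey_ind ((Q.mackey.tr f).comp ((Q.mulHom S).flip (Q.mackey.res f y)))
    (((Q.mulHom T).flip y).comp (Q.mackey.tr f)) (fun V k d => ?_) x
  simp only [AddMonoidHom.comp_apply, AddMonoidHom.flip_apply, tr_elt, mulHom_elt,
    Q.mackey.tr_comp, Q.mackey.res_comp]

lemma mulHom_lmul {S : FinGSet G} (d : Q.D.obj S) (y z : Q.mackey.obj S) :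
    Q.mulHom S (Q.lmul d y) z = Q.lmul d (Q.mulHom S y z) := by
  refine mackey_ind (((Q.mulHom S).flip z).comp (Q.lmul d))
    ((Q.lmul d).comp ((Q.mulHom S).flip z)) (fun V k d' => ?_) y
  simp only [AddMonoidHom.comp_apply, AddMonoidHom.flip_apply, lmul_elt, mulHom_elt, lmul_lmul,
    lmul_tr]

variable (Q) in
/-- The Green functor with the given generators and relations. -/
noncomputable def green : GreenFunctor.{u} G where
  toMackeyFunctor := Q.mackey
  one S := ιelt (Q := Q.toPresentation) (1 : Q.D.obj S)
  mul := Q.mulHom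
  one_mul' x := by rw [mulHom_ιelt, lmul_one]
  mul_one' {S} x := by
    refine mackey_ind ((Q.mulHom S).flip (ιelt 1)) (AddMonoidHom.id _) (fun V k d => ?_) x
    rw [AddMonoidHom.flip_apply, mulHom_elt, res_ιelt, Q.res_one, ιelt, lmul_elt, tr_elt,
      Q.D.res_id, mul_one]
    rfl
  mul_assoc' {S} x y z := by
    refine mackey_ind (((Q.mulHom S).flip z).comp ((Q.mulHom S).flip y))
      ((Q.mulHom S).flip (Q.mulHom S y z)) (fun V k d => ?_) x
    simp only [AddMonoidHom.comp_apply, AddMonoidHom.flip_apply]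
    rw [mulHom_elt, mulHom_elt, ← mulHom_tr, mulHom_lmul]
    congr 2
    refine mackey_ind (((Q.mulHom V).flip (Q.mackey.res k z)).comp (Q.mackey.res k))
      ((Q.mackey.res k).comp ((Q.mulHom S).flip z)) (fun U f d' => ?_) y
    simp only [AddMonoidHom.comp_apply, AddMonoidHom.flip_apply, res_elt, mulHom_elt]
    rw [Q.mackey.mackey (isPb_pb f k), res_lmul, ← Q.mackey.res_comp, ← Q.mackey.res_comp]
    exact congrArg (fun t => Q.mackey.tr _ (Q.lmul _ t))
      (Q.mackey.res_eq (fun w => (FinGSet.pb_comm w).symm) z)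
  res_one f := by rw [res_ιelt, Q.res_one]
  res_mul' {S T} k y z := by
    refine mackey_ind ((Q.mackey.res k).comp ((Q.mulHom T).flip z))
      (((Q.mulHom S).flip (Q.mackey.res k z)).comp (Q.mackey.res k)) (fun U f d' => ?_) y
    simp only [AddMonoidHom.comp_apply, AddMonoidHom.flip_apply, res_elt, mulHom_elt]
    rw [Q.mackey.mackey (isPb_pb f k), res_lmul, ← Q.mackey.res_comp, ← Q.mackey.res_comp]
    exact congrArg (fun t => Q.mackey.tr _ (Q.lmul _ t))
      (Q.mackey.res_eq (fun w => FinGSet.pb_comm w) z)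
  tr_mul_res' := mulHom_tr
  tr_res_mul' {S T} f x y := by
    refine mackey_ind ((Q.mackey.tr f).comp (((Q.mulHom S).flip y).comp (Q.mackey.res f)))
      ((Q.mulHom T).flip (Q.mackey.tr f y)) (fun V k d => ?_) x
    simp only [AddMonoidHom.comp_apply, AddMonoidHom.flip_apply, res_elt, mulHom_elt]
    have hp : IsPb (FinGSet.snd k f) (FinGSet.fst k f) f k :=
      ⟨fun w => (FinGSet.pb_comm w).symm, fun s t e => ⟨FinGSet.pbMk t s e.symm, by simp,
        fun w hw => FinGSet.pb_ext (by simp [hw.2]) (by simp [hw.1])⟩⟩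
    rw [Q.mackey.mackey hp, lmul_tr, ← Q.mackey.tr_comp, ← Q.mackey.tr_comp]
    exact Q.mackey.tr_eq (fun w => (FinGSet.pb_comm w).symm) _

lemma green_mul_ιelt {S : FinGSet G} (d d' : Q.D.obj S) :
    Q.mulHom S (ιelt d) (ιelt d') = ιelt (d * d') := by
  rw [mulHom_ιelt, ιelt, lmul_elt, Q.D.res_id]; rfl

/-- The morphism out of a presented Green functor. -/
noncomputable def descGreen {P : GreenFunctor.{u} G} (φ : ∀ T : FinGSet G, Q.D.obj T →* P.obj T)
    (nat : ∀ {S T : FinGSet G} (h : S →[G] T) (d : Q.D.obj T), φ S (Q.D.res h d) = P.res h (φ T d))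
    (rel : ∀ {T : FinGSet G} (e : _), Q.E T e → ev (fun _ k d => P.tr k (φ _ d)) e = 0) :
    Q.green ⟶ P :=
  { (desc (Q := Q.toPresentation) (P := P.toMackeyFunctor) (fun T d => φ T d) nat rel :
      MackeyFunctor.Hom _ _) with
    app_one := fun S => (desc_ιelt (Q := Q.toPresentation) (P := P.toMackeyFunctor)
      (fun T d => φ T d) nat rel 1).trans (map_one _)
    app_mul := fun {S} x y => by
      let ψ : Q.mackey ⟶ P.toMackeyFunctor :=
        desc (Q := Q.toPresentation) (P := P.toMackeyFunctor) (fun T d => φ T d) nat rel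
      have hψ : ∀ {S T : FinGSet G} (f : T →[G] S) (d : Q.D.obj T),
        ψ.app S (elt f d) = P.tr f (φ T d) := fun f d => desc_elt _ _ _ f d
      have hl : ∀ {S : FinGSet G} (d : Q.D.obj S) (y : Q.mackey.obj S),
          ψ.app S (Q.lmul d y) = φ S d * ψ.app S y := fun {S} d y => by
        refine mackey_ind ((ψ.app S).comp (Q.lmul d))
          ((AddMonoidHom.mulLeft (φ S d)).comp (ψ.app S)) (fun V k d' => ?_) y
        simp only [AddMonoidHom.comp_apply, AddMonoidHom.coe_mulLeft]
        rw [lmul_elt, hψ, hψ, map_mul, nat, P.tr_res_mul]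
      suffices h : ∀ x y : Q.mackey.obj S,
        ψ.app S (Q.mulHom S x y) = ψ.app S x * ψ.app S y from h x y
      intro x y
      refine mackey_ind ((ψ.app S).comp ((Q.mulHom S).flip y))
        ((AddMonoidHom.mulRight (ψ.app S y)).comp (ψ.app S)) (fun V k d => ?_) x
      simp only [AddMonoidHom.comp_apply, AddMonoidHom.flip_apply, AddMonoidHom.coe_mulRight]
      rw [mulHom_elt, MackeyFunctor.app_tr', hl, hψ, MackeyFunctor.app_res', P.tr_mul_res] }

lemma descGreen_ιelt {P : GreenFunctor.{u} G} (φ : ∀ T : FinGSet G, Q.D.obj T →* P.obj T)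
    (nat) (rel) {T : FinGSet G} (d : Q.D.obj T) :
    (descGreen φ nat rel).app T (ιelt d : Q.mackey.obj T) = φ T d :=
  desc_ιelt (Q := Q.toPresentation) (P := P.toMackeyFunctor) (fun T d => φ T d) nat rel d

lemma green_hom_ext {P : GreenFunctor.{u} G} {φ ψ : Q.green ⟶ P}
    (h : ∀ (T : FinGSet G) (d : Q.D.obj T),
      φ.app T (ιelt d : Q.mackey.obj T) = ψ.app T (ιelt d : Q.mackey.obj T)) : φ = ψ := by
  have := mackey_hom_ext (Q := Q.toPresentation) (P := P.toMackeyFunctor)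
    (φ := φ.toHom) (ψ := ψ.toHom) h
  exact GreenFunctor.hom_ext fun S x => congrArg (fun k : Q.mackey ⟶ P.toMackeyFunctor =>
    k.app S x) this

end MulPresentation

/-! ### Box products -/

section Box

set_option linter.unusedSectionVars false

open GCoeff Presentation

variable {G : Type} [Group G] {ι : Type} [DecidableEq ι]

/-- Families of elements `(x_i)_i` with `x_i ∈ M_i(T)`. -/
def boxCoeff (M : ι → MackeyFunctor.{u} G) : GCoeff.{u} G where
  obj T := ∀ i, (M i).obj T
  res f x i := (M i).res f (x i)
  res_id x := funext fun i => (M i).res_id (x i)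
  res_comp f h x := funext fun i => (M i).res_comp f h (x i)

/-- The generator `tr_f (□ x_i)`. -/
def boxGen {M : ι → MackeyFunctor.{u} G} {S T : FinGSet G} (f : T →[G] S)
    (x : ∀ i, (M i).obj T) : FreeAbelianGroup ((boxCoeff M).Gen S) :=
  gen (D := boxCoeff M) f x

/-- The relations of a box product: multilinearity and Frobenius reciprocity in each variable. -/
inductive BoxRel (M : ι → MackeyFunctor.{u} G) :
    ∀ T : FinGSet G, FreeAbelianGroup ((boxCoeff M).Gen T) → Prop
  | add {T : FinGSet G} (x : ∀ i, (M i).obj T) (i : ι) (a b : (M i).obj T) :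
      BoxRel M T (boxGen (MulActionHom.id G) (Function.update x i (a + b))
        - boxGen (MulActionHom.id G) (Function.update x i a)
        - boxGen (MulActionHom.id G) (Function.update x i b))
  | frobenius {T T' : FinGSet G} (h : T' →[G] T) (x : ∀ i, (M i).obj T) (i : ι)
      (a : (M i).obj T') :
      BoxRel M T (boxGen (MulActionHom.id G) (Function.update x i ((M i).tr h a))
        - boxGen h (Function.update (fun j => (M j).res h (x j)) i a))

lemma freeTr_boxGen {M : ι → MackeyFunctor.{u} G} {S S' T : FinGSet G} (h : S →[G] S')
    (f : T →[G] S) (x : ∀ i, (M i).obj T) :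
    (boxCoeff M).freeTr h (boxGen f x) = boxGen (h.comp f) x := freeTr_gen (D := boxCoeff M) h f x

lemma freeRes_boxGen {M : ι → MackeyFunctor.{u} G} {S S' T : FinGSet G} (h : S' →[G] S)
    (f : T →[G] S) (x : ∀ i, (M i).obj T) :
    (boxCoeff M).freeRes h (boxGen f x) =
      boxGen (FinGSet.snd f h) (fun i => (M i).res (FinGSet.fst f h) (x i)) :=
  freeRes_gen (D := boxCoeff M) h f x

lemma ev_boxGen {M : ι → MackeyFunctor.{u} G} {S T : FinGSet G} {A : Type*} [AddCommGroup A]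
    (φ : ∀ T : FinGSet G, (T →[G] S) → (boxCoeff M).obj T → A) (f : T →[G] S)
    (x : ∀ i, (M i).obj T) : ev φ (boxGen f x) = φ T f x := ev_gen φ f _

lemma res_update (M : ι → MackeyFunctor.{u} G) {S T : FinGSet G} (f : S →[G] T)
    (x : ∀ i, (M i).obj T) (i : ι) (a : (M i).obj T) :
    (fun j => (M j).res f (Function.update x i a j)) =
      Function.update (fun j => (M j).res f (x j)) i ((M i).res f a) := by
  funext j
  rcases eq_or_ne j i with rfl | hj
  · simp
  · simp [hj]

lemma boxRel_res {M : ι → MackeyFunctor.{u} G} {T T' : FinGSet G} (k : T' →[G] T)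
    {e : FreeAbelianGroup ((boxCoeff M).Gen T)} (he : BoxRel M T e) :
    (boxCoeff M).freeRes k e ∈ (boxCoeff M).rel (BoxRel M) T' := by
  cases he with
  | add x i a b =>
    refine AddSubgroup.subset_closure ⟨_, FinGSet.snd (MulActionHom.id G) k, _,
      Or.inl (BoxRel.add (fun j => (M j).res (FinGSet.fst (MulActionHom.id G) k) (x j)) i
        ((M i).res (FinGSet.fst (MulActionHom.id G) k) a)
        ((M i).res (FinGSet.fst (MulActionHom.id G) k) b)), ?_⟩
    simp only [map_sub, freeRes_boxGen, freeTr_boxGen, res_update, map_add]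
    rfl
  | @frobenius V h x i a =>
    let q : FinGSet.pb h k →[G] FinGSet.pb (MulActionHom.id G) k :=
      FinGSet.pbLift (MulActionHom.comp h (FinGSet.fst h k)) (FinGSet.snd h k)
        fun w => FinGSet.pb_comm w
    have hq₁ : ∀ w, FinGSet.fst (MulActionHom.id G) k (q w) = h (FinGSet.fst h k w) :=
      fun w => FinGSet.fst_pbLift _ _ _ _
    have hq₂ : ∀ w, FinGSet.snd (MulActionHom.id G) k (q w) = FinGSet.snd h k w :=
      fun w => FinGSet.snd_pbLift _ _ _ _
    have hp : IsPb (FinGSet.fst h k) q h (FinGSet.fst (MulActionHom.id G) k) := by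
      refine ⟨fun w => (hq₁ w).symm, fun s t e => ?_⟩
      have e' : h s = k (FinGSet.snd (MulActionHom.id G) k t) := by
        rw [e]; exact FinGSet.pb_comm t
      refine ⟨FinGSet.pbMk s _ e', ⟨FinGSet.fst_pbMk _ _ _, FinGSet.pb_ext ?_ ?_⟩,
        fun w hw => FinGSet.pb_ext ?_ ?_⟩
      · rw [hq₁, FinGSet.fst_pbMk, e]
      · rw [hq₂, FinGSet.snd_pbMk]
      · rw [FinGSet.fst_pbMk, hw.1]
      · rw [FinGSet.snd_pbMk, ← hw.2, hq₂]
    refine AddSubgroup.subset_closure ⟨_, FinGSet.snd (MulActionHom.id G) k, _,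
      Or.inl (BoxRel.frobenius q
        (fun j => (M j).res (FinGSet.fst (MulActionHom.id G) k) (x j)) i
        ((M i).res (FinGSet.fst h k) a)), ?_⟩
    simp only [map_sub, freeRes_boxGen, freeTr_boxGen, res_update]
    rw [(M i).mackey hp]
    have h₁ : MulActionHom.comp (FinGSet.snd (MulActionHom.id G) k) q = FinGSet.snd h k :=
      MulActionHom.ext hq₂
    have h₂ : (fun j => (M j).res (FinGSet.fst h k) ((M j).res h (x j))) =
        fun j => (M j).res q ((M j).res (FinGSet.fst (MulActionHom.id G) k) (x j)) := by
      funext j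
      rw [← (M j).res_comp, ← (M j).res_comp]
      exact (M j).res_eq (fun w => (hq₁ w).symm) _
    rw [h₁, h₂]
    rfl

/-- The presentation of the box product of a nonempty finite family of Mackey functors. -/
def boxPres (M : ι → MackeyFunctor.{u} G) : Presentation.{u} G where
  D := boxCoeff M
  E := BoxRel M
  res_mem k _ he := boxRel_res k he

/-- The box product of a nonempty finite family of Mackey functors.  Its value at `S` is
`(⨁_{f : T → S} ⨂_i M_i(T)) / ∼`, where the class of `⨂ x_i` in the summand of `f` is the
transfer along `f` of the pure tensor `□ x_i`, and `∼` is Frobenius reciprocity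
`x_1 □ … □ tr_h(a) □ … □ x_r = tr_h (res_h x_1 □ … □ a □ … □ res_h x_r)`.  Morphisms out of it are
the families of multilinear maps `∏ M_i(T) → P(T)` compatible with restrictions and satisfying
Frobenius reciprocity, that is, the multilinear pairings of Mackey functors. -/
noncomputable def bigBox (M : ι → MackeyFunctor.{u} G) : MackeyFunctor.{u} G := (boxPres M).mackey

/-- The pure tensor `□ x_i`. -/
noncomputable def boxTmul {M : ι → MackeyFunctor.{u} G} {T : FinGSet G} (x : ∀ i, (M i).obj T) :
    (bigBox M).obj T := ιelt (Q := boxPres M) x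

lemma boxRel_tmul {M : ι → MackeyFunctor.{u} G} {T : FinGSet G}
    {e : FreeAbelianGroup ((boxCoeff M).Gen T)} (he : BoxRel M T e) :
    ev (D := boxCoeff M) (fun V k x => (bigBox M).tr k (boxTmul (T := V) x)) e = 0 := by
  refine Eq.trans ?_ (ev_elt_eq_zero (Q := boxPres M) he)
  refine congrArg (fun φ => ev (D := boxCoeff M) (S := T) φ e) ?_
  funext V k x
  exact (elt_eq_tr (Q := boxPres M) k x).symm

lemma boxTmul_add {M : ι → MackeyFunctor.{u} G} {T : FinGSet G} (x : ∀ i, (M i).obj T) (i : ι)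
    (a b : (M i).obj T) : boxTmul (Function.update x i (a + b)) =
      boxTmul (Function.update x i a) + boxTmul (Function.update x i b) := by
  have h := boxRel_tmul (BoxRel.add x i a b)
  rw [map_sub, map_sub, sub_sub, sub_eq_zero, ev_boxGen, ev_boxGen, ev_boxGen,
    (bigBox M).tr_id, (bigBox M).tr_id, (bigBox M).tr_id] at h
  exact h

lemma boxTmul_tr {M : ι → MackeyFunctor.{u} G} {T T' : FinGSet G} (h : T' →[G] T)
    (x : ∀ i, (M i).obj T) (i : ι) (a : (M i).obj T') :
    boxTmul (Function.update x i ((M i).tr h a)) =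
      (bigBox M).tr h (boxTmul (Function.update (fun j => (M j).res h (x j)) i a)) := by
  have h' := boxRel_tmul (BoxRel.frobenius h x i a)
  rw [map_sub, sub_eq_zero, ev_boxGen, ev_boxGen, (bigBox M).tr_id] at h'
  exact h'

lemma res_boxTmul {M : ι → MackeyFunctor.{u} G} {S T : FinGSet G} (h : S →[G] T)
    (x : ∀ i, (M i).obj T) :
    (bigBox M).res h (boxTmul x) = boxTmul fun i => (M i).res h (x i) :=
  res_ιelt (Q := boxPres M) h x

lemma boxRel_ev {M : ι → MackeyFunctor.{u} G} {P : MackeyFunctor.{u} G}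
    (φ : ∀ T : FinGSet G, (∀ i, (M i).obj T) → P.obj T)
    (add : ∀ {T : FinGSet G} (x : ∀ i, (M i).obj T) (i : ι) (a b : (M i).obj T),
      φ T (Function.update x i (a + b)) =
        φ T (Function.update x i a) + φ T (Function.update x i b))
    (frobenius : ∀ {T T' : FinGSet G} (h : T' →[G] T) (x : ∀ i, (M i).obj T) (i : ι)
      (a : (M i).obj T'), φ T (Function.update x i ((M i).tr h a)) =
        P.tr h (φ T' (Function.update (fun j => (M j).res h (x j)) i a)))
    {T : FinGSet G} {e : FreeAbelianGroup ((boxCoeff M).Gen T)} (he : BoxRel M T e) :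
    ev (fun V k d => P.tr k (φ V d)) e = 0 := by
  cases he with
  | add x i a b =>
    rw [map_sub, map_sub, sub_sub, sub_eq_zero, ev_boxGen, ev_boxGen, ev_boxGen,
      P.tr_id, P.tr_id, P.tr_id]
    exact add x i a b
  | frobenius h x i a =>
    rw [map_sub, sub_eq_zero, ev_boxGen, ev_boxGen, P.tr_id]
    exact frobenius h x i a

/-- The morphism out of a box product given by a multilinear pairing. -/
noncomputable def boxDesc {M : ι → MackeyFunctor.{u} G} {P : MackeyFunctor.{u} G}
    (φ : ∀ T : FinGSet G, (∀ i, (M i).obj T) → P.obj T)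
    (nat : ∀ {S T : FinGSet G} (h : S →[G] T) (x : ∀ i, (M i).obj T),
      φ S (fun i => (M i).res h (x i)) = P.res h (φ T x))
    (add : ∀ {T : FinGSet G} (x : ∀ i, (M i).obj T) (i : ι) (a b : (M i).obj T),
      φ T (Function.update x i (a + b)) =
        φ T (Function.update x i a) + φ T (Function.update x i b))
    (frobenius : ∀ {T T' : FinGSet G} (h : T' →[G] T) (x : ∀ i, (M i).obj T) (i : ι)
      (a : (M i).obj T'), φ T (Function.update x i ((M i).tr h a)) =
        P.tr h (φ T' (Function.update (fun j => (M j).res h (x j)) i a))) :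
    bigBox M ⟶ P :=
  desc (Q := boxPres M) φ nat fun _ he => boxRel_ev φ add frobenius he

lemma boxDesc_tmul {M : ι → MackeyFunctor.{u} G} {P : MackeyFunctor.{u} G}
    (φ : ∀ T : FinGSet G, (∀ i, (M i).obj T) → P.obj T) (nat) (add) (frobenius)
    {T : FinGSet G} (x : ∀ i, (M i).obj T) :
    (boxDesc φ nat add frobenius).app T (boxTmul x) = φ T x :=
  desc_ιelt (Q := boxPres M) φ _ _ x

lemma bigBox_hom_ext {M : ι → MackeyFunctor.{u} G} {P : MackeyFunctor.{u} G} {φ ψ : bigBox M ⟶ P}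
    (h : ∀ (T : FinGSet G) (x : ∀ i, (M i).obj T),
      φ.app T (boxTmul x) = ψ.app T (boxTmul x)) : φ = ψ :=
  mackey_hom_ext (Q := boxPres M) h

lemma app_update {M N : ι → MackeyFunctor.{u} G} (φ : ∀ i, M i ⟶ N i) {T : FinGSet G}
    (x : ∀ i, (M i).obj T) (i : ι) (a : (M i).obj T) :
    (fun j => (φ j).app T (Function.update x i a j)) =
      Function.update (fun j => (φ j).app T (x j)) i ((φ i).app T a) := by
  funext j
  rcases eq_or_ne j i with rfl | hj
  · simp
  · simp [hj]

/-- Functoriality of box products. -/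
noncomputable def bigBoxMap {M N : ι → MackeyFunctor.{u} G} (φ : ∀ i, M i ⟶ N i) :
    bigBox M ⟶ bigBox N :=
  boxDesc (fun T x => boxTmul fun i => (φ i).app T (x i))
    (fun h x => by
      rw [res_boxTmul]
      simp only [MackeyFunctor.app_res'])
    (fun x i a b => by
      rw [app_update, app_update, app_update, map_add, boxTmul_add])
    (fun h x i a => by
      rw [app_update, app_update, MackeyFunctor.app_tr', boxTmul_tr]
      simp only [MackeyFunctor.app_res'])

lemma bigBoxMap_tmul {M N : ι → MackeyFunctor.{u} G} (φ : ∀ i, M i ⟶ N i) {T : FinGSet G}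
    (x : ∀ i, (M i).obj T) :
    (bigBoxMap φ).app T (boxTmul x) = boxTmul fun i => (φ i).app T (x i) :=
  boxDesc_tmul _ _ _ _ x

lemma boxTmul_eq_zero {M : ι → MackeyFunctor.{u} G} {T : FinGSet G} (x : ∀ i, (M i).obj T)
    (i : ι) (hi : x i = 0) : boxTmul x = 0 := by
  have h := boxTmul_add x i 0 0
  rw [add_zero, ← hi, Function.update_eq_self] at h
  exact left_eq_add.mp h

/-- A family of two objects. -/
def pair {α : Type*} (a b : α) : Bool → α
  | false => a
  | true => b

/-- A pair of morphisms. -/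
def pairMap {C : Type*} [Category C] {X Y X' Y' : C} (φ : X ⟶ X') (ψ : Y ⟶ Y') :
    ∀ i, pair X Y i ⟶ pair X' Y' i
  | false => φ
  | true => ψ

lemma pairMap_id {C : Type*} [Category C] (X Y : C) (i : Bool) :
    pairMap (𝟙 X) (𝟙 Y) i = 𝟙 _ := by cases i <;> rfl

lemma pairMap_comp {C : Type*} [Category C] {X Y X' Y' X'' Y'' : C} (φ : X ⟶ X') (ψ : Y ⟶ Y')
    (φ' : X' ⟶ X'') (ψ' : Y' ⟶ Y'') (i : Bool) :
    pairMap (φ ≫ φ') (ψ ≫ ψ') i = pairMap φ ψ i ≫ pairMap φ' ψ' i := by cases i <;> rfl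

lemma bigBoxMap_id {M : ι → MackeyFunctor.{u} G} {φ : ∀ i, M i ⟶ M i} (h : ∀ i, φ i = 𝟙 _) :
    bigBoxMap φ = 𝟙 _ := bigBox_hom_ext fun T x => by
  rw [bigBoxMap_tmul, MackeyFunctor.id_apply]
  simp only [h, MackeyFunctor.id_apply]

lemma bigBoxMap_comp {M N P : ι → MackeyFunctor.{u} G} {φ : ∀ i, M i ⟶ N i} {ψ : ∀ i, N i ⟶ P i}
    {χ : ∀ i, M i ⟶ P i} (h : ∀ i, χ i = φ i ≫ ψ i) :
    bigBoxMap χ = bigBoxMap φ ≫ bigBoxMap ψ := bigBox_hom_ext fun T x => by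
  rw [MackeyFunctor.comp_apply, bigBoxMap_tmul, bigBoxMap_tmul, bigBoxMap_tmul]
  simp only [h, MackeyFunctor.comp_apply]

variable (G) in
/-- The box product of two Mackey functors, as a bifunctor. -/
noncomputable def box : MackeyFunctor.{u} G ⥤ MackeyFunctor.{u} G ⥤ MackeyFunctor.{u} G where
  obj M :=
    { obj := fun N => bigBox (pair M N)
      map := fun ψ => bigBoxMap (pairMap (𝟙 M) ψ)
      map_id := fun N => bigBoxMap_id (pairMap_id M N)
      map_comp := fun ψ ψ' => bigBoxMap_comp fun i => by
        rw [← pairMap_comp, Category.comp_id] }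
  map φ :=
    { app := fun N => bigBoxMap (pairMap φ (𝟙 N))
      naturality := fun N N' ψ => by
        rw [← bigBoxMap_comp (χ := pairMap φ ψ), ← bigBoxMap_comp (χ := pairMap φ ψ)]
        · intro i; rw [← pairMap_comp, Category.comp_id, Category.id_comp]
        · intro i; rw [← pairMap_comp, Category.comp_id, Category.id_comp] }
  map_id M := by
    ext N
    exact bigBoxMap_id (pairMap_id M N)
  map_comp φ φ' := by
    ext N
    exact bigBoxMap_comp fun i => by rw [← pairMap_comp, Category.comp_id]

instance (M : MackeyFunctor.{u} G) : ((box G).obj M).PreservesZeroMorphisms where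
  map_zero _ _ := bigBox_hom_ext fun _ x =>
    (bigBoxMap_tmul _ x).trans (boxTmul_eq_zero _ true rfl)

instance : (box.{u} G).PreservesZeroMorphisms where
  map_zero _ _ := by
    ext N
    exact bigBox_hom_ext fun _ x => (bigBoxMap_tmul _ x).trans (boxTmul_eq_zero _ false rfl)

instance (K L : ChainComplex (MackeyFunctor.{u} G) ℕ) :
    HomologicalComplex.HasMapBifunctor K L (box G) (ComplexShape.down ℕ) := fun n => by
  have : Finite ((ComplexShape.π (ComplexShape.down ℕ) (ComplexShape.down ℕ)
      (ComplexShape.down ℕ)) ⁻¹' {n}) :=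
    Set.Finite.to_subtype (((Set.finite_Iic n).prod (Set.finite_Iic n)).subset
      (by
        rintro ⟨p, q⟩ h
        have h' : p + q = n := h
        exact ⟨show p ≤ n by omega, show q ≤ n by omega⟩))
  have := hasColimitsOfShape_discrete (MackeyFunctor.{u} G)
    ((ComplexShape.π (ComplexShape.down ℕ) (ComplexShape.down ℕ) (ComplexShape.down ℕ)) ⁻¹' {n})
  infer_instance

variable (G) in
/-- The box product of two nonnegatively graded chain complexes of Mackey functors. -/
noncomputable def chainBox : ChainComplex (MackeyFunctor.{u} G) ℕ ⥤
    ChainComplex (MackeyFunctor.{u} G) ℕ ⥤ ChainComplex (MackeyFunctor.{u} G) ℕ :=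
  (box G).map₂HomologicalComplex (ComplexShape.down ℕ) (ComplexShape.down ℕ) (ComplexShape.down ℕ)

end Box

/-! ### Pointed `G`-sets, pointed `G`-monoids and pointed monoid algebras -/

section PointedSets

/-- A pointed `G`-set. -/
structure PointedGSet (G : Type) [Group G] where
  carrier : Type u
  [act : MulAction G carrier]
  base : carrier
  smul_base : ∀ g : G, g • base = base

attribute [instance] PointedGSet.act

instance (G : Type) [Group G] : CoeSort (PointedGSet.{u} G) (Type u) := ⟨PointedGSet.carrier⟩

variable {G : Type} [Group G]

/-- A pointed equivariant map. -/
@[ext]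
structure PointedGSet.Hom (X Y : PointedGSet.{u} G) where
  toFun : X →[G] Y
  map_base : toFun X.base = Y.base

instance : Category (PointedGSet.{u} G) where
  Hom := PointedGSet.Hom
  id X := ⟨MulActionHom.id G, rfl⟩
  comp φ ψ := ⟨ψ.toFun.comp φ.toFun, (congrArg ψ.toFun φ.map_base).trans ψ.map_base⟩

/-- A pointed monoid in `G`-sets: a monoid with zero on which `G` acts by automorphisms of monoids
with zero. -/
structure PointedGMonoid (G : Type) [Group G] where
  carrier : Type u
  [mon : MonoidWithZero carrier]
  [act : MulDistribMulAction G carrier]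
  smul_zero : ∀ g : G, g • (0 : carrier) = 0

attribute [instance] PointedGMonoid.mon PointedGMonoid.act

instance (G : Type) [Group G] : CoeSort (PointedGMonoid.{u} G) (Type u) :=
  ⟨PointedGMonoid.carrier⟩

/-- A morphism of pointed monoids in `G`-sets. -/
@[ext]
structure PointedGMonoid.Hom (M N : PointedGMonoid.{u} G) where
  toFun : M →*₀ N
  map_smul : ∀ (g : G) (x : M), toFun (g • x) = g • toFun x

instance : Category (PointedGMonoid.{u} G) where
  Hom := PointedGMonoid.Hom
  id M := ⟨MonoidWithZeroHom.id M, fun _ _ => rfl⟩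
  comp φ ψ := ⟨ψ.toFun.comp φ.toFun, fun g x =>
    (congrArg ψ.toFun (φ.map_smul g x)).trans (ψ.map_smul g _)⟩

/-- The underlying equivariant map. -/
def PointedGMonoid.Hom.toMap {M N : PointedGMonoid.{u} G} (φ : PointedGMonoid.Hom M N) :
    M →[G] N where
  toFun := φ.toFun
  map_smul' := φ.map_smul

/-- The constant map at a fixed point. -/
def constMap (S : FinGSet G) {X : Type u} [MulAction G X] (b : X) (hb : ∀ g : G, g • b = b) :
    S →[G] X where
  toFun _ := b
  map_smul' g _ := (hb g).symm

/-- The pointwise monoid structure on equivariant maps into a monoid. -/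
@[reducible] def mapMonoid (S : FinGSet G) (M : Type u) [Monoid M] [MulDistribMulAction G M] :
    Monoid (S →[G] M) where
  mul x y := ⟨fun s => x s * y s, fun g s => by simp only [map_smul, smul_mul', id]⟩
  one := ⟨fun _ => 1, fun g _ => (smul_one g).symm⟩
  mul_assoc x y z := MulActionHom.ext fun s => mul_assoc (x s) (y s) (z s)
  one_mul x := MulActionHom.ext fun s => one_mul (x s)
  mul_one x := MulActionHom.ext fun s => mul_one (x s)



end PointedSets

section Representable

open GCoeff Presentation

variable {G : Type} [Group G]

/-- The functor `T ↦ Map_G(T, X)`. -/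
def mapCoeff (X : PointedGSet.{u} G) : GCoeff.{u} G where
  obj T := T →[G] X
  res f x := x.comp f
  res_id _ := rfl
  res_comp _ _ _ := rfl

/-- The relation that the base point is zero. -/
inductive BaseRel (X : PointedGSet.{u} G) :
    ∀ T : FinGSet G, FreeAbelianGroup ((mapCoeff X).Gen T) → Prop
  | base {T : FinGSet G} : BaseRel X T
      (gen (D := mapCoeff X) (MulActionHom.id G) (constMap T X.base X.smul_base))

/-- The presentation of the reduced representable Mackey functor. -/
def reprPres (X : PointedGSet.{u} G) : Presentation.{u} G where
  D := mapCoeff X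
  E := BaseRel X
  res_mem k _ he := by
    cases he
    exact AddSubgroup.subset_closure ⟨_, FinGSet.snd (MulActionHom.id G) k, _,
      Or.inl BaseRel.base, (freeRes_gen (D := mapCoeff X) k _ _).trans
        (freeTr_gen (D := mapCoeff X) (FinGSet.snd (MulActionHom.id G) k) (MulActionHom.id G)
          (constMap _ X.base X.smul_base)).symm⟩

/-- The quotient `A_X / A_∗` of the representable Mackey functor of a pointed `G`-set `X`.
The unreduced `A_X(S)` is the group completion of the monoid of isomorphism classes of finite
`G`-sets `T` over `X × S`; a map `(x, f) : T → X × S` corresponds to the generator `tr_f x`.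
If `X` is finite this is the value at `X × S` of the Burnside Mackey functor `A`, and in general
`A_X` is the direct sum of the `A_O` over the orbits `O` of `X`. -/
noncomputable def reprObj (X : PointedGSet.{u} G) : MackeyFunctor.{u} G := (reprPres X).mackey

/-- The generators of `A_X / A_∗`. -/
noncomputable def reprElt {X : PointedGSet.{u} G} {T : FinGSet G} (x : T →[G] X) :
    (reprObj X).obj T := ιelt (Q := reprPres X) x

lemma reprElt_base {X : PointedGSet.{u} G} (T : FinGSet G) :
    reprElt (constMap T X.base X.smul_base) = 0 := by
  have h := ev_elt_eq_zero (Q := reprPres X) (BaseRel.base (T := T))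
  exact (ev_gen (fun _ k d => elt (Q := reprPres X) k d) _ _).symm.trans h

/-- Functoriality of `A_X / A_∗`. -/
noncomputable def reprMap {X Y : PointedGSet.{u} G} (φ : X ⟶ Y) : reprObj X ⟶ reprObj Y :=
  desc (Q := reprPres X) (fun _ x => reprElt (PointedGSet.Hom.toFun φ |>.comp x))
    (fun h x => (res_ιelt (Q := reprPres Y) h ((PointedGSet.Hom.toFun φ).comp x)).symm)
    (fun {T} e he => by
      cases he
      refine (ev_gen (D := mapCoeff X) _ _ _).trans ?_
      have h : (PointedGSet.Hom.toFun φ).comp (constMap T X.base X.smul_base) =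
          constMap T Y.base Y.smul_base := MulActionHom.ext fun _ => φ.map_base
      rw [h, reprElt_base, map_zero])

lemma reprMap_elt {X Y : PointedGSet.{u} G} (φ : X ⟶ Y) {T : FinGSet G} (x : T →[G] X) :
    (reprMap φ).app T (reprElt x) = reprElt ((PointedGSet.Hom.toFun φ).comp x) :=
  desc_ιelt (Q := reprPres X) _ _ _ x

lemma repr_hom_ext {X : PointedGSet.{u} G} {P : MackeyFunctor.{u} G} {φ ψ : reprObj X ⟶ P}
    (h : ∀ (T : FinGSet G) (x : T →[G] X), φ.app T (reprElt x) = ψ.app T (reprElt x)) : φ = ψ :=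
  mackey_hom_ext (Q := reprPres X) h

variable (G) in
/-- The functor `X ↦ A_X / A_∗`. -/
noncomputable def repr : PointedGSet.{u} G ⥤ MackeyFunctor.{u} G where
  obj := reprObj
  map := reprMap
  map_id _ := repr_hom_ext fun _ x => reprMap_elt _ x
  map_comp φ ψ := repr_hom_ext fun _ x => by
    rw [MackeyFunctor.comp_apply, reprMap_elt, reprMap_elt, reprMap_elt]
    rfl

end Representable

section MonoidAlgebra

open GCoeff Presentation

variable {G : Type} [Group G]

attribute [local instance] mapMonoid

/-- The functor `T ↦ R(T) × Map_G(T, M)`; a pair `(r, x)` stands for `r · x`. -/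
def algCoeff (R : GreenFunctor.{u} G) (M : PointedGMonoid.{u} G) : GCoeff.{u} G where
  obj T := R.obj T × (T →[G] M)
  res f d := (R.res f d.1, d.2.comp f)
  res_id d := Prod.ext (R.res_id d.1) rfl
  res_comp f h d := Prod.ext (R.res_comp f h d.1) rfl

/-- The generator `tr_f (r · x)` of `R[M]`. -/
def algGen {R : GreenFunctor.{u} G} {M : PointedGMonoid.{u} G} {S T : FinGSet G} (f : T →[G] S)
    (r : R.obj T) (x : T →[G] M) : FreeAbelianGroup ((algCoeff R M).Gen S) :=
  gen (D := algCoeff R M) f (r, x)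

/-- The zero element of `M` over `T`. -/
def zeroMap (M : PointedGMonoid.{u} G) (T : FinGSet G) : T →[G] M := constMap T 0 M.smul_zero

/-- The relations of `R[M] = R_M / R_∗`: additivity in the coefficient, compatibility with
transfers of the coefficient, and the base point is zero. -/
inductive AlgRel (R : GreenFunctor.{u} G) (M : PointedGMonoid.{u} G) :
    ∀ T : FinGSet G, FreeAbelianGroup ((algCoeff R M).Gen T) → Prop
  | add {T : FinGSet G} (r s : R.obj T) (x : T →[G] M) : AlgRel R M T
      (algGen (MulActionHom.id G) (r + s) x - algGen (MulActionHom.id G) r x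
        - algGen (MulActionHom.id G) s x)
  | tr {T T' : FinGSet G} (h : T' →[G] T) (r : R.obj T') (x : T →[G] M) : AlgRel R M T
      (algGen (MulActionHom.id G) (R.tr h r) x - algGen h r (x.comp h))
  | base {T : FinGSet G} (r : R.obj T) : AlgRel R M T
      (algGen (MulActionHom.id G) r (zeroMap M T))

lemma freeTr_algGen {R : GreenFunctor.{u} G} {M : PointedGMonoid.{u} G} {S S' T : FinGSet G}
    (h : S →[G] S') (f : T →[G] S) (r : R.obj T) (x : T →[G] M) :
    (algCoeff R M).freeTr h (algGen f r x) = algGen (h.comp f) r x :=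
  freeTr_gen (D := algCoeff R M) h f (r, x)

lemma freeRes_algGen {R : GreenFunctor.{u} G} {M : PointedGMonoid.{u} G} {S S' T : FinGSet G}
    (h : S' →[G] S) (f : T →[G] S) (r : R.obj T) (x : T →[G] M) :
    (algCoeff R M).freeRes h (algGen f r x) =
      algGen (FinGSet.snd f h) (R.res (FinGSet.fst f h) r) (x.comp (FinGSet.fst f h)) :=
  freeRes_gen (D := algCoeff R M) h f (r, x)

lemma ev_algGen {R : GreenFunctor.{u} G} {M : PointedGMonoid.{u} G} {S T : FinGSet G} {A : Type*}
    [AddCommGroup A] (φ : ∀ T : FinGSet G, (T →[G] S) → (algCoeff R M).obj T → A) (f : T →[G] S)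
    (r : R.obj T) (x : T →[G] M) : ev φ (algGen f r x) = φ T f (r, x) := ev_gen φ f _

lemma algRel_res {R : GreenFunctor.{u} G} {M : PointedGMonoid.{u} G} {T T' : FinGSet G}
    (k : T' →[G] T) {e : FreeAbelianGroup ((algCoeff R M).Gen T)} (he : AlgRel R M T e) :
    (algCoeff R M).freeRes k e ∈ (algCoeff R M).rel (AlgRel R M) T' := by
  cases he with
  | add r s x =>
    refine AddSubgroup.subset_closure ⟨_, FinGSet.snd (MulActionHom.id G) k, _,
      Or.inl (AlgRel.add (R.res (FinGSet.fst (MulActionHom.id G) k) r)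
        (R.res (FinGSet.fst (MulActionHom.id G) k) s)
        (x.comp (FinGSet.fst (MulActionHom.id G) k))), ?_⟩
    simp only [map_sub, freeRes_algGen, freeTr_algGen, map_add]
    rfl
  | @tr V h r x =>
    let q : FinGSet.pb h k →[G] FinGSet.pb (MulActionHom.id G) k :=
      FinGSet.pbLift (MulActionHom.comp h (FinGSet.fst h k)) (FinGSet.snd h k)
        fun w => FinGSet.pb_comm w
    have hq₁ : ∀ w, FinGSet.fst (MulActionHom.id G) k (q w) = h (FinGSet.fst h k w) :=
      fun w => FinGSet.fst_pbLift _ _ _ _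
    have hq₂ : ∀ w, FinGSet.snd (MulActionHom.id G) k (q w) = FinGSet.snd h k w :=
      fun w => FinGSet.snd_pbLift _ _ _ _
    have hp : IsPb (FinGSet.fst h k) q h (FinGSet.fst (MulActionHom.id G) k) := by
      refine ⟨fun w => (hq₁ w).symm, fun s t e => ?_⟩
      have e' : h s = k (FinGSet.snd (MulActionHom.id G) k t) := by
        rw [e]; exact FinGSet.pb_comm t
      refine ⟨FinGSet.pbMk s _ e', ⟨FinGSet.fst_pbMk _ _ _, FinGSet.pb_ext ?_ ?_⟩,
        fun w hw => FinGSet.pb_ext ?_ ?_⟩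
      · rw [hq₁, FinGSet.fst_pbMk, e]
      · rw [hq₂, FinGSet.snd_pbMk]
      · rw [FinGSet.fst_pbMk, hw.1]
      · rw [FinGSet.snd_pbMk, ← hw.2, hq₂]
    refine AddSubgroup.subset_closure ⟨_, FinGSet.snd (MulActionHom.id G) k, _,
      Or.inl (AlgRel.tr q (R.res (FinGSet.fst h k) r)
        (x.comp (FinGSet.fst (MulActionHom.id G) k))), ?_⟩
    simp only [map_sub, freeRes_algGen, freeTr_algGen]
    rw [R.mackey hp]
    have h₁ : MulActionHom.comp (FinGSet.snd (MulActionHom.id G) k) q = FinGSet.snd h k :=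
      MulActionHom.ext hq₂
    have h₂ : (x.comp (FinGSet.fst (MulActionHom.id G) k)).comp q =
        (x.comp h).comp (FinGSet.fst h k) := MulActionHom.ext fun w => congrArg x (hq₁ w)
    rw [h₁, h₂]
    rfl
  | base r =>
    refine AddSubgroup.subset_closure ⟨_, FinGSet.snd (MulActionHom.id G) k, _,
      Or.inl (AlgRel.base (R.res (FinGSet.fst (MulActionHom.id G) k) r)), ?_⟩
    simp only [freeRes_algGen, freeTr_algGen]
    rfl

/-- The presentation of `R[M]` as a Mackey functor. -/
def algPres (R : GreenFunctor.{u} G) (M : PointedGMonoid.{u} G) : Presentation.{u} G where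
  D := algCoeff R M
  E := AlgRel R M
  res_mem k _ he := algRel_res k he

/-- To check the relations of `R[M]` for a family of maps into a Mackey functor. -/
lemma algRel_ev {R : GreenFunctor.{u} G} {M : PointedGMonoid.{u} G} {P : MackeyFunctor.{u} G}
    (φ : ∀ T : FinGSet G, R.obj T → (T →[G] M) → P.obj T)
    (add : ∀ {T : FinGSet G} (r s : R.obj T) (x : T →[G] M), φ T (r + s) x = φ T r x + φ T s x)
    (tr : ∀ {T T' : FinGSet G} (h : T' →[G] T) (r : R.obj T') (x : T →[G] M),
      φ T (R.tr h r) x = P.tr h (φ T' r (x.comp h)))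
    (base : ∀ {T : FinGSet G} (r : R.obj T), φ T r (zeroMap M T) = 0)
    {T : FinGSet G} {e : FreeAbelianGroup ((algCoeff R M).Gen T)} (he : AlgRel R M T e) :
    ev (D := algCoeff R M) (fun V k d => P.tr k (φ V d.1 d.2)) e = 0 := by
  cases he with
  | add r s x =>
    rw [map_sub, map_sub, sub_sub, sub_eq_zero, ev_algGen, ev_algGen, ev_algGen,
      P.tr_id, P.tr_id, P.tr_id]
    exact add r s x
  | tr h r x =>
    rw [map_sub, sub_eq_zero, ev_algGen, ev_algGen, P.tr_id]
    exact tr h r x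
  | base r =>
    rw [ev_algGen, P.tr_id]
    exact base r

/-- The element `r · x` of `R[M]`. -/
noncomputable def algElt {R : GreenFunctor.{u} G} {M : PointedGMonoid.{u} G} {T : FinGSet G}
    (r : R.obj T) (x : T →[G] M) : (algPres R M).mackey.obj T :=
  ιelt (Q := algPres R M) ((r, x) : R.obj T × (T →[G] M))

lemma algRel_elt {R : GreenFunctor.{u} G} {M : PointedGMonoid.{u} G} {T : FinGSet G}
    {e : FreeAbelianGroup ((algCoeff R M).Gen T)} (he : AlgRel R M T e) :
    ev (D := algCoeff R M) (fun V k d => (algPres R M).mackey.tr k (algElt (T := V) d.1 d.2)) e =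
      0 := by
  refine Eq.trans ?_ (ev_elt_eq_zero (Q := algPres R M) he)
  refine congrArg (fun φ => ev (D := algCoeff R M) (S := T) φ e) ?_
  funext V k x
  exact (elt_eq_tr (Q := algPres R M) k x).symm

section

variable {R : GreenFunctor.{u} G} {M : PointedGMonoid.{u} G} {T : FinGSet G}

lemma algElt_add (r s : R.obj T) (x : T →[G] M) :
    algElt (r + s) x = algElt r x + algElt s x := by
  have h := algRel_elt (AlgRel.add r s x)
  rw [map_sub, map_sub, sub_sub, sub_eq_zero, ev_algGen, ev_algGen, ev_algGen,
    MackeyFunctor.tr_id, MackeyFunctor.tr_id, MackeyFunctor.tr_id] at h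
  exact h

lemma algElt_tr {T' : FinGSet G} (h : T' →[G] T) (r : R.obj T') (x : T →[G] M) :
    algElt (R.tr h r) x = (algPres R M).mackey.tr h (algElt r (x.comp h)) := by
  have h' := algRel_elt (AlgRel.tr h r x)
  rw [map_sub, sub_eq_zero, ev_algGen, ev_algGen, MackeyFunctor.tr_id] at h'
  exact h'

lemma algElt_zero (r : R.obj T) : algElt r (zeroMap M T) = 0 := by
  have h := algRel_elt (AlgRel.base (M := M) r)
  rw [ev_algGen, MackeyFunctor.tr_id] at h
  exact h

lemma mul_zeroMap (x : T →[G] M) : x * zeroMap M T = zeroMap M T :=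
  MulActionHom.ext fun s => mul_zero (x s)

lemma zeroMap_mul (x : T →[G] M) : zeroMap M T * x = zeroMap M T :=
  MulActionHom.ext fun s => zero_mul (x s)

end

lemma algRel_lmul {R : GreenFunctor.{u} G} {M : PointedGMonoid.{u} G} {T : FinGSet G} (s : R.obj T)
    (y : T →[G] M) {e : FreeAbelianGroup ((algCoeff R M).Gen T)} (he : AlgRel R M T e) :
    ev (D := algCoeff R M) (fun V k d => (algPres R M).mackey.tr k
      (algElt (T := V) (R.res k s * d.1) (y.comp k * d.2))) e = 0 := by
  cases he with
  | add r r' x =>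
    rw [map_sub, map_sub, sub_sub, sub_eq_zero, ev_algGen, ev_algGen, ev_algGen,
      MackeyFunctor.tr_id, MackeyFunctor.tr_id, MackeyFunctor.tr_id]
    simp only [mul_add]
    exact algElt_add _ _ _
  | tr h r x =>
    rw [map_sub, sub_eq_zero, ev_algGen, ev_algGen, MackeyFunctor.tr_id]
    simp only [R.res_id, ← R.tr_res_mul]
    exact algElt_tr _ _ _
  | base r =>
    rw [ev_algGen, MackeyFunctor.tr_id]
    simp only [mul_zeroMap]
    exact algElt_zero _

lemma algRel_rmul {R : GreenFunctor.{u} G} {M : PointedGMonoid.{u} G} {T : FinGSet G} (s : R.obj T)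
    (y : T →[G] M) {e : FreeAbelianGroup ((algCoeff R M).Gen T)} (he : AlgRel R M T e) :
    ev (D := algCoeff R M) (fun V k d => (algPres R M).mackey.tr k
      (algElt (T := V) (d.1 * R.res k s) (d.2 * y.comp k))) e = 0 := by
  cases he with
  | add r r' x =>
    rw [map_sub, map_sub, sub_sub, sub_eq_zero, ev_algGen, ev_algGen, ev_algGen,
      MackeyFunctor.tr_id, MackeyFunctor.tr_id, MackeyFunctor.tr_id]
    simp only [add_mul]
    exact algElt_add _ _ _
  | tr h r x =>
    rw [map_sub, sub_eq_zero, ev_algGen, ev_algGen, MackeyFunctor.tr_id]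
    simp only [R.res_id, ← R.tr_mul_res]
    exact algElt_tr _ _ _
  | base r =>
    rw [ev_algGen, MackeyFunctor.tr_id]
    simp only [zeroMap_mul]
    exact algElt_zero _

/-- The product `(r · x) (s · y) = rs · xy`. -/
@[reducible] def algMonoid (R : GreenFunctor.{u} G) (M : PointedGMonoid.{u} G) (T : FinGSet G) :
    Monoid ((algCoeff R M).obj T) :=
  show Monoid (R.obj T × (T →[G] M)) from inferInstance

/-- The presentation of the Green functor `R[M]`. -/
def algMulPres (R : GreenFunctor.{u} G) (M : PointedGMonoid.{u} G) : MulPresentation.{u} G where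
  toPresentation := algPres R M
  mon T := algMonoid R M T
  res_one f := Prod.ext (R.res_one f) rfl
  res_mul f x y := Prod.ext (R.res_mul f x.1 y.1) rfl
  lmul_rel {T} d e he := by
    refine Eq.trans ?_ (algRel_lmul (R := R) (M := M) d.1 d.2 he)
    refine congrArg (fun φ => ev (D := algCoeff R M) (S := T) φ e) ?_
    funext V k x
    exact elt_eq_tr (Q := algPres R M) k _
  rmul_rel {T} d e he := by
    refine Eq.trans ?_ (algRel_rmul (R := R) (M := M) d.1 d.2 he)
    refine congrArg (fun φ => ev (D := algCoeff R M) (S := T) φ e) ?_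
    funext V k x
    exact elt_eq_tr (Q := algPres R M) k _

/-- The pointed monoid algebra `R[M] = R_M / R_∗` of a Green functor `R` and a pointed monoid `M`
in `G`-sets.  Here `R_X` is the Mackey functor `S ↦ R(X × S)` if `X` is finite, extended to all
`G`-sets `X` as the direct sum of the `R_O` over the orbits `O` of `X`; equivalently, as the
colimit of `R(T)` over all finite `G`-sets `T` over `X × S`, along transfers.  The image of
`r ∈ R(T)` for `(x, f) : T → M × S` is `tr_f (r · x)`.  The multiplication is
`(r · x) (s · y) = rs · xy`. -/
noncomputable def monoidAlgebraObj (R : GreenFunctor.{u} G) (M : PointedGMonoid.{u} G) :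
    GreenFunctor.{u} G := (algMulPres R M).green

lemma algElt_mul {R : GreenFunctor.{u} G} {M : PointedGMonoid.{u} G} {T : FinGSet G}
    (r s : R.obj T) (x y : T →[G] M) :
    (algMulPres R M).mulHom T (algElt r x) (algElt s y) = algElt (r * s) (x * y) :=
  MulPresentation.green_mul_ιelt (Q := algMulPres R M) (S := T) (r, x) (s, y)

lemma res_algElt {R : GreenFunctor.{u} G} {M : PointedGMonoid.{u} G} {S T : FinGSet G}
    (h : S →[G] T) (r : R.obj T) (x : T →[G] M) :
    (algPres R M).mackey.res h (algElt r x) = algElt (R.res h r) (x.comp h) :=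
  res_ιelt (Q := algPres R M) h ((r, x) : R.obj T × (T →[G] M))

/-- Functoriality of `R[M]`. -/
noncomputable def monoidAlgebraMap {R R' : GreenFunctor.{u} G} {M M' : PointedGMonoid.{u} G}
    (φ : R ⟶ R') (ψ : M ⟶ M') : monoidAlgebraObj R M ⟶ monoidAlgebraObj R' M' :=
  MulPresentation.descGreen (Q := algMulPres R M) (P := monoidAlgebraObj R' M')
    (fun T =>
      { toFun := fun d => algElt (φ.app T d.1) ((PointedGMonoid.Hom.toMap ψ).comp d.2)
        map_one' := congrArg₂ algElt (φ.app_one T)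
          (MulActionHom.ext fun _ => map_one (PointedGMonoid.Hom.toFun ψ))
        map_mul' := fun d d' => (congrArg₂ algElt (φ.app_mul d.1 d'.1)
          (MulActionHom.ext fun t => map_mul (PointedGMonoid.Hom.toFun ψ) (d.2 t) (d'.2 t))).trans
            (algElt_mul _ _ _ _).symm })
    (fun h d => (congrArg₂ algElt (φ.app_res h d.1) rfl).trans
      (res_algElt h (φ.app _ d.1) ((PointedGMonoid.Hom.toMap ψ).comp d.2)).symm)
    (fun e he => algRel_ev (R := R) (M := M) (P := (algPres R' M').mackey)
      (fun T r x => algElt (φ.app T r) ((PointedGMonoid.Hom.toMap ψ).comp x))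
      (fun r s x => by rw [map_add, algElt_add])
      (fun h r x => by rw [φ.app_tr, algElt_tr]; rfl)
      (fun {T} r => by
        have h : (PointedGMonoid.Hom.toMap ψ).comp (zeroMap M T) = zeroMap M' T :=
          MulActionHom.ext fun _ => map_zero (PointedGMonoid.Hom.toFun ψ)
        rw [h, algElt_zero]) he)

lemma monoidAlgebraMap_elt {R R' : GreenFunctor.{u} G} {M M' : PointedGMonoid.{u} G}
    (φ : R ⟶ R') (ψ : M ⟶ M') {T : FinGSet G} (r : R.obj T) (x : T →[G] M) :
    (monoidAlgebraMap φ ψ).app T (algElt r x : (algPres R M).mackey.obj T) =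
      (algElt (φ.app T r) ((PointedGMonoid.Hom.toMap ψ).comp x) :
        (algPres R' M').mackey.obj T) :=
  MulPresentation.descGreen_ιelt (Q := algMulPres R M) (P := monoidAlgebraObj R' M') _ _ _
    ((r, x) : R.obj T × (T →[G] M))

variable (G) in
/-- The functor `(R, M) ↦ R[M]`. -/
noncomputable def monoidAlgebra : GreenFunctor.{u} G × PointedGMonoid.{u} G ⥤ GreenFunctor.{u} G where
  obj X := monoidAlgebraObj X.1 X.2
  map φ := monoidAlgebraMap φ.1 φ.2
  map_id X := MulPresentation.green_hom_ext (Q := algMulPres X.1 X.2) fun _ d =>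
    monoidAlgebraMap_elt _ _ d.1 d.2
  map_comp {X _ _} φ ψ := MulPresentation.green_hom_ext (Q := algMulPres X.1 X.2) fun T d =>
    (monoidAlgebraMap_elt _ _ d.1 d.2).trans
      (((congrArg ((monoidAlgebraMap ψ.1 ψ.2).app T)
        (monoidAlgebraMap_elt φ.1 φ.2 d.1 d.2)).trans (monoidAlgebraMap_elt _ _ _ _)).symm)

end MonoidAlgebra

/-! ### Twisted cyclic operators -/

section Cyclic

variable {N : Type u} [Monoid N] {k m l : ℕ}

/-- Extension of a tuple by `1`. -/
def extOne (x : Fin (k + 1) → N) (i : ℕ) : N := if h : i < k + 1 then x ⟨i, h⟩ else 1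

/-- The product `x_a x_{a+1} ⋯ x_{b-1}`. -/
def seg (x : Fin (k + 1) → N) (a b : ℕ) : N := ((List.Ico a b).map (extOne x)).prod

/-- The simplicial operators of the cyclic bar construction of `N`, with the cyclic permutation
twisted by the endomorphism `φ`: for a monotone map `θ : [m] → [k]`,
`y = θ^* (x_0, …, x_k)` is given by `y_{j+1} = ∏_{θ(j) < i ≤ θ(j+1)} x_i` and
`y_0 = φ (∏_{i > θ(m)} x_i) · ∏_{i ≤ θ(0)} x_i`.  In particular
`d_i (x_0, …, x_k) = (x_0, …, x_i x_{i+1}, …, x_k)` for `i < k`,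
`d_k (x_0, …, x_k) = (φ(x_k) x_0, x_1, …, x_{k-1})`, and the degeneracies insert `1`. -/
def cyc (φ : N →* N) (θ : Fin (m + 1) →o Fin (k + 1)) (x : Fin (k + 1) → N) : Fin (m + 1) → N :=
  Fin.cases (φ (seg x (θ (Fin.last m) + 1) (k + 1)) * seg x 0 (θ 0 + 1))
    fun j => seg x (θ j.castSucc + 1) (θ j.succ + 1)

lemma cyc_zero (φ : N →* N) (θ : Fin (m + 1) →o Fin (k + 1)) (x : Fin (k + 1) → N) :
    cyc φ θ x 0 = φ (seg x (θ (Fin.last m) + 1) (k + 1)) * seg x 0 (θ 0 + 1) := rfl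

lemma cyc_succ (φ : N →* N) (θ : Fin (m + 1) →o Fin (k + 1)) (x : Fin (k + 1) → N) (j : Fin m) :
    cyc φ θ x j.succ = seg x (θ j.castSucc + 1) (θ j.succ + 1) := rfl

lemma extOne_val (x : Fin (k + 1) → N) (i : Fin (k + 1)) : extOne x i = x i := dif_pos i.2

lemma extOne_update (x : Fin (k + 1) → N) (i : Fin (k + 1)) (y : N) {n : ℕ} (h : n ≠ i) :
    extOne (Function.update x i y) n = extOne x n := by
  unfold extOne
  split_ifs with hn
  · rw [Function.update_of_ne]
    rintro rfl
    exact h rfl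
  · rfl

lemma seg_self (x : Fin (k + 1) → N) (a : ℕ) : seg x a a = 1 := by simp [seg]

lemma seg_append (x : Fin (k + 1) → N) {a b c : ℕ} (h : a ≤ b) (h' : b ≤ c) :
    seg x a b * seg x b c = seg x a c := by
  rw [seg, seg, seg, ← List.prod_append, ← List.map_append, List.Ico.append_consecutive h h']

lemma seg_single (x : Fin (k + 1) → N) (a : ℕ) : seg x a (a + 1) = extOne x a := by simp [seg]

lemma seg_update_of_notMem (x : Fin (k + 1) → N) (i : Fin (k + 1)) (y : N) {a b : ℕ}
    (h : ¬(a ≤ i ∧ (i : ℕ) < b)) : seg (Function.update x i y) a b = seg x a b := by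
  unfold seg
  congr 1
  refine List.map_congr_left fun n hn => extOne_update x i y ?_
  rintro rfl
  exact h (List.Ico.mem.mp hn)

lemma seg_update (x : Fin (k + 1) → N) (i : Fin (k + 1)) (y : N) {a b : ℕ} (ha : a ≤ i)
    (hb : (i : ℕ) < b) :
    seg (Function.update x i y) a b = seg x a i * y * seg x (i + 1) b := by
  rw [← seg_append _ ha hb.le, ← seg_append _ (Nat.le_succ (i : ℕ)) hb, seg_single, extOne_val,
    Function.update_self, seg_update_of_notMem _ _ _ (by omega),
    seg_update_of_notMem _ _ _ (by omega), mul_assoc]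

lemma map_extOne {N' : Type u} [Monoid N'] (ψ : N →* N') (x : Fin (k + 1) → N) (i : ℕ) :
    extOne (fun j => ψ (x j)) i = ψ (extOne x i) := by
  unfold extOne
  split_ifs <;> simp

lemma map_seg {N' : Type u} [Monoid N'] (ψ : N →* N') (x : Fin (k + 1) → N) (a b : ℕ) :
    seg (fun j => ψ (x j)) a b = ψ (seg x a b) := by
  rw [seg, seg, map_list_prod, List.map_map]
  congr 1
  exact List.map_congr_left fun n _ => map_extOne ψ x n

lemma map_cyc {N' : Type u} [Monoid N'] (ψ : N →* N') (φ : N →* N) (φ' : N' →* N')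
    (h : ∀ x, ψ (φ x) = φ' (ψ x)) (θ : Fin (m + 1) →o Fin (k + 1)) (x : Fin (k + 1) → N) :
    cyc φ' θ (fun j => ψ (x j)) = fun j => ψ (cyc φ θ x j) := by
  funext j
  refine Fin.cases ?_ (fun j => ?_) j
  · rw [cyc_zero, cyc_zero, map_seg, map_seg, map_mul, h]
  · rw [cyc_succ, cyc_succ, map_seg]

lemma cyc_id (φ : N →* N) (x : Fin (k + 1) → N) : cyc φ OrderHom.id x = x := by
  funext j
  refine Fin.cases ?_ (fun j => ?_) j
  · rw [cyc_zero]
    simp only [OrderHom.id_coe, id, Fin.val_last, Fin.val_zero, seg_self, map_one, one_mul]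
    exact (seg_single x 0).trans (extOne_val x 0)
  · rw [cyc_succ]
    simp only [OrderHom.id_coe, id, Fin.val_castSucc, Fin.val_succ, seg_single]
    exact extOne_val x j.succ

lemma seg_cyc (φ : N →* N) (θ : Fin (m + 1) →o Fin (k + 1)) (x : Fin (k + 1) → N)
    (a b : Fin (m + 1)) (h : a ≤ b) :
    seg (cyc φ θ x) (a + 1) (b + 1) = seg x (θ a + 1) (θ b + 1) := by
  induction b using Fin.induction with
  | zero =>
    obtain rfl : a = 0 := Fin.le_zero_iff.mp h
    rw [seg_self, seg_self]
  | succ b ih =>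
    rcases h.lt_or_eq with h | rfl
    · have h' : a ≤ b.castSucc := Fin.le_castSucc_iff.mpr h
      have h₁ : (θ a : ℕ) ≤ θ b.castSucc := θ.monotone h'
      have h₂ : (θ b.castSucc : ℕ) ≤ θ b.succ := θ.monotone (Fin.castSucc_lt_succ).le
      have h₃ : (a : ℕ) ≤ b := h'
      have e : seg (cyc φ θ x) (b + 1) (b + 1 + 1) = cyc φ θ x b.succ :=
        (seg_single _ _).trans (extOne_val _ b.succ)
      rw [← seg_append x (Nat.succ_le_succ h₁) (Nat.succ_le_succ h₂), ← ih h', Fin.val_castSucc,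
        Fin.val_succ, ← seg_append _ (Nat.succ_le_succ h₃) (Nat.le_succ (b + 1 : ℕ)), e, cyc_succ]
    · rw [seg_self, seg_self]

lemma cyc_comp (φ : N →* N) (θ : Fin (m + 1) →o Fin (k + 1)) (η : Fin (l + 1) →o Fin (m + 1))
    (x : Fin (k + 1) → N) : cyc φ η (cyc φ θ x) = cyc φ (θ.comp η) x := by
  funext j
  refine Fin.cases ?_ (fun j => ?_) j
  · rw [cyc_zero, cyc_zero]
    have h₁ := seg_cyc φ θ x (η (Fin.last l)) (Fin.last m) (Fin.le_last _)
    have h₂ := seg_cyc φ θ x 0 (η 0) (Fin.zero_le _)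
    rw [Fin.val_last] at h₁
    rw [Fin.val_zero, zero_add] at h₂
    have e : seg (cyc φ θ x) 0 1 = cyc φ θ x 0 := (seg_single _ _).trans (extOne_val _ 0)
    have h₃ : (θ (η (Fin.last l)) : ℕ) ≤ θ (Fin.last m) := θ.monotone (Fin.le_last _)
    have h₄ : (θ 0 : ℕ) ≤ θ (η 0) := θ.monotone (Fin.zero_le _)
    rw [← seg_append _ (Nat.zero_le 1) (Nat.succ_le_succ (Nat.zero_le (η 0 : ℕ))), e, h₁, h₂,
      cyc_zero]
    simp only [OrderHom.comp_coe, Function.comp_apply]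
    rw [← seg_append x (Nat.succ_le_succ h₃) (θ (Fin.last m)).2, map_mul,
      ← seg_append x (Nat.zero_le _) (Nat.succ_le_succ h₄)]
    simp only [mul_assoc]
  · rw [cyc_succ, cyc_succ, seg_cyc φ θ x _ _ (η.monotone (Fin.castSucc_lt_succ).le)]
    rfl

/-- In each variable, the operators are given by left and right multiplications. -/
lemma cyc_update (θ : Fin (m + 1) →o Fin (k + 1)) (i : Fin (k + 1)) :
    ∃ (j : Fin (m + 1)) (e : Bool) (a b c d a' b' c' d' : ℕ),
      ∀ (N : Type u) [Monoid N] (φ : N →* N) (x : Fin (k + 1) → N) (y : N),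
        cyc φ θ (Function.update x i y) = Function.update (cyc φ θ x) j
          (φ (seg x a b) * seg x c d * (if e then φ y else y) *
            (φ (seg x a' b') * seg x c' d')) := by
  by_cases h₀ : (i : ℕ) ≤ θ 0
  · refine ⟨0, false, θ (Fin.last m) + 1, k + 1, 0, i, 0, 0, i + 1, θ 0 + 1, ?_⟩
    intro N _ φ x y
    have h₂ : ∀ j, (θ 0 : ℕ) ≤ θ j := fun j => θ.monotone (Fin.zero_le j)
    funext j
    refine Fin.cases ?_ (fun j => ?_) j
    · have := h₂ (Fin.last m)
      rw [Function.update_self, cyc_zero, seg_update_of_notMem _ _ _ (by omega),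
        seg_update _ _ _ (Nat.zero_le _) (by omega), seg_self, map_one]
      simp only [mul_assoc, one_mul, Bool.false_eq_true, if_false]
    · have := h₂ j.castSucc
      rw [Function.update_of_ne (Fin.succ_ne_zero j), cyc_succ, cyc_succ,
        seg_update_of_notMem _ _ _ (by omega)]
  by_cases h₁ : (θ (Fin.last m) : ℕ) < i
  · refine ⟨0, true, θ (Fin.last m) + 1, i, 0, 0, i + 1, k + 1, 0, θ 0 + 1, ?_⟩
    intro N _ φ x y
    have h₂ : ∀ j, (θ j : ℕ) ≤ θ (Fin.last m) := fun j => θ.monotone (Fin.le_last j)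
    funext j
    refine Fin.cases ?_ (fun j => ?_) j
    · rw [Function.update_self, cyc_zero, seg_update _ _ _ h₁ i.2,
        seg_update_of_notMem _ _ _ (by omega), seg_self, map_mul, map_mul]
      simp only [mul_assoc, one_mul, if_true]
    · have := h₂ j.succ
      rw [Function.update_of_ne (Fin.succ_ne_zero j), cyc_succ, cyc_succ,
        seg_update_of_notMem _ _ _ (by omega)]
  have key : ∃ j : Fin m, (θ j.castSucc : ℕ) < i ∧ (i : ℕ) ≤ θ j.succ := by
    by_contra hne
    push Not at hne h₀
    refine h₁ ?_
    have : ∀ j : Fin (m + 1), (θ j : ℕ) < i := fun j => by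
      induction j using Fin.induction with
      | zero => exact h₀
      | succ j ih => exact hne j ih
    exact this _
  obtain ⟨j₀, hj₁, hj₂⟩ := key
  refine ⟨j₀.succ, false, 0, 0, θ j₀.castSucc + 1, i, 0, 0, i + 1, θ j₀.succ + 1, ?_⟩
  intro N _ φ x y
  funext j
  refine Fin.cases ?_ (fun j => ?_) j
  · rw [Function.update_of_ne (Fin.succ_ne_zero j₀).symm, cyc_zero, cyc_zero,
      seg_update_of_notMem _ _ _ (by omega), seg_update_of_notMem _ _ _ (by omega)]
  · rcases lt_trichotomy j j₀ with h | rfl | h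
    · have : (θ j.succ : ℕ) ≤ θ j₀.castSucc := θ.monotone (Fin.succ_le_castSucc_iff.mpr h)
      rw [Function.update_of_ne (fun e => h.ne (Fin.succ_injective _ e)), cyc_succ, cyc_succ,
        seg_update_of_notMem _ _ _ (by omega)]
    · rw [Function.update_self, cyc_succ, seg_update _ _ _ hj₁ (by omega), seg_self, map_one]
      simp only [one_mul, Bool.false_eq_true, if_false]
    · have : (θ j₀.succ : ℕ) ≤ θ j.castSucc := θ.monotone (Fin.succ_le_castSucc_iff.mpr h)
      rw [Function.update_of_ne (fun e => h.ne' (Fin.succ_injective _ e)), cyc_succ, cyc_succ,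
        seg_update_of_notMem _ _ _ (by omega)]

end Cyclic

/-! ### Twisted Hochschild homology and the relative cyclic nerve -/

section Twisted

variable {G : Type} [CommGroup G]

/-- Translation by an element of a commutative group is equivariant. -/
def transl (g : G) (S : FinGSet G) : S →[G] S where
  toFun s := g • s
  map_smul' a s := smul_comm g a s

/-- The action of `g` on a Green functor: the automorphism of the ring `R(S)` induced by the
translation `g : S → S`.  On a representable Mackey functor `A_X` it is the map induced by
the translation `g : X → X`. -/
def twist (R : GreenFunctor.{u} G) (g : G) (S : FinGSet G) : R.obj S →* R.obj S :=
  R.resRing (transl g S)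

lemma twist_apply (R : GreenFunctor.{u} G) (g : G) (S : FinGSet G) (x : R.obj S) :
    twist R g S x = R.res (transl g S) x := rfl

lemma res_twist (R : GreenFunctor.{u} G) (g : G) {S T : FinGSet G} (h : S →[G] T) (x : R.obj T) :
    R.res h (twist R g T x) = twist R g S (R.res h x) := by
  rw [twist_apply, twist_apply, ← R.res_comp, ← R.res_comp]
  exact R.res_eq (fun s => (map_smul h g s).symm) x

lemma twist_add (R : GreenFunctor.{u} G) (g : G) (S : FinGSet G) (x y : R.obj S) :
    twist R g S (x + y) = twist R g S x + twist R g S y := map_add (R.resRing (transl g S)) x y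

lemma twist_tr (R : GreenFunctor.{u} G) (g : G) {S T : FinGSet G} (h : S →[G] T) (x : R.obj S) :
    twist R g T (R.tr h x) = R.tr h (twist R g S x) := by
  refine R.mackey (p := transl g S) (q := h) ⟨fun s => map_smul h g s, fun s t e => ?_⟩ x
  have e' : h s = g • t := e
  refine ⟨g⁻¹ • s, ⟨smul_inv_smul g s, ?_⟩, fun w hw => ?_⟩
  · rw [map_smul, e']
    exact inv_smul_smul g t
  · rw [← hw.1]
    exact (inv_smul_smul g w).symm

lemma app_twist {R R' : GreenFunctor.{u} G} (φ : R ⟶ R') (g : G) (S : FinGSet G) (x : R.obj S) :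
    φ.app S (twist R g S x) = twist R' g S (φ.app S x) := φ.app_res _ x

variable {k m l : ℕ}

/-- The value of a map of the twisted cyclic bar construction on tuples of elements. -/
noncomputable def hcTuple (g : G) (R : GreenFunctor.{u} G) (θ : Fin (m + 1) →o Fin (k + 1))
    (T : FinGSet G) (x : Fin (k + 1) → R.obj T) :
    (bigBox fun _ : Fin (m + 1) => R.toMackeyFunctor).obj T :=
  boxTmul (M := fun _ : Fin (m + 1) => R.toMackeyFunctor) (cyc (twist R g T) θ x)

lemma res_cyc (g : G) (R : GreenFunctor.{u} G) (θ : Fin (m + 1) →o Fin (k + 1)) {S T : FinGSet G}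
    (h : S →[G] T) (x : Fin (k + 1) → R.obj T) :
    cyc (twist R g S) θ (fun i => R.res h (x i)) = fun j => R.res h (cyc (twist R g T) θ x j) :=
  map_cyc (R.resRing h : R.obj T →* R.obj S) (twist R g T) (twist R g S)
    (fun y => res_twist R g h y) θ x

lemma hcTuple_res (g : G) (R : GreenFunctor.{u} G) (θ : Fin (m + 1) →o Fin (k + 1))
    {S T : FinGSet G} (h : S →[G] T) (x : Fin (k + 1) → R.obj T) :
    hcTuple g R θ S (fun i => R.res h (x i)) =
      (bigBox fun _ : Fin (m + 1) => R.toMackeyFunctor).res h (hcTuple g R θ T x) := by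
  rw [hcTuple, hcTuple, res_boxTmul, res_cyc]

lemma hcTuple_add (g : G) (R : GreenFunctor.{u} G) (θ : Fin (m + 1) →o Fin (k + 1))
    {T : FinGSet G} (x : Fin (k + 1) → R.obj T) (i : Fin (k + 1)) (y z : R.obj T) :
    hcTuple g R θ T (Function.update x i (y + z)) =
      hcTuple g R θ T (Function.update x i y) + hcTuple g R θ T (Function.update x i z) := by
  obtain ⟨j, e, a, b, c, d, a', b', c', d', H⟩ := cyc_update θ i
  have he : (if e then twist R g T (y + z) else y + z) =
      (if e then twist R g T y else y) + (if e then twist R g T z else z) := by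
    split_ifs
    · exact twist_add R g T y z
    · rfl
  rw [hcTuple, hcTuple, hcTuple, H, H, H, he, mul_add, add_mul]
  exact boxTmul_add (M := fun _ : Fin (m + 1) => R.toMackeyFunctor) _ j _ _

lemma hcTuple_tr (g : G) (R : GreenFunctor.{u} G) (θ : Fin (m + 1) →o Fin (k + 1))
    {T T' : FinGSet G} (h : T' →[G] T) (x : Fin (k + 1) → R.obj T) (i : Fin (k + 1))
    (y : R.obj T') :
    hcTuple g R θ T (Function.update x i (R.tr h y)) =
      (bigBox fun _ : Fin (m + 1) => R.toMackeyFunctor).tr h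
        (hcTuple g R θ T' (Function.update (fun j => R.res h (x j)) i y)) := by
  obtain ⟨j, e, a, b, c, d, a', b', c', d', H⟩ := cyc_update θ i
  have he : (if e then twist R g T (R.tr h y) else R.tr h y) =
      R.tr h (if e then twist R g T' y else y) := by
    split_ifs
    · exact twist_tr R g h y
    · rfl
  have hs : ∀ a b, seg (fun j => R.res h (x j)) a b = R.res h (seg x a b) := fun a b =>
    map_seg (R.resRing h : R.obj T →* R.obj T') x a b
  rw [hcTuple, hcTuple, H, H, he, res_cyc]
  simp only [hs, ← res_twist, ← R.res_mul]
  rw [← R.tr_res_mul, ← R.tr_mul_res]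
  exact boxTmul_tr (M := fun _ : Fin (m + 1) => R.toMackeyFunctor) h _ j _

/-- The operators of the twisted cyclic bar construction. -/
noncomputable def hcMap (g : G) (R : GreenFunctor.{u} G) (θ : Fin (m + 1) →o Fin (k + 1)) :
    (bigBox fun _ : Fin (k + 1) => R.toMackeyFunctor) ⟶
      bigBox fun _ : Fin (m + 1) => R.toMackeyFunctor :=
  boxDesc (fun T x => hcTuple g R θ T x) (fun h x => hcTuple_res g R θ h x)
    (fun x i y z => hcTuple_add g R θ x i y z) (fun h x i y => hcTuple_tr g R θ h x i y)

lemma hcMap_tmul (g : G) (R : GreenFunctor.{u} G) (θ : Fin (m + 1) →o Fin (k + 1))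
    {T : FinGSet G} (x : Fin (k + 1) → R.obj T) :
    (hcMap g R θ).app T (boxTmul (M := fun _ : Fin (k + 1) => R.toMackeyFunctor) x) =
      boxTmul (M := fun _ : Fin (m + 1) => R.toMackeyFunctor) (cyc (twist R g T) θ x) :=
  boxDesc_tmul _ _ _ _ x

/-- The twisted cyclic bar construction of a Green functor `R`: the simplicial Mackey functor with
`k`-simplices `R^{□(k+1)}`, whose face maps `d_i`, `i < k`, multiply adjacent factors, whose last
face map moves the last factor to the front, applies `g` to it and multiplies it with the next
factor, and whose degeneracies insert the unit. -/
noncomputable def hcSimplicial (g : G) (R : GreenFunctor.{u} G) :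
    SimplicialObject (MackeyFunctor.{u} G) where
  obj n := bigBox fun _ : Fin (n.unop.len + 1) => R.toMackeyFunctor
  map f := hcMap g R f.unop.toOrderHom
  map_id _ := bigBox_hom_ext fun _ x => (hcMap_tmul g R _ x).trans (congrArg boxTmul (cyc_id _ x))
  map_comp _ f' := bigBox_hom_ext fun T x => (hcMap_tmul g R _ x).trans (Eq.trans
    (congrArg boxTmul (cyc_comp _ _ _ x).symm)
    ((congrArg ((hcMap g R f'.unop.toOrderHom).app T) (hcMap_tmul g R _ x)).trans
      (hcMap_tmul g R _ _)).symm)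

lemma app_cyc (g : G) {R R' : GreenFunctor.{u} G} (φ : R ⟶ R') (θ : Fin (m + 1) →o Fin (k + 1))
    {T : FinGSet G} (x : Fin (k + 1) → R.obj T) :
    cyc (twist R' g T) θ (fun i => φ.app T (x i)) =
      fun j => φ.app T (cyc (twist R g T) θ x j) :=
  map_cyc ({ toFun := φ.app T, map_one' := φ.app_one T, map_mul' := φ.app_mul } :
    R.obj T →* R'.obj T) (twist R g T) (twist R' g T) (fun y => app_twist φ g T y) θ x

/-- The twisted cyclic bar construction as a functor. -/
noncomputable def hcFunctor (g : G) :
    GreenFunctor.{u} G ⥤ SimplicialObject (MackeyFunctor.{u} G) where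
  obj R := hcSimplicial g R
  map {R R'} φ :=
    { app := fun _ => bigBoxMap fun _ => GreenFunctor.forget.map φ
      naturality := fun a b f => bigBox_hom_ext fun T x => by
        refine ((congrArg ((bigBoxMap fun _ => GreenFunctor.forget.map φ).app T)
          (hcMap_tmul g R f.unop.toOrderHom x)).trans (bigBoxMap_tmul _ _)).trans (Eq.trans ?_
          ((congrArg ((hcMap g R' f.unop.toOrderHom).app T) (bigBoxMap_tmul _ x)).trans
            (hcMap_tmul g R' _ _)).symm)
        exact congrArg boxTmul (app_cyc g φ f.unop.toOrderHom x).symm }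
  map_id _ := NatTrans.ext (funext fun _ => bigBoxMap_id fun _ => rfl)
  map_comp _ _ := NatTrans.ext (funext fun _ => bigBoxMap_comp fun _ => rfl)

/-- The twisted Hochschild complex `HC^G_*(R)`: the normalized chain complex of the twisted cyclic
bar construction. -/
noncomputable def HC (g : G) : GreenFunctor.{u} G ⥤ ChainComplex (MackeyFunctor.{u} G) ℕ :=
  hcFunctor g ⋙ AlgebraicTopology.normalizedMooreComplex _

/-! #### The relative cyclic nerve -/

/-- The identification of all tuples with a zero coordinate. -/
def smashSetoid (M : PointedGMonoid.{u} G) (k : ℕ) : Setoid (Fin (k + 1) → M) where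
  r x y := x = y ∨ (∃ i, x i = 0) ∧ ∃ i, y i = 0
  iseqv :=
    { refl := fun _ => Or.inl rfl
      symm := fun h => h.elim (fun h => Or.inl h.symm) fun h => Or.inr ⟨h.2, h.1⟩
      trans := fun h h' => by
        rcases h with rfl | h
        · exact h'
        · rcases h' with rfl | h'
          · exact Or.inr h
          · exact Or.inr ⟨h.1, h'.2⟩ }

/-- Maps of smash powers. -/
def smashLift {M N : PointedGMonoid.{u} G} (F : (Fin (k + 1) → M) → (Fin (m + 1) → N))
    (hF : ∀ x, (∃ i, x i = 0) → ∃ j, F x j = 0) :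
    Quotient (smashSetoid M k) → Quotient (smashSetoid N m) :=
  Quotient.map' F fun x y h => by
    rcases h with rfl | h
    · exact Or.inl rfl
    · exact Or.inr ⟨hF x h.1, hF y h.2⟩

/-- The smash power `M^{∧(k+1)}`, with the diagonal action. -/
def smashPow (M : PointedGMonoid.{u} G) (k : ℕ) : PointedGSet.{u} G where
  carrier := Quotient (smashSetoid M k)
  act :=
    { smul := fun a => smashLift (fun x i => a • x i) fun x ⟨i, hi⟩ =>
        ⟨i, by rw [hi, M.smul_zero]⟩
      one_smul := fun q => Quotient.inductionOn' q fun x =>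
        congrArg (Quotient.mk'' (s₁ := smashSetoid M k)) (funext fun i => one_smul G (x i))
      mul_smul := fun a b q => Quotient.inductionOn' q fun x =>
        congrArg (Quotient.mk'' (s₁ := smashSetoid M k)) (funext fun i => mul_smul a b (x i)) }
  base := Quotient.mk'' fun _ => 0
  smul_base a := congrArg (Quotient.mk'' (s₁ := smashSetoid M k)) (funext fun _ => M.smul_zero a)

/-- The class of a tuple. -/
def smashMk (M : PointedGMonoid.{u} G) (x : Fin (k + 1) → M) : smashPow M k :=
  Quotient.mk'' (s₁ := smashSetoid M k) x

/-- Pointed equivariant maps of smash powers. -/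
def smashHom {M N : PointedGMonoid.{u} G} (F : (Fin (k + 1) → M) → (Fin (m + 1) → N))
    (hF : ∀ x, (∃ i, x i = 0) → ∃ j, F x j = 0)
    (hG : ∀ (a : G) (x), F (fun i => a • x i) = fun j => a • F x j) :
    smashPow M k ⟶ smashPow N m :=
  ({ toFun :=
      { toFun := smashLift F hF
        map_smul' := fun a q => by
          induction q using Quotient.inductionOn' with
          | h x => exact congrArg (smashMk N) (hG a x) }
     map_base := Quotient.sound' (s₁ := smashSetoid N m)
      (Or.inr ⟨hF _ ⟨0, rfl⟩, 0, rfl⟩) } : PointedGSet.Hom _ _)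

lemma PointedGSet.comp_apply {X Y Z : PointedGSet.{u} G} (φ : X ⟶ Y) (ψ : Y ⟶ Z) (x : X) :
    Hom.toFun (φ ≫ ψ) x = Hom.toFun ψ (Hom.toFun φ x) := rfl

lemma smashHom_ext {M : PointedGMonoid.{u} G} {X : PointedGSet.{u} G} {φ ψ : smashPow M k ⟶ X}
    (h : ∀ x, PointedGSet.Hom.toFun φ (smashMk M x) = PointedGSet.Hom.toFun ψ (smashMk M x)) :
    φ = ψ :=
  PointedGSet.Hom.ext (MulActionHom.ext fun q => Quotient.inductionOn' q h)

/-- The action of `a ∈ G` on a pointed monoid, as an endomorphism of monoids. -/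
def actEnd (M : PointedGMonoid.{u} G) (a : G) : M →* M := MulDistribMulAction.toMonoidHom M a

lemma smul_cyc (g : G) (M : PointedGMonoid.{u} G) (θ : Fin (m + 1) →o Fin (k + 1)) (a : G)
    (x : Fin (k + 1) → M) :
    cyc (actEnd M g) θ (fun i => a • x i) = fun j => a • cyc (actEnd M g) θ x j :=
  map_cyc (actEnd M a) (actEnd M g) (actEnd M g) (fun y => smul_comm a g y) θ x

lemma cyc_zero_mem (g : G) (M : PointedGMonoid.{u} G) (θ : Fin (m + 1) →o Fin (k + 1))
    (x : Fin (k + 1) → M) (h : ∃ i, x i = 0) : ∃ j, cyc (actEnd M g) θ x j = 0 := by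
  obtain ⟨i, hi⟩ := h
  obtain ⟨j, e, a, b, c, d, a', b', c', d', H⟩ := cyc_update θ i
  refine ⟨j, ?_⟩
  have he : (if e then actEnd M g (0 : M) else 0) = 0 := by
    split_ifs
    · exact M.smul_zero g
    · rfl
  have H' := H M (actEnd M g) x 0
  rw [← hi, Function.update_eq_self, hi, he, mul_zero, zero_mul] at H'
  rw [H', Function.update_self]

/-- The operators of the relative cyclic nerve. -/
def ncycMap (g : G) (M : PointedGMonoid.{u} G) (θ : Fin (m + 1) →o Fin (k + 1)) :
    smashPow M k ⟶ smashPow M m :=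
  smashHom (fun x => cyc (actEnd M g) θ x) (cyc_zero_mem g M θ) (smul_cyc g M θ)

lemma ncycMap_mk (g : G) (M : PointedGMonoid.{u} G) (θ : Fin (m + 1) →o Fin (k + 1))
    (x : Fin (k + 1) → M) : PointedGSet.Hom.toFun (ncycMap g M θ) (smashMk M x) =
      smashMk M (cyc (actEnd M g) θ x) := rfl

/-- The relative cyclic nerve of a pointed monoid `M` in `G`-sets, as a simplicial pointed `G`-set:
its `k`-simplices are `M^{∧(k+1)}` with the diagonal action, the face maps `d_i`, `i < k`, multiply
adjacent factors, the last face map moves the last factor to the front, applies `g` to it and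
multiplies it with the next factor, and the degeneracies insert the unit. -/
def ncycObj (g : G) (M : PointedGMonoid.{u} G) : SimplicialObject (PointedGSet.{u} G) where
  obj n := smashPow M n.unop.len
  map f := ncycMap g M f.unop.toOrderHom
  map_id n := smashHom_ext fun x =>
    (ncycMap_mk g M _ x).trans (congrArg (smashMk M) (cyc_id _ x))
  map_comp f f' := smashHom_ext fun x => by
    rw [PointedGSet.comp_apply, ncycMap_mk, ncycMap_mk, ncycMap_mk, cyc_comp]
    rfl

/-- Functoriality of the smash powers. -/
def smashMap {M N : PointedGMonoid.{u} G} (φ : M ⟶ N) (k : ℕ) : smashPow M k ⟶ smashPow N k :=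
  smashHom (fun x i => PointedGMonoid.Hom.toFun φ (x i))
    (fun x ⟨i, hi⟩ => ⟨i, by rw [hi, map_zero]⟩)
    (fun a x => funext fun i => φ.map_smul a (x i))

lemma smashMap_mk {M N : PointedGMonoid.{u} G} (φ : M ⟶ N) (x : Fin (k + 1) → M) :
    PointedGSet.Hom.toFun (smashMap φ k) (smashMk M x) =
      smashMk N fun i => PointedGMonoid.Hom.toFun φ (x i) := rfl

lemma ncycMap_smashMap (g : G) {M N : PointedGMonoid.{u} G} (φ : M ⟶ N)
    (θ : Fin (m + 1) →o Fin (k + 1)) :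
    ncycMap g M θ ≫ smashMap φ m = smashMap φ k ≫ ncycMap g N θ :=
  smashHom_ext fun x => by
    rw [PointedGSet.comp_apply, PointedGSet.comp_apply, smashMap_mk, ncycMap_mk, ncycMap_mk,
      smashMap_mk]
    exact congrArg (smashMk N)
      (map_cyc (PointedGMonoid.Hom.toFun φ : M →* N) (actEnd M g) (actEnd N g)
        (fun y => φ.map_smul g y) θ x).symm

/-- The relative cyclic nerve as a functor. -/
def Ncyc (g : G) : PointedGMonoid.{u} G ⥤ SimplicialObject (PointedGSet.{u} G) where
  obj M := ncycObj g M
  map φ :=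
    { app := fun n => smashMap φ n.unop.len
      naturality := fun _ _ f => ncycMap_smashMap g φ f.unop.toOrderHom }
  map_id _ := NatTrans.ext (funext fun _ => smashHom_ext fun _ => rfl)
  map_comp _ _ := NatTrans.ext (funext fun _ => smashHom_ext fun _ => rfl)

end Twisted

section Cellular

variable (G : Type) [Group G]

/-- The Mackey-functor-valued (reduced) Bredon cellular chains, with Burnside coefficients, of the
geometric realization of a pointed simplicial `G`-set `X`: the normalized chain complex of the
simplicial Mackey functor `k ↦ A_{X_k} / A_∗`. -/
noncomputable def cellularChains :
    SimplicialObject (PointedGSet.{u} G) ⥤ ChainComplex (MackeyFunctor.{u} G) ℕ :=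
  ((SimplicialObject.whiskering _ _).obj (repr G)) ⋙ AlgebraicTopology.normalizedMooreComplex _

end Cellular

end EquivariantHH

/-! Two facts combine: an isomorphism of simplicial Mackey functors, and an Eilenberg–Zilber theorem
valid for every biadditive bifunctor.

The isomorphism. In each simplicial degree `□ (r_i · x_i) ↔ (□ r_i) □ (x_0 ∧ … ∧ x_k)` identifies
`R[M]^{□(k+1)}` with `R^{□(k+1)} □ A_X / A_∗`, where `X` is the smash power `M^{∧(k+1)}`
(`algPowIso`). The cyclic operators multiply coefficients and monoid elements separately, and `g`
acts on each of them, so these isomorphisms are simplicial and natural (`hcMonoidAlgebraIso`). The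
target is therefore the normalized complex of the diagonal of the bisimplicial object `(a, b) ↦
R^{□(a+1)} □ A_{M^{∧(b+1)}} / A_∗`, and the source is, up to homotopy equivalence, its total
complex.

The comparison of total and diagonal complexes is made once, in the universal case. The universal
bisimplicial object lives in `Mat_ (Free ℤ BiSimplex)`; the maps into it from a formal sum of
objects `([p], [q])` form the direct sum of the bisimplicial groups `ℤ[Δ^p × Δ^q]`, and prepending
the vertex `0` contracts these in both directions. Hence maps from any object see no homology in
positive degrees of either complex (`relAcyclic_total`, `relAcyclic_diagCx`), and explicit maps in
degrees `0` and `1` extend to inverse homotopy equivalences (`exists_homotopyEquiv_of_relAcyclic`),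
as in the method of acyclic models. Any bisimplicial object `X` with values in an additive category
is the image of the universal one under an additive functor `realize X`, naturally in `X`. Additive
functors preserve homotopy equivalences, so the result transfers without any flatness of `R` or
exactness of the box product.

The work on the algebraic side is that an element of `R[M]` is a sum of transfers of elements `r ·
x`, not such an element itself. `algBox_hom_ext` and `exists_algBox_desc` show that morphisms out of
`R[M]^{□(k+1)}` are nevertheless determined by, and can be prescribed on, the tensors `□ (r_i ·
x_i)`. Coordinates on a smash power exist only away from the base point; `boxTmul_algElt_rep` shows
that this ambiguity is invisible to the tensors, by cutting the finite `G`-set into the part where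
some coordinate vanishes and the part where none does. -/

namespace EquivariantHH

/-! ### Comparison of chain complexes under relative acyclicity (acyclic models). -/

section Comparison

variable {𝒜 : Type*} [Category* 𝒜] [Preadditive 𝒜]

/-- Every map from `P` to a positive degree cycle of `L` is a boundary. -/
def RelAcyclic (P : 𝒜) (L : ChainComplex 𝒜 ℕ) : Prop :=
  ∀ (n : ℕ) (f : P ⟶ L.X (n + 1)), f ≫ L.d (n + 1) n = 0 →
    ∃ g : P ⟶ L.X (n + 2), g ≫ L.d (n + 2) (n + 1) = f

/-- Extension of a chain map given in degrees `0` and `1`, under relative acyclicity. -/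
lemma exists_hom_of_relAcyclic {K L : ChainComplex 𝒜 ℕ} (ex : ∀ m, RelAcyclic (K.X m) L)
    (φ₀ : K.X 0 ⟶ L.X 0) (φ₁ : K.X 1 ⟶ L.X 1) (comm : φ₁ ≫ L.d 1 0 = K.d 1 0 ≫ φ₀) :
    ∃ φ : K ⟶ L, φ.f 0 = φ₀ := by
  have step : ∀ (n : ℕ) (p : Σ' (f : K.X n ⟶ L.X n) (f' : K.X (n + 1) ⟶ L.X (n + 1)),
      f' ≫ L.d (n + 1) n = K.d (n + 1) n ≫ f),
      ∃ f'' : K.X (n + 2) ⟶ L.X (n + 2), f'' ≫ L.d (n + 2) (n + 1) = K.d (n + 2) (n + 1) ≫ p.2.1 :=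
    fun n p => ex _ n _ (by
      rw [Category.assoc, p.2.2, K.d_comp_d_assoc, zero_comp])
  exact ⟨ChainComplex.mkHom K L φ₀ φ₁ comm fun n p => ⟨(step n p).choose, (step n p).choose_spec⟩,
    rfl⟩

/-- Chain maps which agree in degree `0` are homotopic, under relative acyclicity. -/
lemma nonempty_homotopy_of_relAcyclic {K L : ChainComplex 𝒜 ℕ} (ex : ∀ m, RelAcyclic (K.X m) L)
    (φ ψ : K ⟶ L) (h : φ.f 0 = ψ.f 0) : Nonempty (Homotopy φ ψ) := by
  have h₀ : (φ - ψ).f 0 = 0 := by simp [h]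
  -- The homotopy is zero in degree `0`. This is why exact agreement in degree `0` is required: it
  -- makes the degree `1` component of `φ - ψ` a cycle, and `RelAcyclic` controls cycles in positive
  -- degrees only.
  have one : ∃ f : K.X 1 ⟶ L.X 2, f ≫ L.d 2 1 = (φ - ψ).f 1 :=
    ex 1 0 _ (by rw [(φ - ψ).comm, h₀, comp_zero])
  have step : ∀ (n : ℕ) (p : Σ' (f : K.X n ⟶ L.X (n + 1)) (f' : K.X (n + 1) ⟶ L.X (n + 2)),
      (φ - ψ).f (n + 1) = K.d (n + 1) n ≫ f + f' ≫ L.d (n + 2) (n + 1)),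
      ∃ f'' : K.X (n + 2) ⟶ L.X (n + 3), f'' ≫ L.d (n + 3) (n + 2) =
        (φ - ψ).f (n + 2) - K.d (n + 2) (n + 1) ≫ p.2.1 := fun n p => ex _ _ _ (by
      have e : p.2.1 ≫ L.d (n + 2) (n + 1) = (φ - ψ).f (n + 1) - K.d (n + 1) n ≫ p.1 := by
        exact eq_sub_of_add_eq' p.2.2.symm
      rw [Preadditive.sub_comp, (φ - ψ).comm, Category.assoc, e, Preadditive.comp_sub,
        K.d_comp_d_assoc, zero_comp, sub_zero, sub_self])
  exact ⟨Homotopy.equivSubZero.symm (Homotopy.mkInductive (φ - ψ) 0 (by simpa using h₀)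
    one.choose (by rw [one.choose_spec, comp_zero, zero_add]) fun n p =>
      ⟨(step n p).choose, by rw [(step n p).choose_spec]; abel⟩)⟩

/-- Relative acyclicity says nothing about degree `0` homology, so the maps in degrees `0` and `1`
have to be supplied. Everything above is an extension problem, and both composites are homotopic to
the identity because they equal it in degree `0`. -/
lemma exists_homotopyEquiv_of_relAcyclic {K L : ChainComplex 𝒜 ℕ}
    (hKK : ∀ m, RelAcyclic (K.X m) K) (hKL : ∀ m, RelAcyclic (K.X m) L)
    (hLK : ∀ m, RelAcyclic (L.X m) K) (hLL : ∀ m, RelAcyclic (L.X m) L)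
    (φ₀ : K.X 0 ⟶ L.X 0) (φ₁ : K.X 1 ⟶ L.X 1) (hφ : φ₁ ≫ L.d 1 0 = K.d 1 0 ≫ φ₀)
    (ψ₀ : L.X 0 ⟶ K.X 0) (ψ₁ : L.X 1 ⟶ K.X 1) (hψ : ψ₁ ≫ K.d 1 0 = L.d 1 0 ≫ ψ₀)
    (h : φ₀ ≫ ψ₀ = 𝟙 _) (h' : ψ₀ ≫ φ₀ = 𝟙 _) : Nonempty (HomotopyEquiv K L) := by
  obtain ⟨φ, hφ₀⟩ := exists_hom_of_relAcyclic hKL φ₀ φ₁ hφ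
  obtain ⟨ψ, hψ₀⟩ := exists_hom_of_relAcyclic hLK ψ₀ ψ₁ hψ
  obtain ⟨H⟩ := nonempty_homotopy_of_relAcyclic hKK (φ ≫ ψ) (𝟙 K) (by simp [hφ₀, hψ₀, h])
  obtain ⟨H'⟩ := nonempty_homotopy_of_relAcyclic hLL (ψ ≫ φ) (𝟙 L) (by simp [hφ₀, hψ₀, h'])
  exact ⟨⟨φ, ψ, H, H'⟩⟩

end Comparison

/-! ### Additive extension of a functor to formal linear combinations and formal direct sums. -/

section Realization

variable {I : Type*} [Category* I] {D : Type*} [Category* D] [Preadditive D]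

/-- A multiple of a morphism, as a formal linear combination. -/
noncomputable def linSingle {i j : I} (φ : i ⟶ j) (r : ℤ) : Free.of ℤ i ⟶ Free.of ℤ j :=
  (Finsupp.single φ r : (i ⟶ j) →₀ ℤ)

lemma linSingle_comp {i j k : I} (φ : i ⟶ j) (ψ : j ⟶ k) (r s : ℤ) :
    linSingle φ r ≫ linSingle ψ s = linSingle (φ ≫ ψ) (r * s) :=
  Free.single_comp_single ℤ I φ ψ r s

/-- The morphisms of `Free ℤ I` are finitely supported functions only after unfolding; this form of
the induction keeps the goals in terms of `linSingle`. -/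
lemma lin_induction {i j : I} {p : (Free.of ℤ i ⟶ Free.of ℤ j) → Prop}
    (zero : p 0) (add : ∀ f g, p f → p g → p (f + g)) (single : ∀ φ r, p (linSingle φ r))
    (f : Free.of ℤ i ⟶ Free.of ℤ j) : p f :=
  Finsupp.induction_linear (motive := p) f zero add single

/-- The homomorphism out of the formal linear combinations given by its values on morphisms. -/
noncomputable def linHom {i j : I} {A : Type*} [AddCommGroup A] (F : (i ⟶ j) → A) :
    (Free.of ℤ i ⟶ Free.of ℤ j) →+ A :=
  (Finsupp.liftAddHom fun φ => (AddMonoidHom.mk' (fun r : ℤ => r • F φ) fun a b => add_smul a b _) :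
    ((i ⟶ j) →₀ ℤ) →+ A)

lemma linHom_single {i j : I} {A : Type*} [AddCommGroup A] (F : (i ⟶ j) → A) (φ : i ⟶ j) (r : ℤ) :
    linHom F (linSingle φ r) = r • F φ :=
  Finsupp.liftAddHom_apply_single _ _ _

/-- The extension of a functor to formal linear combinations of morphisms, on morphisms. -/
noncomputable def linMap (X : I ⥤ D) (i j : I) :
    (Free.of ℤ i ⟶ Free.of ℤ j) →+ (X.obj i ⟶ X.obj j) :=
  linHom X.map

lemma linMap_comp (X : I ⥤ D) {i j k : I} (f : Free.of ℤ i ⟶ Free.of ℤ j)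
    (g : Free.of ℤ j ⟶ Free.of ℤ k) :
    linMap X i k (f ≫ g) = linMap X i j f ≫ linMap X j k g := by
  induction f using lin_induction with
  | zero => rw [map_zero, zero_comp, zero_comp, map_zero]
  | add f₁ f₂ h₁ h₂ =>
    rw [map_add, Preadditive.add_comp, Preadditive.add_comp, map_add, h₁, h₂]
  | single φ r =>
    induction g using lin_induction with
    | zero => rw [map_zero, comp_zero, comp_zero, map_zero]
    | add f₁ f₂ h₁ h₂ =>
      rw [map_add, Preadditive.comp_add, Preadditive.comp_add, map_add, h₁, h₂]
    | single ψ s =>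
      rw [linSingle_comp]
      refine (linHom_single _ _ _).trans ?_
      refine Eq.trans ?_ (congrArg₂ (· ≫ ·) (linHom_single X.map φ r)
        (linHom_single X.map ψ s)).symm
      simp only [X.map_comp, Preadditive.zsmul_comp, Preadditive.comp_zsmul, mul_smul]
      exact smul_comm _ _ _

/-- The additive extension of a functor to the linearization. -/
noncomputable def linLift (X : I ⥤ D) : Free ℤ I ⥤ D where
  obj i := X.obj i
  map {i j} f := linMap X i j f
  map_id i := (linHom_single X.map (𝟙 (show I from i)) 1).trans (by
    rw [one_smul]; exact X.map_id _)
  map_comp f g := linMap_comp X f g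

instance (X : I ⥤ D) : (linLift X).Additive where
  map_add {i j f g} := (linMap X i j).map_add f g

/-- The additive extension of an additive functor to formal finite direct sums. -/
noncomputable def matLift {S : Type*} [Category* S] [Preadditive S] [HasFiniteBiproducts D]
    (F : S ⥤ D) [F.Additive] : Mat_ S ⥤ D where
  obj M := ⨁ fun i => F.obj (M.X i)
  map f := biproduct.matrix fun i j => F.map (f i j)
  map_id M := by
    classical
    ext i j
    by_cases h : j = i
    · subst h; simp
    · simp [h]
  map_comp f g := by
    ext i j
    simp [biproduct.lift_desc]

instance {S : Type*} [Category* S] [Preadditive S] [HasFiniteBiproducts D]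
    (F : S ⥤ D) [F.Additive] : (matLift F).Additive where
  map_add := by
    intro M N f g
    have h : (biproduct.matrix fun i j => F.map ((f + g) i j)) =
        (biproduct.matrix fun i j => F.map (f i j)) + biproduct.matrix fun i j => F.map (g i j) := by
      refine biproduct.hom_ext _ _ fun i => biproduct.hom_ext' _ _ fun j => ?_
      rw [Preadditive.add_comp, Preadditive.comp_add]
      simp
    exact h

end Realization

/-! ### Total and diagonal complexes of bisimplicial objects. -/

section Bisimplicial
open Opposite Simplicial AlgebraicTopology

/-- The index category of bisimplicial objects. -/
abbrev BiSimplex : Type := SimplexCategoryᵒᵖ × SimplexCategoryᵒᵖ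

/-- The object `([a], [b])`. -/
abbrev biObj (a b : ℕ) : BiSimplex := (op ⦋a⦌, op ⦋b⦌)

/-- The horizontal face maps. -/
abbrev hFace {a : ℕ} (i : Fin (a + 2)) (b : ℕ) : biObj (a + 1) b ⟶ biObj a b :=
  ((SimplexCategory.δ i).op, 𝟙 _)

/-- The vertical face maps. -/
abbrev vFace (a : ℕ) {b : ℕ} (j : Fin (b + 2)) : biObj a (b + 1) ⟶ biObj a b :=
  (𝟙 _, (SimplexCategory.δ j).op)

variable {D : Type*} [Category* D] [Preadditive D] (X Y : BiSimplex ⥤ D)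

/-- The horizontal differential of a bisimplicial object. -/
def hDiff (a b : ℕ) : X.obj (biObj (a + 1) b) ⟶ X.obj (biObj a b) :=
  ∑ i : Fin (a + 2), (-1 : ℤ) ^ (i : ℕ) • X.map (hFace i b)

/-- The vertical differential of a bisimplicial object. -/
def vDiff (a b : ℕ) : X.obj (biObj a (b + 1)) ⟶ X.obj (biObj a b) :=
  ∑ j : Fin (b + 2), (-1 : ℤ) ^ (j : ℕ) • X.map (vFace a j)

/-- A total complex of the double complex of a bisimplicial object. -/
structure TotalCx where
  cx : ChainComplex D ℕ
  ι : ∀ (a b n : ℕ), a + b = n → (X.obj (biObj a b) ⟶ cx.X n)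
  desc : ∀ {n : ℕ} {Z : D}, (∀ a b, a + b = n → (X.obj (biObj a b) ⟶ Z)) → (cx.X n ⟶ Z)
  ι_desc : ∀ {n : ℕ} {Z : D} (f : ∀ a b, a + b = n → (X.obj (biObj a b) ⟶ Z)) (a b h),
    ι a b n h ≫ desc f = f a b h
  hom_ext : ∀ {n : ℕ} {Z : D} {f f' : cx.X n ⟶ Z}, (∀ a b h, ι a b n h ≫ f = ι a b n h ≫ f') →
    f = f'
  -- The differential is prescribed separately on the two edges and in the interior, because `hDiff`
  -- and `vDiff` start at positive indices only. The vertical differential carries the sign `(-1) ^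
  -- a`, which is trivial on the edge `a = 0`.
  ι_d_zero_succ : ∀ (b n : ℕ) (h : 0 + (b + 1) = n + 1) (h' : 0 + b = n),
    ι 0 (b + 1) (n + 1) h ≫ cx.d (n + 1) n = vDiff X 0 b ≫ ι 0 b n h'
  ι_d_succ_zero : ∀ (a n : ℕ) (h : (a + 1) + 0 = n + 1) (h' : a + 0 = n),
    ι (a + 1) 0 (n + 1) h ≫ cx.d (n + 1) n = hDiff X a 0 ≫ ι a 0 n h'
  ι_d_succ_succ : ∀ (a b n : ℕ) (h : (a + 1) + (b + 1) = n + 1) (h₁ : a + (b + 1) = n)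
    (h₂ : (a + 1) + b = n),
    ι (a + 1) (b + 1) (n + 1) h ≫ cx.d (n + 1) n =
      hDiff X a (b + 1) ≫ ι a (b + 1) n h₁ +
        (-1 : ℤ) ^ (a + 1) • vDiff X (a + 1) b ≫ ι (a + 1) b n h₂

variable {X Y}

section OfDouble

variable (K : HomologicalComplex₂ D (ComplexShape.down ℕ) (ComplexShape.down ℕ))
  [K.HasTotal (ComplexShape.down ℕ)]

lemma double_d₁_zero (b n : ℕ) : K.d₁ (ComplexShape.down ℕ) 0 b n = 0 :=
  K.d₁_eq_zero _ _ _ _ (by simp)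

lemma double_d₂_zero (a n : ℕ) : K.d₂ (ComplexShape.down ℕ) a 0 n = 0 :=
  K.d₂_eq_zero _ _ _ _ (by simp)

lemma double_d₁_succ (a b n : ℕ) (h : a + b = n) : K.d₁ (ComplexShape.down ℕ) (a + 1) b n =
    (K.d (a + 1) a).f b ≫ K.ιTotal (ComplexShape.down ℕ) a b n h := by
  have r : (ComplexShape.down ℕ).Rel (a + 1) a := rfl
  rw [K.d₁_eq _ r b n h]
  exact one_smul _ _

/-- This is where the sign convention for totals of double complexes enters: the second differential
is twisted by the first degree, in agreement with `TotalCx`. -/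
lemma double_d₂_succ (a b n : ℕ) (h : a + b = n) : K.d₂ (ComplexShape.down ℕ) a (b + 1) n =
    (-1 : ℤ) ^ a • ((K.X a).d (b + 1) b ≫ K.ιTotal (ComplexShape.down ℕ) a b n h) := by
  have r : (ComplexShape.down ℕ).Rel (b + 1) b := rfl
  rw [K.d₂_eq _ a r n h]
  refine (Units.smul_def _ _).trans ?_
  congr 1

lemma double_ι_d (a b n : ℕ) (h : a + b = n + 1) :
    K.ιTotal (ComplexShape.down ℕ) a b (n + 1) h ≫ (K.total (ComplexShape.down ℕ)).d (n + 1) n =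
      K.d₁ (ComplexShape.down ℕ) a b n + K.d₂ (ComplexShape.down ℕ) a b n := by
  rw [HomologicalComplex₂.total_d, Preadditive.comp_add, K.ι_D₁, K.ι_D₂]

variable {K}

/-- A total complex from a double complex. -/
noncomputable def TotalCx.ofDouble (e : ∀ a b, X.obj (biObj a b) ≅ (K.X a).X b)
    (he₁ : ∀ a b, (e (a + 1) b).hom ≫ (K.d (a + 1) a).f b = hDiff X a b ≫ (e a b).hom)
    (he₂ : ∀ a b, (e a (b + 1)).hom ≫ (K.X a).d (b + 1) b = vDiff X a b ≫ (e a b).hom) :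
    TotalCx X where
  cx := K.total (ComplexShape.down ℕ)
  ι a b n h := (e a b).hom ≫ K.ιTotal (ComplexShape.down ℕ) a b n h
  desc f := K.totalDesc fun a b h => (e a b).inv ≫ f a b h
  ι_desc f a b h := by rw [Category.assoc, K.ι_totalDesc, Iso.hom_inv_id_assoc]
  hom_ext {n Z f f'} H := HomologicalComplex₂.total.hom_ext _ fun a b h => by
    have := H a b h
    rwa [Category.assoc, Category.assoc, cancel_epi] at this
  ι_d_zero_succ b n h h' := by
    rw [Category.assoc, double_ι_d, double_d₁_zero, double_d₂_succ K _ _ _ h', zero_add, pow_zero,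
      one_smul, reassoc_of% he₂]
  ι_d_succ_zero a n h h' := by
    rw [Category.assoc, double_ι_d, double_d₂_zero, double_d₁_succ K _ _ _ h', add_zero,
      reassoc_of% he₁]
  ι_d_succ_succ a b n h h₁ h₂ := by
    rw [Category.assoc, double_ι_d, double_d₁_succ K _ _ _ h₁, double_d₂_succ K _ _ _ h₂,
      Preadditive.comp_add, Preadditive.comp_zsmul, reassoc_of% he₁, reassoc_of% he₂]

end OfDouble

/-- The double complex of a bisimplicial object. -/
noncomputable def doubleCx (X : BiSimplex ⥤ D) :
    HomologicalComplex₂ D (ComplexShape.down ℕ) (ComplexShape.down ℕ) :=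
  (alternatingFaceMapComplex (ChainComplex D ℕ)).obj
    (Functor.curry.obj X ⋙ alternatingFaceMapComplex D)

lemma sum_zsmul_f {C₁ C₂ : ChainComplex D ℕ} {J : Type*} (s : Finset J) (z : J → ℤ)
    (φ : J → (C₁ ⟶ C₂)) (b : ℕ) : (∑ i ∈ s, z i • φ i).f b = ∑ i ∈ s, z i • (φ i).f b := by
  refine (map_sum (HomologicalComplex.Hom.fAddMonoidHom (C₁ := C₁) (C₂ := C₂) b) _ _).trans ?_
  exact Finset.sum_congr rfl fun i _ => map_zsmul (HomologicalComplex.Hom.fAddMonoidHom b) _ _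

lemma doubleCx_d_f (a b : ℕ) : ((doubleCx X).d (a + 1) a).f b = hDiff X a b :=
  (congrArg (fun φ => HomologicalComplex.Hom.f φ b) (alternatingFaceMapComplex_obj_d _ a)).trans
    (sum_zsmul_f _ _ _ b)

lemma doubleCx_X_d (a b : ℕ) : ((doubleCx X).X a).d (b + 1) b = vDiff X a b :=
  alternatingFaceMapComplex_obj_d _ b

/-- Only finitely many bidegrees have total degree `n`, so finite direct sums are enough to form
total complexes. -/
lemma finite_antidiagonal (n : ℕ) : Finite ((ComplexShape.π (ComplexShape.down ℕ)
    (ComplexShape.down ℕ) (ComplexShape.down ℕ)) ⁻¹' {n}) :=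
  Set.Finite.to_subtype (((Set.finite_Iic n).prod (Set.finite_Iic n)).subset
    (by
      rintro ⟨p, q⟩ h
      have h' : p + q = n := h
      exact ⟨show p ≤ n by omega, show q ≤ n by omega⟩))

instance [HasFiniteBiproducts D]
    (K : HomologicalComplex₂ D (ComplexShape.down ℕ) (ComplexShape.down ℕ)) :
    K.HasTotal (ComplexShape.down ℕ) := fun n => by
  have := finite_antidiagonal n
  have := hasColimitsOfShape_discrete D ((ComplexShape.π (ComplexShape.down ℕ)
    (ComplexShape.down ℕ) (ComplexShape.down ℕ)) ⁻¹' {n})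
  infer_instance

variable (X) in
/-- The total complex of a bisimplicial object in a category with finite direct sums. -/
noncomputable def TotalCx.total [HasFiniteBiproducts D] : TotalCx X :=
  TotalCx.ofDouble (K := doubleCx X) (fun _ _ => Iso.refl _)
    (fun a b => by
      rw [doubleCx_d_f]; exact (Category.id_comp _).trans (Category.comp_id _).symm)
    (fun a b => by
      rw [doubleCx_X_d]; exact (Category.id_comp _).trans (Category.comp_id _).symm)

variable (X) in
/-- The chain complex of the diagonal of a bisimplicial object. -/
noncomputable def diagCx : ChainComplex D ℕ :=
  (alternatingFaceMapComplex D).obj (Functor.diag _ ⋙ X)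

/-- The diagonal face maps. -/
abbrev dFace {n : ℕ} (i : Fin (n + 2)) : biObj (n + 1) (n + 1) ⟶ biObj n n :=
  ((SimplexCategory.δ i).op, (SimplexCategory.δ i).op)

lemma diagCx_d (n : ℕ) : (diagCx X).d (n + 1) n =
    ∑ i : Fin (n + 2), (-1 : ℤ) ^ (i : ℕ) • X.map (dFace i) :=
  alternatingFaceMapComplex_obj_d _ n

end Bisimplicial

/-! ### Acyclicity of total and diagonal complexes from horizontal and vertical contractions. -/

section Contraction
open Opposite Simplicial AlgebraicTopology

variable {D : Type*} [Category* D] [Preadditive D] {X : BiSimplex ⥤ D}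

namespace TotalCx

variable (T : TotalCx X)

/-- The projections of a total complex. -/
def π (a b n : ℕ) (h : a + b = n) : T.cx.X n ⟶ X.obj (biObj a b) :=
  T.desc fun a' b' h' => if e : a' = a then
    X.map (eqToHom (show biObj a' b' = biObj a b by
      obtain rfl : b' = b := by omega
      rw [e])) else 0

lemma ι_π_self (a b n : ℕ) (h : a + b = n) : T.ι a b n h ≫ T.π a b n h = 𝟙 _ := by
  rw [π, T.ι_desc, dif_pos rfl, eqToHom_refl, X.map_id]

lemma ι_π_of_ne {a a' b b' n : ℕ} (h : a + b = n) (h' : a' + b' = n) (ha : a ≠ a') :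
    T.ι a b n h ≫ T.π a' b' n h' = 0 := by
  rw [π, T.ι_desc, dif_neg ha]

/-- The pairs with `a + b = n` are indexed by `i : Fin (n + 1)`, with second entry the truncated
difference `n - i`. When a single `a` contributes, the sum collapses, and the replacement of `n - a`
by `b` is made here once and for all. -/
lemma sum_fin_eq {A : Type*} [AddCommMonoid A] {n : ℕ} (F : ∀ a b, a + b = n → A) (a b : ℕ)
    (h : a + b = n) (H : ∀ a' b' h', a' ≠ a → F a' b' h' = 0) :
    ∑ i : Fin (n + 1), F i (n - i) (by omega) = F a b h := by
  obtain rfl : b = n - a := by omega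
  rw [Finset.sum_eq_single (⟨a, by omega⟩ : Fin (n + 1))]
  · intro i _ hi
    exact H _ _ _ fun e => hi (Fin.ext e)
  · intro hi
    exact absurd (Finset.mem_univ _) hi

/-- A `TotalCx` is specified by maps out of its terms. Since only finitely many summands occur and
zero morphisms exist, each term is also a biproduct, and maps into it can be decomposed as well. -/
lemma sum_π_ι (n : ℕ) :
    ∑ i : Fin (n + 1), T.π i (n - i) n (by omega) ≫ T.ι i (n - i) n (by omega) =
      𝟙 (T.cx.X n) := by
  refine T.hom_ext fun a b h => ?_
  rw [Preadditive.comp_sum, Category.comp_id]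
  refine (sum_fin_eq (fun a' b' h' => T.ι a b n h ≫ T.π a' b' n h' ≫ T.ι a' b' n h') a b h
    fun a' b' h' ne => ?_).trans ?_
  · rw [← Category.assoc, T.ι_π_of_ne h h' ne.symm, zero_comp]
  · rw [← Category.assoc, T.ι_π_self, Category.id_comp]

/-- Homomorphisms on maps into a total complex are determined on the summands. -/
lemma hom_to_ext {P : D} {A : Type*} [AddCommGroup A] {n : ℕ} {F F' : (P ⟶ T.cx.X n) →+ A}
    (H : ∀ a b h (g : P ⟶ X.obj (biObj a b)), F (g ≫ T.ι a b n h) = F' (g ≫ T.ι a b n h))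
    (f : P ⟶ T.cx.X n) : F f = F' f := by
  rw [← Category.comp_id f, ← T.sum_π_ι, Preadditive.comp_sum, map_sum, map_sum]
  refine Finset.sum_congr rfl fun i _ => ?_
  rw [← Category.assoc]
  exact H _ _ _ _

end TotalCx

variable (X) in
/-- Contracting homotopies in both directions of the bisimplicial abelian group of maps from `P`. -/
structure BiContraction (P : D) where
  sh : ∀ {a b : ℕ}, (P ⟶ X.obj (biObj a b)) →+ (P ⟶ X.obj (biObj (a + 1) b))
  sv : ∀ {a b : ℕ}, (P ⟶ X.obj (biObj a b)) →+ (P ⟶ X.obj (biObj a (b + 1)))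
  -- There is no augmentation, so in horizontal degree `0` the contraction leaves an error term `η`:
  -- the projection of each simplex to a base vertex. No vertical counterpart is needed, since `sv`
  -- is differentiated only in positive vertical degree.
  η : ∀ {b : ℕ}, (P ⟶ X.obj (biObj 0 b)) →+ (P ⟶ X.obj (biObj 0 b))
  sh_zero : ∀ {a b : ℕ} (f : P ⟶ X.obj (biObj a b)), sh f ≫ X.map (hFace 0 b) = f
  sh_succ : ∀ {a b : ℕ} (f : P ⟶ X.obj (biObj (a + 1) b)) (i : Fin (a + 2)),
    sh f ≫ X.map (hFace i.succ b) = sh (f ≫ X.map (hFace i b))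
  sh_one : ∀ {b : ℕ} (f : P ⟶ X.obj (biObj 0 b)), sh f ≫ X.map (hFace 1 b) = η f
  sh_vFace : ∀ {a b : ℕ} (f : P ⟶ X.obj (biObj a (b + 1))) (j : Fin (b + 2)),
    sh f ≫ X.map (vFace (a + 1) j) = sh (f ≫ X.map (vFace a j))
  sv_zero : ∀ {a b : ℕ} (f : P ⟶ X.obj (biObj a b)), sv f ≫ X.map (vFace a 0) = f
  sv_succ : ∀ {a b : ℕ} (f : P ⟶ X.obj (biObj a (b + 1))) (j : Fin (b + 2)),
    sv f ≫ X.map (vFace a j.succ) = sv (f ≫ X.map (vFace a j))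
  sv_hFace : ∀ {a b : ℕ} (f : P ⟶ X.obj (biObj (a + 1) b)) (i : Fin (a + 2)),
    sv f ≫ X.map (hFace i (b + 1)) = sv (f ≫ X.map (hFace i b))
  η_hFace : ∀ {b : ℕ} (f : P ⟶ X.obj (biObj 1 b)),
    η (f ≫ X.map (hFace 0 b)) = η (f ≫ X.map (hFace 1 b))
  η_vFace : ∀ {b : ℕ} (f : P ⟶ X.obj (biObj 0 (b + 1))) (j : Fin (b + 2)),
    η f ≫ X.map (vFace 0 j) = η (f ≫ X.map (vFace 0 j))

namespace BiContraction

variable {P : D} (s : BiContraction X P)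

/-- Splitting off `d_0` and lowering the remaining indices by one reverses their signs; this is what
turns an extra degeneracy into a contracting homotopy. -/
lemma alternating_sum_succ {A : Type*} [AddCommGroup A] {n : ℕ} (F : Fin (n + 3) → A)
    (F' : Fin (n + 2) → A) (h : ∀ i, F i.succ = F' i) :
    ∑ i : Fin (n + 3), (-1 : ℤ) ^ (i : ℕ) • F i =
      F 0 - ∑ i : Fin (n + 2), (-1 : ℤ) ^ (i : ℕ) • F' i := by
  rw [Fin.sum_univ_succ, sub_eq_add_neg, ← Finset.sum_neg_distrib]
  congr 1
  · simp
  · refine Finset.sum_congr rfl fun i _ => ?_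
    rw [h, Fin.val_succ, pow_succ, mul_neg, mul_one, neg_smul]

lemma comp_alternating_sum {ι : Type*} [Fintype ι] {Y Z : D} (f : P ⟶ Y) (z : ι → ℤ)
    (φ : ι → (Y ⟶ Z)) : f ≫ ∑ i, z i • φ i = ∑ i, z i • (f ≫ φ i) := by
  rw [Preadditive.comp_sum]
  exact Finset.sum_congr rfl fun i _ => Preadditive.comp_zsmul _ _ _

lemma map_alternating_sum {ι : Type*} [Fintype ι] {A B : Type*} [AddCommGroup A] [AddCommGroup B]
    (F : A →+ B) (z : ι → ℤ) (φ : ι → A) : F (∑ i, z i • φ i) = ∑ i, z i • F (φ i) := by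
  rw [map_sum]
  exact Finset.sum_congr rfl fun i _ => map_zsmul _ _ _

/-- The extra degeneracy computation: `d_0` undoes `sh` and `d_{i+1}` passes through it as `d_i`, so
the alternating sum leaves the identity minus `sh` of the boundary. -/
lemma sh_hDiff_succ {a b : ℕ} (f : P ⟶ X.obj (biObj (a + 1) b)) :
    s.sh f ≫ hDiff X (a + 1) b = f - s.sh (f ≫ hDiff X a b) := by
  rw [hDiff, hDiff, comp_alternating_sum, comp_alternating_sum, map_alternating_sum,
    alternating_sum_succ _ _ (s.sh_succ f), s.sh_zero]

lemma sh_hDiff_zero {b : ℕ} (f : P ⟶ X.obj (biObj 0 b)) :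
    s.sh f ≫ hDiff X 0 b = f - s.η f := by
  rw [hDiff, comp_alternating_sum, Fin.sum_univ_two, s.sh_zero, s.sh_one]
  simp [sub_eq_add_neg]

lemma sh_vDiff {a b : ℕ} (f : P ⟶ X.obj (biObj a (b + 1))) :
    s.sh f ≫ vDiff X (a + 1) b = s.sh (f ≫ vDiff X a b) := by
  rw [vDiff, vDiff, comp_alternating_sum, comp_alternating_sum, map_alternating_sum]
  exact Finset.sum_congr rfl fun j _ => by rw [s.sh_vFace]

lemma sv_vDiff {a b : ℕ} (f : P ⟶ X.obj (biObj a (b + 1))) :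
    s.sv f ≫ vDiff X a (b + 1) = f - s.sv (f ≫ vDiff X a b) := by
  rw [vDiff, vDiff, comp_alternating_sum, comp_alternating_sum, map_alternating_sum,
    alternating_sum_succ _ _ (s.sv_succ f), s.sv_zero]

/-- The two ends of a horizontal edge have the same projection to the base vertex, and they occur in
the boundary with opposite signs. -/
lemma η_hDiff {b : ℕ} (f : P ⟶ X.obj (biObj 1 b)) : s.η (f ≫ hDiff X 0 b) = 0 := by
  rw [hDiff, comp_alternating_sum, map_alternating_sum, Fin.sum_univ_two, s.η_hFace]
  simp

lemma η_vDiff {b : ℕ} (f : P ⟶ X.obj (biObj 0 (b + 1))) :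
    s.η f ≫ vDiff X 0 b = s.η (f ≫ vDiff X 0 b) := by
  rw [vDiff, comp_alternating_sum, comp_alternating_sum, map_alternating_sum]
  exact Finset.sum_congr rfl fun j _ => by rw [s.η_vFace]

lemma dFace_eq {n : ℕ} (i : Fin (n + 2)) : dFace i = hFace i (n + 1) ≫ vFace n i :=
  Prod.ext (Category.comp_id _).symm (Category.id_comp _).symm

/-- The composite of the vertical and the horizontal contraction is an extra degeneracy for the
diagonal: a diagonal face is a horizontal face followed by a vertical one, and each of them meets
its own contraction. A cycle is therefore the boundary of its image. -/
lemma diag_boundary {n : ℕ} (f : P ⟶ X.obj (biObj (n + 1) (n + 1)))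
    (hf : f ≫ ∑ i : Fin (n + 2), (-1 : ℤ) ^ (i : ℕ) • X.map (dFace i) = 0) :
    s.sh (s.sv f) ≫ ∑ i : Fin (n + 3), (-1 : ℤ) ^ (i : ℕ) • X.map (dFace i) = f := by
  have h₀ : s.sh (s.sv f) ≫ X.map (dFace 0) = f := by
    rw [dFace_eq, X.map_comp, ← Category.assoc, s.sh_zero, s.sv_zero]
  have h₁ : ∀ i : Fin (n + 2), s.sh (s.sv f) ≫ X.map (dFace i.succ) =
      s.sh (s.sv (f ≫ X.map (dFace i))) := fun i => by
    rw [dFace_eq, dFace_eq, X.map_comp, X.map_comp, ← Category.assoc, ← Category.assoc, s.sh_succ,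
      s.sh_vFace, s.sv_hFace, s.sv_succ]
  have h₂ := congrArg (fun φ => s.sh (s.sv φ)) ((comp_alternating_sum f _ _).symm.trans hf)
  simp only [map_alternating_sum, map_zero] at h₂
  rw [comp_alternating_sum, alternating_sum_succ _ _ h₁, h₀, h₂, sub_zero]

include s in
lemma relAcyclic_diagCx : RelAcyclic P (diagCx X) := by
  intro n f hf
  rw [diagCx_d] at hf
  refine ⟨s.sh (s.sv (show P ⟶ X.obj (biObj (n + 1) (n + 1)) from f)), ?_⟩
  rw [diagCx_d]
  exact s.diag_boundary f hf

variable (T : TotalCx X)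

/-- The contracting homotopy of the maps into a total complex. -/
def totalHomotopy (n : ℕ) : (P ⟶ T.cx.X n) →+ (P ⟶ T.cx.X (n + 1)) :=
  AddMonoidHom.mk' (fun f => (∑ i : Fin (n + 1), s.sh (f ≫ T.π i (n - i) n (by omega)) ≫
      T.ι (i + 1) (n - i) (n + 1) (by omega)) +
      s.sv (s.η (f ≫ T.π 0 n n (by omega))) ≫ T.ι 0 (n + 1) (n + 1) (by omega)) fun f f' => by
    simp only [Preadditive.add_comp, map_add, Finset.sum_add_distrib]
    abel

lemma totalHomotopy_sum {a b n : ℕ} (h : a + b = n) (g : P ⟶ X.obj (biObj a b)) :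
    ∑ i : Fin (n + 1), s.sh ((g ≫ T.ι a b n h) ≫ T.π i (n - i) n (by omega)) ≫
      T.ι (i + 1) (n - i) (n + 1) (by omega) = s.sh g ≫ T.ι (a + 1) b (n + 1) (by omega) := by
  refine (TotalCx.sum_fin_eq (fun a' b' h' => s.sh ((g ≫ T.ι a b n h) ≫ T.π a' b' n h') ≫
    T.ι (a' + 1) b' (n + 1) (by omega)) a b h fun a' b' h' ne => ?_).trans ?_
  · rw [Category.assoc, T.ι_π_of_ne h h' ne.symm, comp_zero, map_zero, zero_comp]
  · rw [Category.assoc, T.ι_π_self, Category.comp_id]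

/-- On the column `a = 0` the horizontal contraction alone produces `g - η g`. The second term is
present to contract `η g` vertically. -/
lemma totalHomotopy_zero {b n : ℕ} (h : 0 + b = n) (g : P ⟶ X.obj (biObj 0 b)) :
    s.totalHomotopy T n (g ≫ T.ι 0 b n h) = s.sh g ≫ T.ι 1 b (n + 1) (by omega) +
      s.sv (s.η g) ≫ T.ι 0 (b + 1) (n + 1) (by omega) := by
  obtain rfl : b = n := by omega
  refine congrArg₂ (· + ·) (s.totalHomotopy_sum T h g) ?_
  rw [Category.assoc, T.ι_π_self, Category.comp_id]

lemma totalHomotopy_succ {a b n : ℕ} (h : (a + 1) + b = n) (g : P ⟶ X.obj (biObj (a + 1) b)) :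
    s.totalHomotopy T n (g ≫ T.ι (a + 1) b n h) =
      s.sh g ≫ T.ι (a + 1 + 1) b (n + 1) (by omega) := by
  refine (congrArg₂ (· + ·) (s.totalHomotopy_sum T h g) ?_).trans (add_zero _)
  rw [Category.assoc, T.ι_π_of_ne _ _ (Nat.succ_ne_zero a), comp_zero, map_zero, map_zero,
    zero_comp]

/-- No correction term survives even when the boundary lands in the column `a = 0`, because `η`
kills horizontal boundaries. This makes the formula uniform in `a`. -/
lemma totalHomotopy_hDiff {a b n : ℕ} (h : a + b = n) (g : P ⟶ X.obj (biObj (a + 1) b)) :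
    s.totalHomotopy T n (g ≫ hDiff X a b ≫ T.ι a b n h) =
      s.sh (g ≫ hDiff X a b) ≫ T.ι (a + 1) b (n + 1) (by omega) := by
  rw [← Category.assoc]
  rcases a with _ | a
  · rw [totalHomotopy_zero, s.η_hDiff, map_zero, zero_comp, add_zero]
  · rw [totalHomotopy_succ]

/-- In positive total degree `totalHomotopy` is an honest contraction. By additivity this is checked
on the summands, where the edges and the interior are treated apart. -/
lemma totalHomotopy_comm (n : ℕ) (f : P ⟶ T.cx.X (n + 1)) :
    s.totalHomotopy T (n + 1) f ≫ T.cx.d (n + 2) (n + 1) +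
      s.totalHomotopy T n (f ≫ T.cx.d (n + 1) n) = f := by
  refine T.hom_to_ext (F := AddMonoidHom.mk' (fun f => s.totalHomotopy T (n + 1) f ≫
    T.cx.d (n + 2) (n + 1) + s.totalHomotopy T n (f ≫ T.cx.d (n + 1) n)) fun f f' => by
      simp only [Preadditive.add_comp, map_add]; abel) (F' := AddMonoidHom.id _)
    (fun a b h g => ?_) f
  rw [AddMonoidHom.mk'_apply, AddMonoidHom.id_apply]
  rcases a with _ | a
  -- On the column `a = 0` the summand `b = 0` is excluded by positivity of the degree. Otherwise
  -- `sh g` contributes `g - η g` and `-sh (∂ᵛ g)`, while `sv (η g)` contributes `η g - sv (η (∂ᵛ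
  -- g))`. The two unwanted terms are cancelled by the homotopy applied to `∂ᵛ g`.
  · rcases b with _ | b
    · omega
    rw [totalHomotopy_zero, Preadditive.add_comp, Category.assoc, Category.assoc, Category.assoc,
      T.ι_d_zero_succ b n h (by omega), T.ι_d_zero_succ (b + 1) (n + 1) _ (by omega),
      T.ι_d_succ_succ 0 b (n + 1) _ (by omega) (by omega), Preadditive.comp_add,
      Preadditive.comp_zsmul, ← Category.assoc, ← Category.assoc, ← Category.assoc,
      ← Category.assoc, totalHomotopy_zero, s.sh_hDiff_zero, s.sh_vDiff, s.sv_vDiff, s.η_vDiff]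
    simp only [Preadditive.sub_comp, zero_add, pow_one, neg_smul, one_smul]
    abel
  rcases b with _ | b
  · rw [totalHomotopy_succ, Category.assoc, Category.assoc,
      T.ι_d_succ_zero a n h (by omega), T.ι_d_succ_zero (a + 1) (n + 1) _ (by omega),
      totalHomotopy_hDiff, ← Category.assoc, s.sh_hDiff_succ]
    simp only [Preadditive.sub_comp]
    abel
  -- In the interior the mixed terms `sh (∂ᵛ g)` occur with the signs `(-1) ^ (a + 2)` and `(-1) ^
  -- (a + 1)`, since `sh` raises the horizontal degree by one, and so they cancel.
  · rw [totalHomotopy_succ, Category.assoc, Category.assoc,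
      T.ι_d_succ_succ a b n h (by omega) (by omega),
      T.ι_d_succ_succ (a + 1) b (n + 1) _ (by omega) (by omega), Preadditive.comp_add,
      Preadditive.comp_add, map_add, totalHomotopy_hDiff, Preadditive.comp_zsmul,
      Preadditive.comp_zsmul, map_zsmul, ← Category.assoc, ← Category.assoc, s.sh_hDiff_succ,
      s.sh_vDiff, ← Category.assoc g (vDiff X (a + 1) b), totalHomotopy_succ,
      pow_succ _ (a + 1)]
    simp only [Preadditive.sub_comp, mul_neg, mul_one, neg_smul]
    abel

include s in
lemma relAcyclic_total : RelAcyclic P T.cx := by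
  intro n f hf
  refine ⟨s.totalHomotopy T (n + 1) f, ?_⟩
  have := s.totalHomotopy_comm T n f
  rwa [hf, map_zero, add_zero] at this

end BiContraction

end Contraction

/-! ### The universal bisimplicial object and its contractions. -/

section Universal
open Opposite Simplicial AlgebraicTopology

/-- The universal object of shape `I` in an additive category. -/
noncomputable def universalObj (I : Type*) [Category* I] : I ⥤ Mat_ (Free ℤ I) :=
  Free.embedding ℤ I ⋙ Mat_.embedding (Free ℤ I)

section

variable {I : Type*} [Category* I]

/-- The components of a formal direct sum, as objects of `I`. -/
def component (P : Mat_ (Free ℤ I)) (i : P.ι) : I := P.X i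

/-- The matrix entry of a map into the universal object. -/
def entry {P : Mat_ (Free ℤ I)} {x : I} (f : P ⟶ (universalObj I).obj x) (i : P.ι) :
    Free.of ℤ (component P i) ⟶ Free.of ℤ x := f i PUnit.unit

lemma entry_ext {P : Mat_ (Free ℤ I)} {x : I} {f f' : P ⟶ (universalObj I).obj x}
    (h : ∀ i, entry f i = entry f' i) : f = f' :=
  Mat_.hom_ext _ _ fun i _ => h i

lemma entry_comp {P : Mat_ (Free ℤ I)} {x y : I} (f : P ⟶ (universalObj I).obj x) (φ : x ⟶ y)
    (i : P.ι) : entry (f ≫ (universalObj I).map φ) i =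
      entry f i ≫ linSingle φ 1 := by
  refine (Mat_.comp_apply f ((universalObj I).map φ) i PUnit.unit).trans ?_
  exact Fintype.sum_unique (ι := PUnit) _

/-- The operation on maps into the universal object induced by an operation on morphisms. -/
noncomputable def universalOp (P : Mat_ (Free ℤ I)) {x y : I} (F : ∀ z : I, (z ⟶ x) → (z ⟶ y)) :
    (P ⟶ (universalObj I).obj x) →+ (P ⟶ (universalObj I).obj y) :=
  AddMonoidHom.mk' (fun f i _ => linHom (fun φ => linSingle (F (component P i) φ) 1) (entry f i))
    fun f f' => Mat_.hom_ext _ _ fun i _ => map_add (linHom _) (entry f i) (entry f' i)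

lemma entry_universalOp (P : Mat_ (Free ℤ I)) {x y : I} (F : ∀ z : I, (z ⟶ x) → (z ⟶ y))
    (f : P ⟶ (universalObj I).obj x) (i : P.ι) : entry (universalOp P F f) i =
      linHom (fun φ => linSingle (F (component P i) φ) 1) (entry f i) := rfl

lemma zsmul_linSingle {x y : I} (φ : x ⟶ y) (r : ℤ) : r • linSingle φ 1 = linSingle φ r := by
  refine (Finsupp.smul_single r φ (1 : ℤ)).trans ?_
  rw [smul_eq_mul, mul_one]; rfl

lemma universalOp_comp_map (P : Mat_ (Free ℤ I)) {x y z : I} (F : ∀ z : I, (z ⟶ x) → (z ⟶ y))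
    (φ : y ⟶ z) (f : P ⟶ (universalObj I).obj x) :
    universalOp P F f ≫ (universalObj I).map φ = universalOp P (fun w ψ => F w ψ ≫ φ) f := by
  refine entry_ext fun i => ?_
  rw [entry_comp, entry_universalOp, entry_universalOp]
  induction entry f i using lin_induction with
  | zero => rw [map_zero, map_zero, zero_comp]
  | add a b ha hb => rw [map_add, map_add, Preadditive.add_comp, ha, hb]
  | single ψ r =>
    refine (congrArg (· ≫ linSingle φ 1) (linHom_single _ ψ r)).trans ?_
    refine Eq.trans ?_ (linHom_single _ ψ r).symm
    refine (Preadditive.zsmul_comp _ _ _).trans ?_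
    rw [linSingle_comp, mul_one]

lemma universalOp_map (P : Mat_ (Free ℤ I)) {x y z : I} (φ : z ⟶ x)
    (F : ∀ z : I, (z ⟶ x) → (z ⟶ y)) (f : P ⟶ (universalObj I).obj z) :
    universalOp P F (f ≫ (universalObj I).map φ) = universalOp P (fun w ψ => F w (ψ ≫ φ)) f := by
  refine entry_ext fun i => ?_
  rw [entry_universalOp, entry_universalOp, entry_comp]
  induction entry f i using lin_induction with
  | zero => rw [map_zero, zero_comp, map_zero]
  | add a b ha hb => rw [map_add, Preadditive.add_comp, map_add, ha, hb]
  | single ψ r =>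
    refine (congrArg (linHom _) (linSingle_comp ψ φ r 1)).trans ?_
    refine (linHom_single _ _ _).trans ?_
    refine Eq.trans ?_ (linHom_single _ ψ r).symm
    rw [mul_one]

lemma universalOp_id (P : Mat_ (Free ℤ I)) {x : I} (f : P ⟶ (universalObj I).obj x) :
    universalOp P (fun _ ψ => ψ) f = f := by
  refine entry_ext fun i => ?_
  rw [entry_universalOp]
  induction entry f i using lin_induction with
  | zero => rw [map_zero]
  | add a b ha hb => rw [map_add, ha, hb]
  | single ψ r => exact (linHom_single _ ψ r).trans (zsmul_linSingle ψ r)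

/-- Identities between operations on morphisms of `I` become identities between operations on maps
into the universal object. The operations are not required to be natural in the source `z`, and
prepending a vertex is not, as a map of simplices may move the vertex `0`. -/
lemma universalOp_comm (P : Mat_ (Free ℤ I)) {x y x' y' : I} (F : ∀ z : I, (z ⟶ x) → (z ⟶ y))
    (F' : ∀ z : I, (z ⟶ x') → (z ⟶ y')) (φ : y ⟶ y') (φ' : x ⟶ x')
    (h : ∀ w (ψ : w ⟶ x), F w ψ ≫ φ = F' w (ψ ≫ φ')) (f : P ⟶ (universalObj I).obj x) :
    universalOp P F f ≫ (universalObj I).map φ = universalOp P F' (f ≫ (universalObj I).map φ') := by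
  rw [universalOp_comp_map, universalOp_map]
  simp only [h]

end

/-- Prepend `0` to a simplex of a standard simplex. -/
def consZero {a : ℕ} {p : SimplexCategory} (φ : ⦋a⦌ ⟶ p) : ⦋a + 1⦌ ⟶ p :=
  SimplexCategory.Hom.mk ⟨Fin.cons 0 φ.toOrderHom, fun i j h => by
    induction i using Fin.cases with
    | zero => exact Fin.zero_le _
    | succ i =>
      induction j using Fin.cases with
      | zero => exact absurd h (by simp)
      | succ j => exact φ.toOrderHom.monotone (Fin.succ_le_succ_iff.mp h)⟩

/-- With the next two identities, this says that prepending `0` is an extra degeneracy on the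
simplices of a standard simplex, contracting it to its vertex `0`. -/
lemma δ_zero_consZero {a : ℕ} {p : SimplexCategory} (φ : ⦋a⦌ ⟶ p) :
    SimplexCategory.δ 0 ≫ consZero φ = φ := by
  refine SimplexCategory.Hom.ext _ _ (OrderHom.ext _ _ (funext fun i => ?_))
  rfl

lemma δ_succ_consZero {a : ℕ} {p : SimplexCategory} (φ : ⦋a + 1⦌ ⟶ p) (i : Fin (a + 2)) :
    SimplexCategory.δ i.succ ≫ consZero φ = consZero (SimplexCategory.δ i ≫ φ) := by
  refine SimplexCategory.Hom.ext _ _ (OrderHom.ext _ _ (funext fun j => ?_))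
  induction j using Fin.cases with
  | zero =>
    refine (congrArg (consZero φ).toOrderHom (Fin.succ_succAbove_zero i)).trans ?_
    rfl
  | succ j =>
    refine (congrArg (consZero φ).toOrderHom (Fin.succ_succAbove_succ i j)).trans ?_
    rfl

/-- The constant vertex `0`. -/
def zeroVertex (p : SimplexCategory) : ⦋0⦌ ⟶ p := SimplexCategory.const _ p 0

lemma δ_one_consZero {p : SimplexCategory} (φ : ⦋0⦌ ⟶ p) :
    SimplexCategory.δ 1 ≫ consZero φ = zeroVertex p := by
  refine SimplexCategory.Hom.ext _ _ (OrderHom.ext _ _ (funext fun j => ?_))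
  obtain rfl : j = 0 := Subsingleton.elim (α := Fin 1) _ _
  rfl

/-- Prepend `0` horizontally. -/
def hCons (a b : ℕ) (z : BiSimplex) (ψ : z ⟶ biObj a b) : z ⟶ biObj (a + 1) b :=
  ((consZero ψ.1.unop).op, ψ.2)

/-- Prepend `0` vertically. -/
def vCons (a b : ℕ) (z : BiSimplex) (ψ : z ⟶ biObj a b) : z ⟶ biObj a (b + 1) :=
  (ψ.1, (consZero ψ.2.unop).op)

/-- Replace the horizontal component by `0`. -/
def hConst (b : ℕ) (z : BiSimplex) (ψ : z ⟶ biObj 0 b) : z ⟶ biObj 0 b :=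
  ((zeroVertex z.1.unop).op, ψ.2)

/-- The contractions of the universal bisimplicial object. -/
noncomputable def universalContraction (P : Mat_ (Free ℤ BiSimplex)) :
    BiContraction (universalObj BiSimplex) P where
  sh {a b} := universalOp P (hCons a b)
  sv {a b} := universalOp P (vCons a b)
  η {b} := universalOp P (hConst b)
  sh_zero {a b} f := (universalOp_comp_map P (hCons a b) (hFace 0 b) f).trans <|
    Eq.trans (congrArg (universalOp P · f) (funext fun _ => funext fun ψ => Prod.ext
      (congrArg Quiver.Hom.op (δ_zero_consZero ψ.1.unop)) (Category.comp_id ψ.2)))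
      (universalOp_id P f)
  sh_succ {a b} f i := universalOp_comm P (hCons (a + 1) b) (hCons a b) (hFace i.succ b)
    (hFace i b) (fun _ ψ => Prod.ext (congrArg Quiver.Hom.op (δ_succ_consZero ψ.1.unop i)) rfl) f
  sh_one {b} f := (universalOp_comp_map P (hCons 0 b) (hFace 1 b) f).trans <|
    congrArg (universalOp P · f) (funext fun _ => funext fun ψ => Prod.ext
      (congrArg Quiver.Hom.op (δ_one_consZero ψ.1.unop)) (Category.comp_id ψ.2))
  sh_vFace {a b} f j := universalOp_comm P (hCons a (b + 1)) (hCons a b) (vFace (a + 1) j)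
    (vFace a j) (fun _ ψ => Prod.ext ((Category.comp_id _).trans
      (congrArg (fun φ => (consZero (Quiver.Hom.unop φ)).op) (Category.comp_id ψ.1).symm)) rfl) f
  sv_zero {a b} f := (universalOp_comp_map P (vCons a b) (vFace a 0) f).trans <|
    Eq.trans (congrArg (universalOp P · f) (funext fun _ => funext fun ψ => Prod.ext
      (Category.comp_id ψ.1) (congrArg Quiver.Hom.op (δ_zero_consZero ψ.2.unop))))
      (universalOp_id P f)
  sv_succ {a b} f j := universalOp_comm P (vCons a (b + 1)) (vCons a b) (vFace a j.succ)
    (vFace a j) (fun _ ψ => Prod.ext rfl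
      (congrArg Quiver.Hom.op (δ_succ_consZero ψ.2.unop j))) f
  sv_hFace {a b} f i := universalOp_comm P (vCons (a + 1) b) (vCons a b) (hFace i (b + 1))
    (hFace i b) (fun _ ψ => Prod.ext rfl ((Category.comp_id _).trans
      (congrArg (fun φ => (consZero (Quiver.Hom.unop φ)).op) (Category.comp_id ψ.2).symm))) f
  -- `hConst` discards the horizontal component, which is the only one in which the two faces
  -- differ, so both sides are the same operation.
  η_hFace {b} f := (universalOp_map P (hFace 0 b) (hConst b) f).trans
    (universalOp_map P (hFace 1 b) (hConst b) f).symm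
  η_vFace {b} f j := universalOp_comm P (hConst (b + 1)) (hConst b) (vFace 0 j) (vFace 0 j)
    (fun _ _ => Prod.ext (Category.comp_id _) rfl) f

end Universal

/-! ### Explicit comparison maps in degrees zero and one; the universal Eilenberg–Zilber theorem. -/

section LowDegree
open Opposite Simplicial AlgebraicTopology

variable {D : Type*} [Category* D] [Preadditive D] {X : BiSimplex ⥤ D} (T : TotalCx X)

/-- Horizontal degeneracy. -/
abbrev hDegen (b : ℕ) : biObj 0 b ⟶ biObj 1 b := ((SimplexCategory.σ 0).op, 𝟙 _)

/-- Vertical degeneracy. -/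
abbrev vDegen (a : ℕ) : biObj a 0 ⟶ biObj a 1 := (𝟙 _, (SimplexCategory.σ 0).op)

lemma hDiff_zero (b : ℕ) : hDiff X 0 b = X.map (hFace 0 b) - X.map (hFace 1 b) := by
  rw [hDiff, Fin.sum_univ_two]
  simp [sub_eq_add_neg]

lemma vDiff_zero (a : ℕ) : vDiff X a 0 = X.map (vFace a 0) - X.map (vFace a 1) := by
  rw [vDiff, Fin.sum_univ_two]
  simp [sub_eq_add_neg]

lemma diag_zero : ∑ i : Fin 2, (-1 : ℤ) ^ (i : ℕ) • X.map (dFace (n := 0) i) =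
    X.map (dFace 0) - X.map (dFace 1) := by
  rw [Fin.sum_univ_two]
  simp [sub_eq_add_neg]

lemma σ_op_δ_op (i : Fin 2) : (SimplexCategory.σ (0 : Fin 1)).op ≫
    (SimplexCategory.δ i : ⦋0⦌ ⟶ ⦋1⦌).op = 𝟙 (op ⦋0⦌) := by
  rw [← op_comp, ← op_id]
  refine congrArg Quiver.Hom.op ?_
  fin_cases i
  · exact SimplexCategory.δ_comp_σ_self (i := 0)
  · exact SimplexCategory.δ_comp_σ_succ (i := 0)

/-- A face cancels the degeneracy in the vertical direction, so on a vertically degenerate simplex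
the diagonal face is just the horizontal one. Together with the symmetric statement this makes the
shuffle map compatible with the differentials. -/
lemma vDegen_dFace (i : Fin 2) : vDegen 1 ≫ dFace (n := 0) i = hFace i 0 :=
  Prod.ext (Category.id_comp _) (σ_op_δ_op i)

lemma hDegen_dFace (i : Fin 2) : hDegen 1 ≫ dFace (n := 0) i = vFace 0 i :=
  Prod.ext (σ_op_δ_op i) (Category.id_comp _)

namespace TotalCx

/-- The Eilenberg–Zilber shuffle map in degree one. -/
def shuffleOne : T.cx.X 1 ⟶ X.obj (biObj 1 1) :=
  T.π 1 0 1 rfl ≫ X.map (vDegen 1) + T.π 0 1 1 rfl ≫ X.map (hDegen 1)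

/-- The Alexander–Whitney map in degree one. -/
def alexanderWhitneyOne : X.obj (biObj 1 1) ⟶ T.cx.X 1 :=
  X.map (vFace 1 0) ≫ T.ι 1 0 1 rfl + X.map (hFace 1 1) ≫ T.ι 0 1 1 rfl

lemma shuffleOne_comm : T.shuffleOne ≫ ∑ i : Fin 2, (-1 : ℤ) ^ (i : ℕ) • X.map (dFace (n := 0) i) =
    T.cx.d 1 0 ≫ T.π 0 0 0 rfl := by
  rw [diag_zero]
  refine T.hom_ext fun a b h => ?_
  rcases a with _ | a
  · obtain rfl : b = 1 := by omega
    have h₁ : T.ι 0 1 1 h ≫ T.shuffleOne = X.map (hDegen 1) := by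
      rw [shuffleOne, Preadditive.comp_add, ← Category.assoc, ← Category.assoc,
        T.ι_π_of_ne h rfl (by omega), T.ι_π_self, zero_comp, zero_add, Category.id_comp]
    rw [← Category.assoc, h₁, ← Category.assoc, T.ι_d_zero_succ 0 0 h rfl, Category.assoc,
      T.ι_π_self, Category.comp_id, Preadditive.comp_sub, ← X.map_comp, ← X.map_comp,
      hDegen_dFace, hDegen_dFace, vDiff_zero]
  · obtain rfl : a = 0 := by omega
    obtain rfl : b = 0 := by omega
    have h₁ : T.ι 1 0 1 h ≫ T.shuffleOne = X.map (vDegen 1) := by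
      rw [shuffleOne, Preadditive.comp_add, ← Category.assoc, ← Category.assoc,
        T.ι_π_of_ne (a' := 0) (b' := 1) h rfl (by omega), T.ι_π_self, zero_comp, add_zero,
        Category.id_comp]
    refine (Category.assoc _ _ _).symm.trans ?_
    refine (congrArg (· ≫ (X.map (dFace 0) - X.map (dFace 1))) h₁).trans ?_
    refine Eq.trans ?_ (Category.assoc _ _ _)
    refine Eq.trans ?_ (congrArg (· ≫ T.π 0 0 0 rfl) (T.ι_d_succ_zero 0 0 h rfl)).symm
    rw [Category.assoc, T.ι_π_self, Category.comp_id, Preadditive.comp_sub, ← X.map_comp,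
      ← X.map_comp, vDegen_dFace, vDegen_dFace, hDiff_zero]

/-- The choice of the faces `d_0` vertically and `d_1` horizontally makes the sum telescope: `(d_0ʰ
- d_1ʰ) d_0ᵛ + d_1ʰ (d_0ᵛ - d_1ᵛ) = d_0ʰ d_0ᵛ - d_1ʰ d_1ᵛ`, since horizontal and vertical faces
commute. -/
lemma alexanderWhitneyOne_comm : T.alexanderWhitneyOne ≫ T.cx.d 1 0 =
    (∑ i : Fin 2, (-1 : ℤ) ^ (i : ℕ) • X.map (dFace (n := 0) i)) ≫ T.ι 0 0 0 rfl := by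
  have e (i j : Fin 2) : X.map (hFace i 1) ≫ X.map (vFace 0 j) =
      X.map (((SimplexCategory.δ i).op, (SimplexCategory.δ j).op) : biObj 1 1 ⟶ biObj 0 0) := by
    rw [← X.map_comp]
    exact congrArg X.map (Prod.ext (Category.comp_id _) (Category.id_comp _))
  have e' (i j : Fin 2) : X.map (vFace 1 j) ≫ X.map (hFace i 0) =
      X.map (((SimplexCategory.δ i).op, (SimplexCategory.δ j).op) : biObj 1 1 ⟶ biObj 0 0) := by
    rw [← X.map_comp]
    exact congrArg X.map (Prod.ext (Category.id_comp _) (Category.comp_id _))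
  rw [diag_zero, alexanderWhitneyOne, Preadditive.add_comp, Category.assoc, Category.assoc,
    T.ι_d_zero_succ 0 0 rfl rfl, T.ι_d_succ_zero 0 0 rfl rfl, hDiff_zero, vDiff_zero,
    ← Category.assoc, ← Category.assoc, ← Preadditive.add_comp, Preadditive.comp_sub,
    Preadditive.comp_sub, e, e, e', e']
  congr 1
  abel

lemma π_ι_zero : T.π 0 0 0 rfl ≫ T.ι 0 0 0 rfl = 𝟙 _ := by
  refine T.hom_ext fun a b h => ?_
  obtain rfl : a = 0 := by omega
  obtain rfl : b = 0 := by omega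
  rw [← Category.assoc, T.ι_π_self, Category.id_comp, Category.comp_id]

end TotalCx

/-- The Eilenberg–Zilber theorem for the universal bisimplicial object. -/
lemma nonempty_universal_eilenbergZilber :
    Nonempty (HomotopyEquiv (TotalCx.total (universalObj BiSimplex)).cx
      (diagCx (universalObj BiSimplex))) := by
  set T := TotalCx.total (universalObj BiSimplex)
  -- The contractions exist for maps from every object of the universal category, in particular from
  -- the terms of both complexes, so all four acyclicity conditions hold. In degree `0` both
  -- complexes are the object of bidegree `(0, 0)`.
  refine exists_homotopyEquiv_of_relAcyclic
    (fun _ => (universalContraction _).relAcyclic_total T)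
    (fun _ => (universalContraction _).relAcyclic_diagCx)
    (fun _ => (universalContraction _).relAcyclic_total T)
    (fun _ => (universalContraction _).relAcyclic_diagCx)
    (T.π 0 0 0 rfl) T.shuffleOne ?_ (T.ι 0 0 0 rfl) T.alexanderWhitneyOne ?_ ?_ ?_
  · rw [diagCx_d]
    exact T.shuffleOne_comm
  · rw [diagCx_d]
    exact T.alexanderWhitneyOne_comm
  · exact T.π_ι_zero
  · exact T.ι_π_self 0 0 0 rfl

end LowDegree

/-! ### Every diagram is the image of the universal one under an additive functor. -/

section Realize

variable {I : Type*} [Category* I] {D : Type*} [Category* D] [Preadditive D]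

lemma lift_id_map {A B : D} (f : A ⟶ B) :
    f ≫ biproduct.lift (f := fun _ : PUnit.{1} => B) (fun _ => 𝟙 B) =
      biproduct.lift (f := fun _ : PUnit.{1} => A) (fun _ => 𝟙 A) ≫
        biproduct.map (fun _ => f) := by
  refine biproduct.hom_ext _ _ fun k => ?_
  simp

lemma linMap_naturality {X Y : I ⥤ D} (τ : X ⟶ Y) {i j : I} (f : Free.of ℤ i ⟶ Free.of ℤ j) :
    linMap X i j f ≫ τ.app j = τ.app i ≫ linMap Y i j f := by
  induction f using lin_induction with
  | zero => rw [map_zero, map_zero, zero_comp, comp_zero]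
  | add f₁ f₂ h₁ h₂ =>
    rw [map_add, map_add, Preadditive.add_comp, Preadditive.comp_add, h₁, h₂]
  | single φ r =>
    refine (congrArg (· ≫ τ.app j) (linHom_single X.map φ r)).trans ?_
    refine Eq.trans ?_ (congrArg (τ.app i ≫ ·) (linHom_single Y.map φ r)).symm
    rw [Preadditive.zsmul_comp, Preadditive.comp_zsmul, τ.naturality]

/-- Functoriality of `linLift`. -/
noncomputable def linLiftMap {X Y : I ⥤ D} (τ : X ⟶ Y) : linLift X ⟶ linLift Y where
  app i := τ.app i
  naturality _ _ f := linMap_naturality τ f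

variable [HasFiniteBiproducts D]

/-- Functoriality of `matLift`. -/
noncomputable def matLiftMap {S : Type*} [Category* S] [Preadditive S] {F F' : S ⥤ D} [F.Additive]
    [F'.Additive] (τ : F ⟶ F') : matLift F ⟶ matLift F' where
  app M := biproduct.map fun i => τ.app (M.X i)
  naturality M N f := by
    refine biproduct.hom_ext _ _ fun i => biproduct.hom_ext' _ _ fun j => ?_
    simp [matLift]

/-- The additive functor extending a functor to the universal additive category. -/
noncomputable def realize (X : I ⥤ D) : Mat_ (Free ℤ I) ⥤ D := matLift (linLift X)

instance (X : I ⥤ D) : (realize X).Additive := inferInstanceAs (matLift (linLift X)).Additive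

/-- Functoriality of the realization. -/
noncomputable def realizeMap {X Y : I ⥤ D} (τ : X ⟶ Y) : realize X ⟶ realize Y :=
  matLiftMap (linLiftMap τ)

lemma lift_id_matrix {A B : D} (f : A ⟶ B) :
    f ≫ biproduct.lift (f := fun _ : PUnit.{1} => B) (fun _ => 𝟙 B) =
      biproduct.lift (f := fun _ : PUnit.{1} => A) (fun _ => 𝟙 A) ≫
        biproduct.matrix (fun _ _ => f) := by
  refine biproduct.hom_ext _ _ fun k => ?_
  simp [biproduct.lift_desc]

/-- The comparison of a functor with the realization of the universal object. -/
noncomputable def toRealize (X : I ⥤ D) : X ⟶ universalObj I ⋙ realize X where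
  app i := biproduct.lift (f := fun _ : PUnit.{1} => X.obj i) fun _ => 𝟙 (X.obj i)
  naturality i j φ := by
    refine (lift_id_matrix (X.map φ)).trans ?_
    refine congrArg (biproduct.lift (f := fun _ : PUnit.{1} => X.obj i) (fun _ => 𝟙 _) ≫ ·) ?_
    refine congrArg (biproduct.matrix (f := fun _ : PUnit.{1} => X.obj i)
      (g := fun _ : PUnit.{1} => X.obj j)) (funext fun _ => funext fun _ => ?_)
    exact ((linHom_single X.map φ 1).trans (one_smul _ _)).symm

/-- The universal object consists of formal sums with a single summand, so its realization at `i` is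
a biproduct over a one-point type, whose only projection is the inverse. -/
instance (X : I ⥤ D) : IsIso (toRealize X) := by
  refine (NatTrans.isIso_iff_isIso_app _).2 fun i => ?_
  refine ⟨biproduct.π (fun _ : PUnit.{1} => X.obj i) PUnit.unit, ?_, ?_⟩
  · exact biproduct.lift_π _ _
  · refine biproduct.hom_ext (f := fun _ : PUnit.{1} => X.obj i) _ _ fun k => ?_
    refine (Category.assoc _ _ _).trans ?_
    refine (congrArg (biproduct.π (fun _ : PUnit.{1} => X.obj i) PUnit.unit ≫ ·)
      (biproduct.lift_π (f := fun _ : PUnit.{1} => X.obj i) (fun _ => 𝟙 (X.obj i)) k)).trans ?_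
    exact (Category.comp_id _).trans (Category.id_comp _).symm

/-- A map of diagrams is induced by a natural transformation between realization functors. This is
the source of the naturality of the Eilenberg–Zilber map. -/
lemma toRealize_naturality {X Y : I ⥤ D} (τ : X ⟶ Y) :
    τ ≫ toRealize Y = toRealize X ≫ Functor.whiskerLeft (universalObj I) (realizeMap τ) := by
  ext i
  exact lift_id_map (τ.app i)

end Realize

/-! ### Total and diagonal complexes under natural transformations and additive functors. -/

section Transport
open Opposite Simplicial AlgebraicTopology

variable {D : Type*} [Category* D] [Preadditive D] {X Y Z : BiSimplex ⥤ D}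

lemma alternating_naturality {J : Type*} [Fintype J] (z : J → ℤ) {x y : BiSimplex} (φ : J → (x ⟶ y))
    (τ : X ⟶ Y) : (∑ i, z i • X.map (φ i)) ≫ τ.app y = τ.app x ≫ ∑ i, z i • Y.map (φ i) := by
  rw [Preadditive.sum_comp, Preadditive.comp_sum]
  refine Finset.sum_congr rfl fun i _ => ?_
  rw [Preadditive.zsmul_comp, Preadditive.comp_zsmul, τ.naturality]

lemma map_alternating {D' : Type*} [Category* D'] [Preadditive D'] (F : D ⥤ D') [F.Additive]
    {J : Type*} [Fintype J] (z : J → ℤ) {x y : BiSimplex} (φ : J → (x ⟶ y)) :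
    F.map (∑ i, z i • X.map (φ i)) = ∑ i, z i • (X ⋙ F).map (φ i) := by
  rw [F.map_sum]
  exact Finset.sum_congr rfl fun i _ => F.map_zsmul

namespace TotalCx

/-- Functoriality of total complexes. -/
def hom (T : TotalCx X) (T' : TotalCx Y) (τ : X ⟶ Y) : T.cx ⟶ T'.cx where
  f n := T.desc fun a b h => τ.app (biObj a b) ≫ T'.ι a b n h
  comm' := by
    rintro _ n rfl
    refine T.hom_ext fun a b h => ?_
    rw [← Category.assoc, T.ι_desc, Category.assoc]
    rcases a with _ | a
    · rcases b with _ | b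
      · exact absurd h (by simp)
      rw [T'.ι_d_zero_succ b n h (by omega), ← Category.assoc (T.ι _ _ _ _),
        T.ι_d_zero_succ b n h (by omega), Category.assoc, T.ι_desc, vDiff, vDiff,
        ← Category.assoc, ← Category.assoc, alternating_naturality]
    rcases b with _ | b
    · rw [T'.ι_d_succ_zero a n h (by omega), ← Category.assoc (T.ι _ _ _ _),
        T.ι_d_succ_zero a n h (by omega), Category.assoc, T.ι_desc, hDiff, hDiff,
        ← Category.assoc, ← Category.assoc, alternating_naturality]
    · rw [T'.ι_d_succ_succ a b n h (by omega) (by omega), ← Category.assoc (T.ι _ _ _ _),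
        T.ι_d_succ_succ a b n h (by omega) (by omega), Preadditive.add_comp, Category.assoc,
        T.ι_desc, Preadditive.zsmul_comp, Category.assoc, T.ι_desc, hDiff, hDiff, vDiff, vDiff,
        Preadditive.comp_add, Preadditive.comp_zsmul, ← Category.assoc, ← Category.assoc,
        ← Category.assoc, ← Category.assoc, alternating_naturality, alternating_naturality]

lemma ι_hom (T : TotalCx X) (T' : TotalCx Y) (τ : X ⟶ Y) (a b n : ℕ) (h : a + b = n) :
    T.ι a b n h ≫ (T.hom T' τ).f n = τ.app (biObj a b) ≫ T'.ι a b n h :=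
  T.ι_desc _ _ _ _

lemma hom_comp (T : TotalCx X) (T' : TotalCx Y) (T'' : TotalCx Z) (τ : X ⟶ Y) (τ' : Y ⟶ Z) :
    T.hom T' τ ≫ T'.hom T'' τ' = T.hom T'' (τ ≫ τ') := by
  ext n
  refine T.hom_ext fun a b h => ?_
  rw [HomologicalComplex.comp_f, ← Category.assoc, ι_hom, Category.assoc, ι_hom, ι_hom,
    NatTrans.comp_app, Category.assoc]

lemma hom_id (T : TotalCx X) : T.hom T (𝟙 X) = 𝟙 T.cx := by
  ext n
  refine T.hom_ext fun a b h => ?_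
  rw [ι_hom, NatTrans.id_app, Category.id_comp, HomologicalComplex.id_f, Category.comp_id]

instance (T : TotalCx X) (T' : TotalCx Y) (τ : X ⟶ Y) [IsIso τ] : IsIso (T.hom T' τ) :=
  ⟨T'.hom T (inv τ), by rw [hom_comp, IsIso.hom_inv_id, hom_id],
    by rw [hom_comp, IsIso.inv_hom_id, hom_id]⟩

variable {D' : Type*} [Category* D'] [Preadditive D']

/-- The image of a total complex under an additive functor. -/
def mapFunctor (T : TotalCx X) (F : D ⥤ D') [F.Additive] : TotalCx (X ⋙ F) where
  cx := (F.mapHomologicalComplex _).obj T.cx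
  ι a b n h := F.map (T.ι a b n h)
  -- An additive functor is not assumed to preserve colimits, but it preserves the relations between
  -- the inclusions and the projections of a finite biproduct. Maps out of the image are therefore
  -- assembled by means of the projections.
  desc {n _} f := ∑ i : Fin (n + 1), F.map (T.π i (n - i) n (by omega)) ≫ f i (n - i) (by omega)
  ι_desc {n Z} f a b h := by
    refine (Preadditive.comp_sum _ _ _).trans ?_
    refine (sum_fin_eq (fun a' b' h' => F.map (T.ι a b n h) ≫ F.map (T.π a' b' n h') ≫ f a' b' h')
      a b h fun a' b' h' ne => ?_).trans ?_
    · refine (Category.assoc _ _ _).symm.trans ?_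
      rw [← F.map_comp, T.ι_π_of_ne h h' ne.symm, F.map_zero]
      exact zero_comp
    · refine (Category.assoc _ _ _).symm.trans ?_
      rw [← F.map_comp, T.ι_π_self, F.map_id]
      exact Category.id_comp _
  hom_ext {n Z f f'} H := by
    -- The image of the decomposition of the identity; it shows that a map is determined by its
    -- restrictions to the summands.
    have h : 𝟙 (F.obj (T.cx.X n)) = ∑ i : Fin (n + 1), F.map (T.π i (n - i) n (by omega)) ≫
        F.map (T.ι i (n - i) n (by omega)) := by
      rw [← F.map_id, ← T.sum_π_ι, F.map_sum]
      exact Finset.sum_congr rfl fun i _ => F.map_comp _ _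
    have h' (k : F.obj (T.cx.X n) ⟶ Z) : k = ∑ i : Fin (n + 1),
        F.map (T.π i (n - i) n (by omega)) ≫ F.map (T.ι i (n - i) n (by omega)) ≫ k := by
      refine (Category.id_comp k).symm.trans ?_
      rw [h, Preadditive.sum_comp]
      exact Finset.sum_congr rfl fun i _ => Category.assoc _ _ _
    refine (h' f).trans (Eq.trans ?_ (h' f').symm)
    exact Finset.sum_congr rfl fun i _ => congrArg _ (H _ _ _)
  ι_d_zero_succ b n h h' := by
    refine (F.map_comp _ _).symm.trans ?_
    rw [T.ι_d_zero_succ b n h h', F.map_comp, vDiff, map_alternating]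
    rfl
  ι_d_succ_zero a n h h' := by
    refine (F.map_comp _ _).symm.trans ?_
    rw [T.ι_d_succ_zero a n h h', F.map_comp, hDiff, map_alternating]
    rfl
  ι_d_succ_succ a b n h h₁ h₂ := by
    refine (F.map_comp _ _).symm.trans ?_
    rw [T.ι_d_succ_succ a b n h h₁ h₂, F.map_add, F.map_zsmul, F.map_comp, F.map_comp, vDiff,
      hDiff, map_alternating, map_alternating]
    rfl

/-- The comparison of total complexes induced by `τ : F ⟶ F'` is `τ` applied termwise to the
complex; this is the form needed to commute it past the image of a chain map. -/
lemma mapFunctor_hom (T : TotalCx X) (F F' : D ⥤ D') [F.Additive] [F'.Additive] (τ : F ⟶ F') :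
    (T.mapFunctor F).hom (T.mapFunctor F') (Functor.whiskerLeft X τ) =
      (NatTrans.mapHomologicalComplex τ _).app T.cx := by
  ext n
  refine (T.mapFunctor F).hom_ext fun a b h => ?_
  rw [ι_hom]
  exact (τ.naturality _).symm

end TotalCx

/-- Functoriality of the diagonal complex. -/
noncomputable def diagMap (τ : X ⟶ Y) : diagCx X ⟶ diagCx Y :=
  (alternatingFaceMapComplex D).map (Functor.whiskerLeft (Functor.diag _) τ)

lemma diagMap_comp (τ : X ⟶ Y) (τ' : Y ⟶ Z) : diagMap τ ≫ diagMap τ' = diagMap (τ ≫ τ') :=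
  ((alternatingFaceMapComplex D).map_comp _ _).symm

lemma diagMap_id (X : BiSimplex ⥤ D) : diagMap (𝟙 X) = 𝟙 (diagCx X) :=
  (alternatingFaceMapComplex D).map_id _

instance (τ : X ⟶ Y) [IsIso τ] : IsIso (diagMap τ) :=
  ⟨diagMap (inv τ), by rw [diagMap_comp, IsIso.hom_inv_id, diagMap_id],
    by rw [diagMap_comp, IsIso.inv_hom_id, diagMap_id]⟩

variable {D' : Type*} [Category* D'] [Preadditive D']

/-- Additive functors commute with the diagonal complex. -/
noncomputable def mapDiagIso (X : BiSimplex ⥤ D) (F : D ⥤ D') [F.Additive] :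
    (F.mapHomologicalComplex _).obj (diagCx X) ≅ diagCx (X ⋙ F) :=
  HomologicalComplex.Hom.isoOfComponents (fun _ => Iso.refl _) (by
    rintro _ n rfl
    refine (Category.id_comp _).trans (Eq.trans ?_ (Category.comp_id _).symm)
    refine (diagCx_d n).trans ?_
    refine Eq.trans ?_ (congrArg F.map (diagCx_d n)).symm
    exact (map_alternating F _ _).symm)

lemma mapDiagIso_naturality (X : BiSimplex ⥤ D) {F F' : D ⥤ D'} [F.Additive] [F'.Additive]
    (τ : F ⟶ F') : (mapDiagIso X F).hom ≫ diagMap (Functor.whiskerLeft X τ) =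
      (NatTrans.mapHomologicalComplex τ _).app (diagCx X) ≫ (mapDiagIso X F').hom := by
  ext n
  exact (Category.id_comp _).trans (Category.comp_id _).symm

end Transport

/-! ### The Eilenberg–Zilber theorem in an additive category. -/

section EilenbergZilber

variable {D : Type*} [Category* D] [Preadditive D] [HasFiniteBiproducts D] {X Y : BiSimplex ⥤ D}

/-- The Eilenberg–Zilber equivalence of the universal bisimplicial object. -/
noncomputable def universalEilenbergZilber :
    HomotopyEquiv (TotalCx.total (universalObj BiSimplex)).cx (diagCx (universalObj BiSimplex)) :=
  nonempty_universal_eilenbergZilber.some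

namespace TotalCx

/-- Pasting of four commutative squares, stated for arbitrary morphisms so that the naturality proof
never has to rewrite inside the concrete complexes. -/
lemma comp_squares {𝒞 : Type*} [Category* 𝒞] {A A' B B' C C' E E' F F' : 𝒞} {t : A ⟶ A'}
    {a : A ⟶ B} {a' : A' ⟶ B'} {r : B ⟶ B'} {b : B ⟶ C} {b' : B' ⟶ C'} {s : C ⟶ C'} {c : C ⟶ E}
    {c' : C' ⟶ E'} {q : E ⟶ E'} {d : E ⟶ F} {d' : E' ⟶ F'} {p : F ⟶ F'} (h₁ : t ≫ a' = a ≫ r)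
    (h₂ : r ≫ b' = b ≫ s) (h₃ : s ≫ c' = c ≫ q) (h₄ : q ≫ d' = d ≫ p) :
    t ≫ a' ≫ b' ≫ c' ≫ d' = (a ≫ b ≫ c ≫ d) ≫ p := by
  rw [reassoc_of% h₁, reassoc_of% h₂, reassoc_of% h₃, h₄]
  simp only [Category.assoc]

/-- The Eilenberg–Zilber map. -/
noncomputable def eilenbergZilber (T : TotalCx X) : T.cx ⟶ diagCx X :=
  T.hom ((TotalCx.total (universalObj BiSimplex)).mapFunctor (realize X)) (toRealize X) ≫
    ((realize X).mapHomologicalComplex _).map universalEilenbergZilber.hom ≫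
      (mapDiagIso _ _).hom ≫ inv (diagMap (toRealize X))

/-- The equivalence in the universal category is chosen once and does not depend on the diagram. A
map `τ` enters only through the natural transformation `realizeMap τ`, and each of the four factors
of the Eilenberg–Zilber map commutes with it. -/
lemma eilenbergZilber_naturality (T : TotalCx X) (T' : TotalCx Y) (τ : X ⟶ Y) :
    T.hom T' τ ≫ T'.eilenbergZilber = T.eilenbergZilber ≫ diagMap τ := by
  have h₁ : T.hom T' τ ≫ T'.hom ((TotalCx.total (universalObj BiSimplex)).mapFunctor (realize Y))
      (toRealize Y) = T.hom ((TotalCx.total (universalObj BiSimplex)).mapFunctor (realize X))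
      (toRealize X) ≫ (NatTrans.mapHomologicalComplex (realizeMap τ) _).app _ := by
    refine Eq.trans ?_ (congrArg (_ ≫ ·) (mapFunctor_hom _ _ _ (realizeMap τ)))
    refine (hom_comp _ _ _ _ _).trans (Eq.trans ?_ (hom_comp _ _ _ _ _).symm)
    rw [toRealize_naturality]
  have h₂ : diagMap (Functor.whiskerLeft (universalObj BiSimplex) (realizeMap τ)) ≫
      inv (diagMap (toRealize Y)) = inv (diagMap (toRealize X)) ≫ diagMap τ := by
    rw [IsIso.eq_inv_comp, ← Category.assoc, IsIso.comp_inv_eq, diagMap_comp, diagMap_comp,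
      toRealize_naturality]
  exact comp_squares h₁ (NatTrans.mapHomologicalComplex_naturality (c := ComplexShape.down ℕ)
    (realizeMap τ) universalEilenbergZilber.hom).symm (mapDiagIso_naturality _ _).symm h₂

/-- One factor is the image of a homotopy equivalence under an additive functor, and the other three
are isomorphisms. -/
instance (T : TotalCx X) [CategoryWithHomology D] : QuasiIso T.eilenbergZilber := by
  have h₁ : QuasiIso (((realize X).mapHomologicalComplex _).map universalEilenbergZilber.hom) :=
    ((realize X).mapHomotopyEquiv universalEilenbergZilber).quasiIso_hom
  have h₂ := quasiIso_comp ((mapDiagIso (universalObj BiSimplex) (realize X)).hom)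
    (inv (diagMap (toRealize X)))
  have h₃ := quasiIso_comp (((realize X).mapHomologicalComplex _).map
    universalEilenbergZilber.hom) ((mapDiagIso (universalObj BiSimplex) (realize X)).hom ≫
      inv (diagMap (toRealize X)))
  exact quasiIso_comp (T.hom ((TotalCx.total (universalObj BiSimplex)).mapFunctor (realize X))
    (toRealize X)) _ (hφ' := h₃)

end TotalCx

end EilenbergZilber

/-! ### The Eilenberg–Zilber theorem for a biadditive bifunctor, unnormalized and normalized. -/

section Bifunctor
open Opposite Simplicial AlgebraicTopology HomologicalComplex

attribute [local instance] Abelian.hasFiniteBiproducts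

section

variable {C : Type*} [Category* C] (F : C ⥤ C ⥤ C)

/-- The product of two simplicial objects along a bifunctor, as a bisimplicial object. -/
def biProd : SimplicialObject C × SimplicialObject C ⥤ (BiSimplex ⥤ C) where
  obj p := Functor.prod p.1 p.2 ⋙ Functor.uncurry.obj F
  map τ := Functor.whiskerRight (NatTrans.prod τ.1 τ.2) _
  map_id p := by
    ext x
    exact (Functor.uncurry.obj F).map_id (p.1.obj x.1, p.2.obj x.2)
  map_comp {p q r} τ τ' := by
    ext x
    exact (Functor.uncurry.obj F).map_comp
      ((τ.1.app x.1, τ.2.app x.2) : (p.1.obj x.1, p.2.obj x.2) ⟶ (q.1.obj x.1, q.2.obj x.2))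
      ((τ'.1.app x.1, τ'.2.app x.2) : (q.1.obj x.1, q.2.obj x.2) ⟶ (r.1.obj x.1, r.2.obj x.2))

/-- The levelwise product of two simplicial objects along a bifunctor. -/
def diagProd : SimplicialObject C × SimplicialObject C ⥤ SimplicialObject C :=
  biProd F ⋙ (Functor.whiskeringLeft _ _ _).obj (Functor.diag _)

variable (p : SimplicialObject C × SimplicialObject C)

lemma biProd_hFace {a : ℕ} (i : Fin (a + 2)) (b : ℕ) : ((biProd F).obj p).map (hFace i b) =
    (F.map (p.1.δ i)).app (p.2.obj (op ⦋b⦌)) := by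
  refine (congrArg (_ ≫ ·) ((congrArg (F.obj _).map (p.2.map_id _)).trans
    ((F.obj _).map_id _))).trans (Category.comp_id _)

lemma biProd_vFace (a : ℕ) {b : ℕ} (j : Fin (b + 2)) : ((biProd F).obj p).map (vFace a j) =
    (F.obj (p.1.obj (op ⦋a⦌))).map (p.2.δ j) := by
  refine (congrArg (fun φ => NatTrans.app φ _ ≫ _) ((congrArg F.map (p.1.map_id _)).trans
    (F.map_id _))).trans (Category.id_comp _)

variable [Preadditive C]

lemma app_zsmul {C₁ C₂ : Type*} [Category* C₁] [Category* C₂] [Preadditive C₂] {P Q : C₁ ⥤ C₂}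
    (z : ℤ) (τ : P ⟶ Q) (X : C₁) : (z • τ).app X = z • τ.app X := rfl

lemma map_app_alternating [F.Additive] {J : Type*} [Fintype J] (z : J → ℤ) {A B : C} (φ : J → (A ⟶ B)) (X : C) :
    (F.map (∑ i, z i • φ i)).app X = ∑ i, z i • (F.map (φ i)).app X := by
  rw [F.map_sum, NatTrans.app_sum]
  refine Finset.sum_congr rfl fun i _ => ?_
  rw [F.map_zsmul, app_zsmul]

lemma obj_map_alternating [∀ X, (F.obj X).Additive] {J : Type*} [Fintype J] (z : J → ℤ) {A B : C} (φ : J → (A ⟶ B)) (X : C) :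
    (F.obj X).map (∑ i, z i • φ i) = ∑ i, z i • (F.obj X).map (φ i) := by
  rw [(F.obj X).map_sum]
  exact Finset.sum_congr rfl fun i _ => (F.obj X).map_zsmul

/-- Additivity in the first variable lets the alternating sum of faces pass through the bifunctor.
With `biProd_vDiff` it follows that the double complex of the bisimplicial product is the one whose
total complex is the product of the two chain complexes. -/
lemma biProd_hDiff [F.Additive] (a b : ℕ) : hDiff ((biProd F).obj p) a b =
    (F.map (((alternatingFaceMapComplex C).obj p.1).d (a + 1) a)).app (p.2.obj (op ⦋b⦌)) := by
  rw [alternatingFaceMapComplex_obj_d]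
  refine Eq.trans ?_ (map_app_alternating F _ _ _).symm
  exact Finset.sum_congr rfl fun i _ => congrArg _ (biProd_hFace F p i b)

lemma biProd_vDiff [∀ X, (F.obj X).Additive] (a b : ℕ) : vDiff ((biProd F).obj p) a b =
    (F.obj (p.1.obj (op ⦋a⦌))).map (((alternatingFaceMapComplex C).obj p.2).d (b + 1) b) := by
  rw [alternatingFaceMapComplex_obj_d]
  refine Eq.trans ?_ (obj_map_alternating F _ _ _).symm
  exact Finset.sum_congr rfl fun i _ => congrArg _ (biProd_vFace F p a i)

variable [F.Additive] [∀ X, (F.obj X).Additive]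
  [∀ K₁ K₂ : ChainComplex C ℕ, HasMapBifunctor K₁ K₂ F (ComplexShape.down ℕ)]

/-- The product of chain complexes along a bifunctor. -/
noncomputable abbrev complexProd : ChainComplex C ℕ × ChainComplex C ℕ ⥤ ChainComplex C ℕ :=
  Functor.uncurry.obj (F.map₂HomologicalComplex (ComplexShape.down ℕ) (ComplexShape.down ℕ)
    (ComplexShape.down ℕ))

/-- The product of two alternating face map complexes as a total complex. -/
noncomputable def prodTotal : TotalCx ((biProd F).obj p) :=
  TotalCx.ofDouble (K := ((F.mapBifunctorHomologicalComplex (ComplexShape.down ℕ)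
    (ComplexShape.down ℕ)).obj ((alternatingFaceMapComplex C).obj p.1)).obj
    ((alternatingFaceMapComplex C).obj p.2)) (fun _ _ => Iso.refl _)
    (fun a b => (Category.id_comp _).trans
      ((biProd_hDiff F p a b).symm.trans (Category.comp_id _).symm))
    (fun a b => (Category.id_comp _).trans
      ((biProd_vDiff F p a b).symm.trans (Category.comp_id _).symm))

lemma prodTotal_ι (a b n : ℕ) (h : a + b = n) : (prodTotal F p).ι a b n h =
    ιMapBifunctor ((alternatingFaceMapComplex C).obj p.1) ((alternatingFaceMapComplex C).obj p.2) F
      (ComplexShape.down ℕ) a b n h := Category.id_comp _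

/-- Identifies the functoriality of `TotalCx` with that of the product of chain complexes, which
makes the Eilenberg–Zilber map a natural transformation out of the latter. Both sides are compared
on the summands. -/
lemma prodTotal_hom {p q : SimplicialObject C × SimplicialObject C} (τ : p ⟶ q) :
    (prodTotal F p).hom (prodTotal F q) ((biProd F).map τ) =
      (complexProd F).map (((alternatingFaceMapComplex C).map τ.1,
        (alternatingFaceMapComplex C).map τ.2) :
        ((alternatingFaceMapComplex C).obj p.1, (alternatingFaceMapComplex C).obj p.2) ⟶
        ((alternatingFaceMapComplex C).obj q.1, (alternatingFaceMapComplex C).obj q.2)) := by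
  ext n
  refine (prodTotal F p).hom_ext fun a b h => ?_
  rw [TotalCx.ι_hom]
  -- The map of products is defined by acting on the first variable and then on the second, so its
  -- value on a summand is found in two steps, in each of which the other variable is the identity.
  have h₁ := ι_mapBifunctorMap ((alternatingFaceMapComplex C).map τ.1)
    (𝟙 ((alternatingFaceMapComplex C).obj p.2)) F (ComplexShape.down ℕ) a b n h
  have h₂ := ι_mapBifunctorMap (𝟙 ((alternatingFaceMapComplex C).obj q.1))
    ((alternatingFaceMapComplex C).map τ.2) F (ComplexShape.down ℕ) a b n h
  rw [HomologicalComplex.id_f, CategoryTheory.Functor.map_id, Category.id_comp] at h₁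
  rw [HomologicalComplex.id_f, CategoryTheory.Functor.map_id, NatTrans.id_app, Category.id_comp] at h₂
  refine Eq.trans ?_ (congrArg (· ≫ _) (prodTotal_ι F p a b n h).symm)
  refine Eq.trans ?_ (Category.assoc _ _ _)
  refine Eq.trans ?_ (congrArg (· ≫ (mapBifunctorMap (𝟙 ((alternatingFaceMapComplex C).obj q.1))
    ((alternatingFaceMapComplex C).map τ.2) F (ComplexShape.down ℕ)).f n) h₁).symm
  refine Eq.trans ?_ (Category.assoc _ _ _).symm
  refine Eq.trans ?_ (congrArg ((F.map (τ.1.app (op ⦋a⦌))).app (p.2.obj (op ⦋b⦌)) ≫ ·) h₂).symm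
  refine (congrArg (_ ≫ ·) (prodTotal_ι F q a b n h)).trans (Category.assoc _ _ _)

end

section

variable {C : Type*} [Category* C] [Abelian C] (F : C ⥤ C ⥤ C) [F.Additive]
  [∀ X, (F.obj X).Additive]
  [∀ K₁ K₂ : ChainComplex C ℕ, HasMapBifunctor K₁ K₂ F (ComplexShape.down ℕ)]

/-- The Eilenberg–Zilber transformation for alternating face map complexes. -/
noncomputable def eilenbergZilberAlternating :
    Functor.prod (alternatingFaceMapComplex C) (alternatingFaceMapComplex C) ⋙ complexProd F ⟶
      diagProd F ⋙ alternatingFaceMapComplex C where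
  app p := (prodTotal F p).eilenbergZilber
  naturality p q τ := (congrArg (· ≫ (prodTotal F q).eilenbergZilber) (prodTotal_hom F τ)).symm.trans
    (TotalCx.eilenbergZilber_naturality (prodTotal F p) (prodTotal F q) ((biProd F).map τ))

instance (p : SimplicialObject C × SimplicialObject C) :
    QuasiIso ((eilenbergZilberAlternating F).app p) :=
  inferInstanceAs (QuasiIso (prodTotal F p).eilenbergZilber)

/-- The bifunctor is not assumed exact, so a mere quasi-isomorphism need not be preserved.
Homotopies, however, survive any additive bifunctor. -/
lemma quasiIso_mapBifunctorMap_left {K L : ChainComplex C ℕ} (e : HomotopyEquiv K L)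
    (M : ChainComplex C ℕ) :
    QuasiIso (mapBifunctorMap e.hom (𝟙 M) F (ComplexShape.down ℕ)) := by
  let Φ := (F.map₂HomologicalComplex (ComplexShape.down ℕ) (ComplexShape.down ℕ)
    (ComplexShape.down ℕ)).flip.obj M
  let E : HomotopyEquiv (Φ.obj K) (Φ.obj L) :=
    { hom := Φ.map e.hom
      inv := Φ.map e.inv
      homotopyHomInvId := (Homotopy.ofEq (Φ.map_comp _ _).symm).trans
        ((mapBifunctorMapHomotopy₁ e.homotopyHomInvId (𝟙 M) F (ComplexShape.down ℕ)).trans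
          (Homotopy.ofEq (Φ.map_id _)))
      homotopyInvHomId := (Homotopy.ofEq (Φ.map_comp _ _).symm).trans
        ((mapBifunctorMapHomotopy₁ e.homotopyInvHomId (𝟙 M) F (ComplexShape.down ℕ)).trans
          (Homotopy.ofEq (Φ.map_id _))) }
  exact E.quasiIso_hom

lemma quasiIso_mapBifunctorMap_right {K L : ChainComplex C ℕ} (e : HomotopyEquiv K L)
    (M : ChainComplex C ℕ) :
    QuasiIso (mapBifunctorMap (𝟙 M) e.hom F (ComplexShape.down ℕ)) := by
  let Φ := (F.map₂HomologicalComplex (ComplexShape.down ℕ) (ComplexShape.down ℕ)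
    (ComplexShape.down ℕ)).obj M
  let E : HomotopyEquiv (Φ.obj K) (Φ.obj L) :=
    { hom := Φ.map e.hom
      inv := Φ.map e.inv
      homotopyHomInvId := (Homotopy.ofEq (Φ.map_comp _ _).symm).trans
        ((mapBifunctorMapHomotopy₂ (𝟙 M) e.homotopyHomInvId F (ComplexShape.down ℕ)).trans
          (Homotopy.ofEq (Φ.map_id _)))
      homotopyInvHomId := (Homotopy.ofEq (Φ.map_comp _ _).symm).trans
        ((mapBifunctorMapHomotopy₂ (𝟙 M) e.homotopyInvHomId F (ComplexShape.down ℕ)).trans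
          (Homotopy.ofEq (Φ.map_id _))) }
  exact E.quasiIso_hom

/-- The Eilenberg–Zilber transformation for normalized chain complexes. -/
noncomputable def eilenbergZilberNormalized :
    Functor.prod (normalizedMooreComplex C) (normalizedMooreComplex C) ⋙ complexProd F ⟶
      diagProd F ⋙ normalizedMooreComplex C :=
  Functor.whiskerRight (NatTrans.prod (inclusionOfMooreComplex C) (inclusionOfMooreComplex C))
    (complexProd F) ≫ eilenbergZilberAlternating F ≫
      { app := fun p => DoldKan.PInftyToNormalizedMooreComplex ((diagProd F).obj p)
        naturality := fun _ _ τ =>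
          DoldKan.PInftyToNormalizedMooreComplex_naturality ((diagProd F).map τ) }

/-- The inclusion of the normalized complex into the alternating one is a homotopy equivalence, with
inverse the Dold–Kan projection. It may thus be inserted in one variable at a time before the
unnormalized map, and its inverse for the diagonal after it. -/
instance (p : SimplicialObject C × SimplicialObject C) :
    QuasiIso ((eilenbergZilberNormalized F).app p) := by
  have h₁ := quasiIso_mapBifunctorMap_left F
    (DoldKan.homotopyEquivNormalizedMooreComplexAlternatingFaceMapComplex (Y := p.1))
    ((normalizedMooreComplex C).obj p.2)
  have h₂ := quasiIso_mapBifunctorMap_right F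
    (DoldKan.homotopyEquivNormalizedMooreComplexAlternatingFaceMapComplex (Y := p.2))
    ((alternatingFaceMapComplex C).obj p.1)
  have h₃ : QuasiIso (DoldKan.PInftyToNormalizedMooreComplex ((diagProd F).obj p)) :=
    (DoldKan.homotopyEquivNormalizedMooreComplexAlternatingFaceMapComplex
      (Y := (diagProd F).obj p)).quasiIso_inv
  have h₄ := quasiIso_comp ((eilenbergZilberAlternating F).app p)
    (DoldKan.PInftyToNormalizedMooreComplex ((diagProd F).obj p)) (hφ' := h₃)
  have h₅ := quasiIso_comp _ _ (hφ := h₁) (hφ' := h₂)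
  exact quasiIso_comp _ _ (hφ := h₅) (hφ' := h₄)

end

end Bifunctor

/-! ### Stable subsets of finite `G`-sets and gluing of elements of a Mackey functor. -/

section SubGSets

variable {G : Type} [Group G]

/-- A `G`-stable subset of a finite `G`-set, as a finite `G`-set. -/
noncomputable def FinGSet.sub {T : FinGSet G} (E : SubMulAction G T) : FinGSet G :=
  FinGSet.ofFinite E

/-- The inclusion of a `G`-stable subset. -/
noncomputable def FinGSet.incl {T : FinGSet G} (E : SubMulAction G T) : FinGSet.sub E →[G] T where
  toFun w := (FinGSet.equiv E w : T)
  map_smul' g w := congrArg Subtype.val (FinGSet.equiv_smul E g w)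

lemma FinGSet.incl_injective {T : FinGSet G} (E : SubMulAction G T) :
    Function.Injective (FinGSet.incl E) :=
  Subtype.val_injective.comp (FinGSet.equiv E).injective

lemma FinGSet.incl_mem {T : FinGSet G} (E : SubMulAction G T) (w : FinGSet.sub E) :
    FinGSet.incl E w ∈ E := (FinGSet.equiv E w).2

/-- A point of a `G`-stable subset. -/
noncomputable def FinGSet.subMk {T : FinGSet G} {E : SubMulAction G T} (t : T) (h : t ∈ E) :
    FinGSet.sub E := (FinGSet.equiv E).symm ⟨t, h⟩

@[simp] lemma FinGSet.incl_subMk {T : FinGSet G} {E : SubMulAction G T} (t : T) (h : t ∈ E) :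
    FinGSet.incl E (FinGSet.subMk t h) = t :=
  congrArg Subtype.val ((FinGSet.equiv E).apply_symm_apply ⟨t, h⟩)

/-- A map with values in a `G`-stable subset. -/
noncomputable def FinGSet.subLift {V T : FinGSet G} {E : SubMulAction G T} (f : V →[G] T)
    (h : ∀ v, f v ∈ E) : V →[G] FinGSet.sub E where
  toFun v := FinGSet.subMk (f v) (h v)
  map_smul' g v := FinGSet.incl_injective E ((FinGSet.incl_subMk _ _).trans ((map_smul f g v).trans
    ((map_smul (FinGSet.incl E) g _).trans (congrArg (g • ·) (FinGSet.incl_subMk _ (h v)))).symm))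

@[simp] lemma FinGSet.incl_subLift {V T : FinGSet G} {E : SubMulAction G T} (f : V →[G] T)
    (h : ∀ v, f v ∈ E) (v : V) : FinGSet.incl E (FinGSet.subLift f h v) = f v :=
  FinGSet.incl_subMk _ _

/-- The `G`-stable subset given by an invariant predicate. -/
def stable {T : FinGSet G} (p : T → Prop) (h : ∀ (g : G) t, p t → p (g • t)) :
    SubMulAction G T where
  carrier := {t | p t}
  smul_mem' g _ ht := h g _ ht

/-- The complement of a `G`-stable subset. -/
def stableCompl {T : FinGSet G} (E : SubMulAction G T) : SubMulAction G T :=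
  stable (fun t => t ∉ E) fun g t h h' => h (by
    have := E.smul_mem g⁻¹ h'
    rwa [inv_smul_smul] at this)

/-- The complement of a `G`-stable subset is again `G`-stable, so every such subset splits off and
the additivity axiom of Mackey functors applies to it. -/
lemma isCoprod_stableCompl {T : FinGSet G} (E : SubMulAction G T) :
    IsCoprod (FinGSet.incl E) (FinGSet.incl (stableCompl E)) := by
  constructor
  · rintro (a | a) (b | b) h
    · exact congrArg Sum.inl (FinGSet.incl_injective E h)
    · have h' : FinGSet.incl E a = FinGSet.incl (stableCompl E) b := h
      exact absurd (h' ▸ FinGSet.incl_mem E a) (FinGSet.incl_mem (stableCompl E) b)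
    · have h' : FinGSet.incl (stableCompl E) a = FinGSet.incl E b := h
      exact absurd (h' ▸ FinGSet.incl_mem E b) (FinGSet.incl_mem (stableCompl E) a)
    · exact congrArg Sum.inr (FinGSet.incl_injective _ h)
  · intro t
    by_cases ht : t ∈ E
    · exact ⟨Sum.inl (FinGSet.subMk t ht), FinGSet.incl_subMk t ht⟩
    · exact ⟨Sum.inr (FinGSet.subMk (E := stableCompl E) t ht),
        FinGSet.incl_subMk (E := stableCompl E) t ht⟩

/-- The preimage of a `G`-stable subset. -/
def stablePreimage {V T : FinGSet G} (f : V →[G] T) (E : SubMulAction G T) : SubMulAction G V :=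
  stable (fun v => f v ∈ E) fun g v h => by rw [map_smul]; exact E.smul_mem g h

lemma IsPb.symm {W S T U : FinGSet G} {p : W →[G] S} {q : W →[G] T} {f : S →[G] U}
    {h : T →[G] U} (H : IsPb p q f h) : IsPb q p h f where
  comm w := (H.comm w).symm
  existsUnique s t e := by
    obtain ⟨w, hw, hw'⟩ := H.existsUnique t s e.symm
    exact ⟨w, hw.symm, fun y hy => hw' y hy.symm⟩

namespace MackeyFunctor

variable (P : MackeyFunctor.{u} G)

/-- Elements which agree locally are equal. -/
lemma ext_of_cover (n : ℕ) {T : FinGSet G} (hn : Nat.card T ≤ n) {a b : P.obj T}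
    (h : ∀ t : T, ∃ E : SubMulAction G T, t ∈ E ∧
      P.res (FinGSet.incl E) a = P.res (FinGSet.incl E) b) : a = b := by
  induction n generalizing T with
  | zero =>
    have hT : IsEmpty T := (Nat.card_eq_zero.mp (Nat.le_zero.mp hn)).resolve_right
      (not_infinite_iff_finite.mpr inferInstance)
    have := P.subsingleton_of_isEmpty T
    exact Subsingleton.elim _ _
  | succ n ih =>
    rcases isEmpty_or_nonempty T with hT | ⟨⟨t⟩⟩
    · have := P.subsingleton_of_isEmpty T
      exact Subsingleton.elim _ _
    -- The stable set around one chosen point is split off. By additivity it suffices to compare the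
    -- restrictions to `E`, which agree, and to its complement, which is strictly smaller.
    obtain ⟨E, ht, hE⟩ := h t
    apply (P.additive (isCoprod_stableCompl E)).1
    refine Prod.ext hE (ih ?_ fun w => ?_)
    · have hlt : Nat.card (FinGSet.sub (stableCompl E)) < Nat.card T := by
        have := Fintype.ofFinite T
        have := Fintype.ofFinite (FinGSet.sub (stableCompl E))
        rw [Nat.card_eq_fintype_card, Nat.card_eq_fintype_card]
        refine Fintype.card_lt_of_injective_of_notMem (b := t) (FinGSet.incl (stableCompl E))
          (FinGSet.incl_injective _) ?_
        rintro ⟨w, hw⟩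
        exact FinGSet.incl_mem (stableCompl E) w (hw ▸ ht)
      omega
    · obtain ⟨E', hw, hE'⟩ := h (FinGSet.incl (stableCompl E) w)
      refine ⟨stablePreimage (FinGSet.incl (stableCompl E)) E', hw, ?_⟩
      -- The hypothesis for the complement comes from pulling `E'` back to it: restricting in two
      -- steps through the complement is the same as restricting to `E'` first.
      have key : ∀ x : P.obj T, P.res (FinGSet.incl (stablePreimage (FinGSet.incl (stableCompl E))
          E')) (P.res (FinGSet.incl (stableCompl E)) x) =
          P.res (FinGSet.subLift (E := E') ((FinGSet.incl (stableCompl E)).comp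
            (FinGSet.incl (stablePreimage (FinGSet.incl (stableCompl E)) E')))
            fun v => FinGSet.incl_mem (stablePreimage (FinGSet.incl (stableCompl E)) E') v)
            (P.res (FinGSet.incl E') x) := fun x => by
        rw [← P.res_comp, ← P.res_comp]
        exact P.res_eq (fun v => (FinGSet.incl_subLift (E := E') _ _ v).symm) x
      exact (key a).trans ((congrArg _ hE').trans (key b).symm)

end MackeyFunctor

end SubGSets

/-! ### Homomorphisms with a parameter out of a presented Mackey functor. -/

namespace Presentation

open GCoeff

variable {G : Type} [Group G] {Q : Presentation.{u} G}

/-- A parametrized version of `desc`: a homomorphism from the values of a presented Mackey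
functor, depending on a parameter. -/
noncomputable def pdesc {N : MackeyFunctor.{u} G} {Y : GCoeff.{u} G}
    (φ : ∀ T : FinGSet G, Y.obj T → Q.D.obj T → N.obj T)
    (nat : ∀ {S T : FinGSet G} (h : S →[G] T) (y : Y.obj T) (d : Q.D.obj T),
      φ S (Y.res h y) (Q.D.res h d) = N.res h (φ T y d))
    (rel : ∀ {T : FinGSet G} (y : Y.obj T) (e : _), Q.E T e →
      ev (fun V k d => N.tr k (φ V (Y.res k y) d)) e = 0) {S : FinGSet G} (y : Y.obj S) :
    Q.mackey.obj S →+ N.obj S :=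
  lift (fun T f d => N.tr f (φ T (Y.res f y) d))
    (fun f i j hij d => by
      rw [N.tr_comp, N.tr_comp, Y.res_comp, Y.res_comp, nat, nat, ← map_add, ← N.decomp hij])
    (fun f e he => by
      have h := congrArg (N.tr f) (rel (Y.res f y) e he)
      rw [map_zero] at h
      rw [← h, map_ev]
      refine congrArg (fun ψ => ev ψ e) ?_
      funext V k d
      rw [N.tr_comp, Y.res_comp])

section

variable {N : MackeyFunctor.{u} G} {Y : GCoeff.{u} G}
  (φ : ∀ T : FinGSet G, Y.obj T → Q.D.obj T → N.obj T)
  (nat : ∀ {S T : FinGSet G} (h : S →[G] T) (y : Y.obj T) (d : Q.D.obj T),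
    φ S (Y.res h y) (Q.D.res h d) = N.res h (φ T y d))
  (rel : ∀ {T : FinGSet G} (y : Y.obj T) (e : _), Q.E T e →
    ev (fun V k d => N.tr k (φ V (Y.res k y) d)) e = 0)

lemma pdesc_elt {S T : FinGSet G} (y : Y.obj S) (f : T →[G] S) (d : Q.D.obj T) :
    pdesc φ nat rel y (elt f d) = N.tr f (φ T (Y.res f y) d) := lift_elt _ _ _ f d

lemma pdesc_ιelt {T : FinGSet G} (y : Y.obj T) (d : Q.D.obj T) :
    pdesc φ nat rel y (ιelt d) = φ T y d := by
  rw [ιelt, pdesc_elt, N.tr_id, Y.res_id]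

/-- The Frobenius relation in the presented variable: a transfer moves outside at the cost of
restricting the parameter. Together with `pdesc_res` it supplies half of what a pairing of Mackey
functors must satisfy; the conditions in the parameter follow separately. -/
lemma pdesc_tr {S T : FinGSet G} (h : S →[G] T) (y : Y.obj T) (a : Q.mackey.obj S) :
    pdesc φ nat rel y (Q.mackey.tr h a) = N.tr h (pdesc φ nat rel (Y.res h y) a) := by
  refine DFunLike.congr_fun (f := (pdesc φ nat rel y).comp (Q.mackey.tr h))
    (g := (N.tr h).comp (pdesc φ nat rel (Y.res h y))) (elt_hom_ext fun V k d => ?_) a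
  rw [AddMonoidHom.comp_apply, AddMonoidHom.comp_apply, tr_elt, pdesc_elt, pdesc_elt, N.tr_comp,
    Y.res_comp]

lemma pdesc_res {S T : FinGSet G} (h : S →[G] T) (y : Y.obj T) (a : Q.mackey.obj T) :
    pdesc φ nat rel (Y.res h y) (Q.mackey.res h a) = N.res h (pdesc φ nat rel y a) := by
  refine DFunLike.congr_fun (f := (pdesc φ nat rel (Y.res h y)).comp (Q.mackey.res h))
    (g := (N.res h).comp (pdesc φ nat rel y)) (elt_hom_ext fun V k d => ?_) a
  rw [AddMonoidHom.comp_apply, AddMonoidHom.comp_apply, res_elt, pdesc_elt, pdesc_elt,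
    N.mackey (isPb_pb k h), ← nat, ← Y.res_comp, ← Y.res_comp]
  congr 2
  rw [show h.comp (FinGSet.snd k h) = k.comp (FinGSet.fst k h) from
    MulActionHom.ext fun w => (FinGSet.pb_comm w).symm]

end

end Presentation

/-! ### Box products of two Mackey functors: pure tensors, pairings and additivity. -/

section TwofoldBox

variable {G : Type} [Group G] {P Q N : MackeyFunctor.{u} G}

/-- A pair of elements as a family indexed by `Bool`. -/
def pairElt {T : FinGSet G} (p : P.obj T) (q : Q.obj T) : ∀ i, (pair P Q i).obj T
  | false => p
  | true => q

lemma pairElt_eta {T : FinGSet G} (x : ∀ i, (pair P Q i).obj T) :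
    x = pairElt (P := P) (Q := Q) (x false) (x true) := by
  funext i; cases i <;> rfl

lemma update_false {T : FinGSet G} (x : ∀ i, (pair P Q i).obj T) (a : P.obj T) :
    Function.update x false a = pairElt (P := P) (Q := Q) a (x true) := by
  funext i; cases i <;> rfl

lemma update_true {T : FinGSet G} (x : ∀ i, (pair P Q i).obj T) (a : Q.obj T) :
    Function.update x true a = pairElt (P := P) (Q := Q) (x false) a := by
  funext i; cases i <;> rfl

/-- The pure tensor of two elements. -/
noncomputable def tmul {T : FinGSet G} (p : P.obj T) (q : Q.obj T) : (bigBox (pair P Q)).obj T :=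
  boxTmul (pairElt p q)

lemma boxTmul_pair {T : FinGSet G} (x : ∀ i, (pair P Q i).obj T) :
    boxTmul x = tmul (P := P) (Q := Q) (x false) (x true) :=
  congrArg boxTmul (pairElt_eta x)

lemma boxTmul_update_false {T : FinGSet G} (x : ∀ i, (pair P Q i).obj T) (a : P.obj T) :
    boxTmul (Function.update x false a) = tmul (P := P) (Q := Q) a (x true) :=
  congrArg boxTmul (update_false x a)

lemma boxTmul_update_true {T : FinGSet G} (x : ∀ i, (pair P Q i).obj T) (a : Q.obj T) :
    boxTmul (Function.update x true a) = tmul (P := P) (Q := Q) (x false) a :=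
  congrArg boxTmul (update_true x a)

lemma tmul_add_left {T : FinGSet G} (p p' : P.obj T) (q : Q.obj T) :
    tmul (p + p') q = tmul p q + tmul p' q :=
  (boxTmul_update_false (pairElt p q) (p + p')).symm.trans
    ((boxTmul_add (M := pair P Q) (pairElt p q) false p p').trans
      (congrArg₂ (· + ·) (boxTmul_update_false _ _) (boxTmul_update_false _ _)))

lemma tmul_add_right {T : FinGSet G} (p : P.obj T) (q q' : Q.obj T) :
    tmul p (q + q') = tmul p q + tmul p q' :=
  (boxTmul_update_true (pairElt p q) (q + q')).symm.trans
    ((boxTmul_add (M := pair P Q) (pairElt p q) true q q').trans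
      (congrArg₂ (· + ·) (boxTmul_update_true _ _) (boxTmul_update_true _ _)))

lemma tmul_tr_left {T T' : FinGSet G} (h : T' →[G] T) (p : P.obj T') (q : Q.obj T) :
    tmul (P.tr h p) q = (bigBox (pair P Q)).tr h (tmul p (Q.res h q)) :=
  (boxTmul_update_false (pairElt (P.tr h p) q) (P.tr h p)).symm.trans
    ((boxTmul_tr (M := pair P Q) h (pairElt (P.tr h p) q) false p).trans
      (congrArg _ (boxTmul_update_false _ _)))

lemma tmul_tr_right {T T' : FinGSet G} (h : T' →[G] T) (p : P.obj T) (q : Q.obj T') :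
    tmul p (Q.tr h q) = (bigBox (pair P Q)).tr h (tmul (P.res h p) q) :=
  (boxTmul_update_true (pairElt p (Q.tr h q)) (Q.tr h q)).symm.trans
    ((boxTmul_tr (M := pair P Q) h (pairElt p (Q.tr h q)) true q).trans
      (congrArg _ (boxTmul_update_true _ _)))

lemma res_tmul {T T' : FinGSet G} (h : T' →[G] T) (p : P.obj T) (q : Q.obj T) :
    (bigBox (pair P Q)).res h (tmul p q) = tmul (P.res h p) (Q.res h q) :=
  (res_boxTmul h _).trans (boxTmul_pair _)

lemma box_hom_ext {φ ψ : bigBox (pair P Q) ⟶ N}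
    (h : ∀ (T : FinGSet G) (p : P.obj T) (q : Q.obj T),
      φ.app T (tmul p q) = ψ.app T (tmul p q)) : φ = ψ :=
  bigBox_hom_ext fun T x => by rw [boxTmul_pair]; exact h T _ _

lemma bigBoxMap_pair {P' Q' : MackeyFunctor.{u} G} (φ : ∀ i, pair P Q i ⟶ pair P' Q' i)
    {T : FinGSet G} (p : P.obj T) (q : Q.obj T) :
    (bigBoxMap φ).app T (tmul p q) =
      tmul (P := P') (Q := Q') ((φ false).app T p) ((φ true).app T q) :=
  (bigBoxMap_tmul φ _).trans (boxTmul_pair _)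

lemma box_obj_map_tmul (M : MackeyFunctor.{u} G) (ψ : Q ⟶ N) {T : FinGSet G} (p : M.obj T)
    (q : Q.obj T) : MackeyFunctor.Hom.app (((box G).obj M).map ψ) T (tmul p q) =
      tmul p (ψ.app T q) :=
  bigBoxMap_pair (P' := M) (Q' := N) (pairMap (𝟙 M) ψ) p q

lemma box_map_app_tmul (φ : P ⟶ N) (M : MackeyFunctor.{u} G) {T : FinGSet G} (p : P.obj T)
    (q : M.obj T) : MackeyFunctor.Hom.app (((box G).map φ).app M) T (tmul p q) =
      tmul (φ.app T p) q :=
  bigBoxMap_pair (P' := N) (Q' := M) (pairMap φ (𝟙 M)) p q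

/-- Additivity in each variable is the property of the box product on which the Eilenberg–Zilber
theorem relies. -/
instance (M : MackeyFunctor.{u} G) : ((box G).obj M).Additive where
  map_add {N N' φ ψ} := box_hom_ext (P := M) (Q := N) fun T p q =>
    (box_obj_map_tmul M (φ + ψ) p q).trans
      ((tmul_add_right (P := M) (Q := N') p (φ.app T q) (ψ.app T q)).trans
        (congrArg₂ (· + ·) (box_obj_map_tmul M φ p q) (box_obj_map_tmul M ψ p q)).symm)

instance : (box.{u} G).Additive where
  map_add {M M' φ ψ} := NatTrans.ext (funext fun N =>
    box_hom_ext (P := M) (Q := N) fun T p q => (box_map_app_tmul (φ + ψ) N p q).trans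
      ((tmul_add_left (P := M') (Q := N) (φ.app T p) (ψ.app T p) q).trans
        (congrArg₂ (· + ·) (box_map_app_tmul φ N p q) (box_map_app_tmul ψ N p q)).symm))

/-- The morphism out of a box product of two Mackey functors given by a pairing. -/
noncomputable def boxHom (β : ∀ T : FinGSet G, P.obj T → Q.obj T →+ N.obj T)
    (nat : ∀ {S T : FinGSet G} (h : S →[G] T) (p : P.obj T) (q : Q.obj T),
      β S (P.res h p) (Q.res h q) = N.res h (β T p q))
    (add : ∀ {T : FinGSet G} (p p' : P.obj T) (q : Q.obj T), β T (p + p') q = β T p q + β T p' q)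
    (tr_left : ∀ {T T' : FinGSet G} (h : T' →[G] T) (p : P.obj T') (q : Q.obj T),
      β T (P.tr h p) q = N.tr h (β T' p (Q.res h q)))
    (tr_right : ∀ {T T' : FinGSet G} (h : T' →[G] T) (p : P.obj T) (q : Q.obj T'),
      β T p (Q.tr h q) = N.tr h (β T' (P.res h p) q)) : bigBox (pair P Q) ⟶ N :=
  boxDesc (M := pair P Q) (fun T x => β T (x false) (x true)) (fun h _ => nat h _ _)
    (fun x i a b => match i with
      | false => (congrArg (fun y => β _ (y false) (y true)) (update_false x (a + b))).trans
          ((add a b (x true)).trans (congrArg₂ (· + ·)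
            (congrArg (fun y => β _ (y false) (y true)) (update_false x a).symm)
            (congrArg (fun y => β _ (y false) (y true)) (update_false x b).symm)))
      | true => (congrArg (fun y => β _ (y false) (y true)) (update_true x (a + b))).trans
          ((map_add (β _ (x false)) a b).trans (congrArg₂ (· + ·)
            (congrArg (fun y => β _ (y false) (y true)) (update_true x a).symm)
            (congrArg (fun y => β _ (y false) (y true)) (update_true x b).symm))))
    (fun {T T'} h x i a => match i with
      | false => (congrArg (fun y => β T (y false) (y true)) (update_false x (P.tr h a))).trans
          ((tr_left h a (x true)).trans (congrArg (fun y => N.tr h (β T' (y false) (y true)))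
            (update_false (fun j => (pair P Q j).res h (x j)) a).symm))
      | true => (congrArg (fun y => β T (y false) (y true)) (update_true x (Q.tr h a))).trans
          ((tr_right h (x false) a).trans (congrArg (fun y => N.tr h (β T' (y false) (y true)))
            (update_true (fun j => (pair P Q j).res h (x j)) a).symm)))

lemma boxHom_tmul (β : ∀ T : FinGSet G, P.obj T → Q.obj T →+ N.obj T) (nat) (add) (tr_left)
    (tr_right) {T : FinGSet G} (p : P.obj T) (q : Q.obj T) :
    (boxHom β nat add tr_left tr_right).app T (tmul p q) = β T p q :=
  boxDesc_tmul (M := pair P Q) _ _ _ _ _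

end TwofoldBox

/-! ### Additivity and Frobenius reciprocity in the parameter. -/

namespace Presentation

open GCoeff

variable {G : Type} [Group G] {Q : Presentation.{u} G} {N : MackeyFunctor.{u} G} {Y : GCoeff.{u} G}
  (φ : ∀ T : FinGSet G, Y.obj T → Q.D.obj T → N.obj T)
  (nat : ∀ {S T : FinGSet G} (h : S →[G] T) (y : Y.obj T) (d : Q.D.obj T),
    φ S (Y.res h y) (Q.D.res h d) = N.res h (φ T y d))
  (rel : ∀ {T : FinGSet G} (y : Y.obj T) (e : _), Q.E T e →
    ev (fun V k d => N.tr k (φ V (Y.res k y) d)) e = 0)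

lemma pdesc_add {T : FinGSet G} {y y₁ y₂ : Y.obj T}
    (h : ∀ {V : FinGSet G} (f : V →[G] T) (d : Q.D.obj V),
      φ V (Y.res f y) d = φ V (Y.res f y₁) d + φ V (Y.res f y₂) d) (a : Q.mackey.obj T) :
    pdesc φ nat rel y a = pdesc φ nat rel y₁ a + pdesc φ nat rel y₂ a :=
  DFunLike.congr_fun (f := pdesc φ nat rel y) (g := pdesc φ nat rel y₁ + pdesc φ nat rel y₂)
    (elt_hom_ext fun V k d => by
      rw [AddMonoidHom.add_apply, pdesc_elt, pdesc_elt, pdesc_elt, h, map_add]) a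

lemma pdesc_zero {T : FinGSet G} {y : Y.obj T}
    (h : ∀ {V : FinGSet G} (f : V →[G] T) (d : Q.D.obj V), φ V (Y.res f y) d = 0)
    (a : Q.mackey.obj T) : pdesc φ nat rel y a = 0 :=
  DFunLike.congr_fun (f := pdesc φ nat rel y) (g := 0)
    (elt_hom_ext fun V k d => by rw [pdesc_elt, h, map_zero, AddMonoidHom.zero_apply]) a

/-- The parameters carry restrictions only, so "`y` is the transfer of `y'` along `h`" cannot be
expressed directly. The hypothesis `H` replaces it: it is the double coset formula for restricting
such a transfer along `f`, read off after applying `φ`. -/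
lemma pdesc_frobenius {T T' : FinGSet G} (h : T' →[G] T) {y : Y.obj T} {y' : Y.obj T'}
    (H : ∀ {V : FinGSet G} (f : V →[G] T) (d : Q.D.obj V), φ V (Y.res f y) d =
      N.tr (FinGSet.fst f h) (φ _ (Y.res (FinGSet.snd f h) y') (Q.D.res (FinGSet.fst f h) d)))
    (a : Q.mackey.obj T) :
    pdesc φ nat rel y a = N.tr h (pdesc φ nat rel y' (Q.mackey.res h a)) :=
  DFunLike.congr_fun (f := pdesc φ nat rel y)
    (g := (N.tr h).comp ((pdesc φ nat rel y').comp (Q.mackey.res h)))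
    (elt_hom_ext fun V k d => by
      rw [AddMonoidHom.comp_apply, AddMonoidHom.comp_apply, res_elt, pdesc_elt, pdesc_elt, H,
        ← N.tr_comp, ← N.tr_comp]
      exact N.tr_eq FinGSet.pb_comm _) a

end Presentation

/-! ### Morphisms out of box powers of `R[M]`: reduction to tensors of the form `□ (r_i · x_i)`. -/

section BoxOfMonoidAlgebras

open GCoeff Presentation

variable {G : Type} [Group G] {ι : Type} [DecidableEq ι]

lemma comp_update_apply {α β : Type*} (F : α → β) (x : ι → α) (i : ι) (a : α) :
    (fun j => F (Function.update x i a j)) = Function.update (fun j => F (x j)) i (F a) :=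
  Function.comp_update F x i a

section

variable {R : GreenFunctor.{u} G} {M : PointedGMonoid.{u} G} {N : MackeyFunctor.{u} G}

/-- A morphism out of a box power of `R[M]` as a function of one variable. -/
noncomputable def varHom (χ : (bigBox fun _ : ι => (algPres R M).mackey) ⟶ N) {T : FinGSet G}
    (a : ι → (algPres R M).mackey.obj T) (i : ι) : (algPres R M).mackey.obj T →+ N.obj T :=
  AddMonoidHom.mk' (fun b => χ.app T
    (boxTmul (M := fun _ : ι => (algPres R M).mackey) (Function.update a i b)))
    fun b c => (congrArg (χ.app T)
      (boxTmul_add (M := fun _ : ι => (algPres R M).mackey) a i b c)).trans (map_add _ _ _)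

lemma varHom_self (χ : (bigBox fun _ : ι => (algPres R M).mackey) ⟶ N) {T : FinGSet G}
    (a : ι → (algPres R M).mackey.obj T) (i : ι) : varHom χ a i (a i) =
      χ.app T (boxTmul (M := fun _ : ι => (algPres R M).mackey) a) :=
  congrArg (fun b => χ.app T (boxTmul (M := fun _ : ι => (algPres R M).mackey) b))
    (Function.update_eq_self i a)

lemma varHom_tr (χ : (bigBox fun _ : ι => (algPres R M).mackey) ⟶ N) {V T : FinGSet G}
    (a : ι → (algPres R M).mackey.obj T) (i : ι) (f : V →[G] T)
    (b : (algPres R M).mackey.obj V) : varHom χ a i ((algPres R M).mackey.tr f b) =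
      N.tr f (χ.app V (boxTmul (M := fun _ : ι => (algPres R M).mackey)
        (Function.update (fun j => (algPres R M).mackey.res f (a j)) i b))) :=
  (congrArg (χ.app T) (boxTmul_tr (M := fun _ : ι => (algPres R M).mackey) f a i b)).trans
    (χ.app_tr f _)

/-- Induction on the set `J` of variables that are not yet of the form `r · x`. In one variable,
additivity leaves a transfer of such an element, and Frobenius reciprocity moves the transfer
outside. -/
lemma app_boxTmul_eq {φ ψ : (bigBox fun _ : ι => (algPres R M).mackey) ⟶ N}
    (h : ∀ (T : FinGSet G) (r : ι → R.obj T) (x : ι → (T →[G] M)),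
      φ.app T (boxTmul (M := fun _ : ι => (algPres R M).mackey) fun i => algElt (r i) (x i)) =
        ψ.app T (boxTmul (M := fun _ : ι => (algPres R M).mackey) fun i =>
          algElt (r i) (x i))) (J : Finset ι) (T : FinGSet G)
    (a : ι → (algPres R M).mackey.obj T)
    (ha : ∀ i, i ∉ J → ∃ (r : R.obj T) (x : T →[G] M), a i = algElt r x) :
    φ.app T (boxTmul (M := fun _ : ι => (algPres R M).mackey) a) =
      ψ.app T (boxTmul (M := fun _ : ι => (algPres R M).mackey) a) := by
  induction J using Finset.induction_on generalizing T with
  | empty =>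
    choose r x hrx using fun i => ha i (Finset.notMem_empty i)
    rw [show a = fun i => algElt (r i) (x i) from funext hrx]
    exact h T r x
  | insert i J hi ih =>
    rw [← varHom_self φ a i, ← varHom_self ψ a i]
    refine DFunLike.congr_fun (elt_hom_ext (Q := algPres R M) (φ := varHom φ a i)
      (ψ := varHom ψ a i) fun V f d => ?_) (a i)
    rw [elt_eq_tr, varHom_tr, varHom_tr]
    -- Moving the transfer outside restricts the other variables along `f`. Those already of the
    -- form `r · x` keep it, because restriction acts on `r` and on `x`.
    refine congrArg (N.tr f) (ih V _ fun j hj => ?_)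
    rcases eq_or_ne j i with rfl | hji
    · exact ⟨d.1, d.2, Function.update_self _ _ _⟩
    · obtain ⟨r, x, hrx⟩ := ha j (by simp [hji, hj])
      refine ⟨R.res f r, x.comp f, (Function.update_of_ne hji _ _).trans ?_⟩
      rw [hrx, res_algElt]

/-- A morphism out of a box power of `R[M]` is determined on the tensors `□ (r_i · x_i)`. -/
lemma algBox_hom_ext [Fintype ι] {φ ψ : (bigBox fun _ : ι => (algPres R M).mackey) ⟶ N}
    (h : ∀ (T : FinGSet G) (r : ι → R.obj T) (x : ι → (T →[G] M)),
      φ.app T (boxTmul (M := fun _ : ι => (algPres R M).mackey) fun i => algElt (r i) (x i)) =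
        ψ.app T (boxTmul (M := fun _ : ι => (algPres R M).mackey) fun i =>
          algElt (r i) (x i))) : φ = ψ :=
  bigBox_hom_ext fun T a => app_boxTmul_eq h Finset.univ T a fun i hi =>
    absurd (Finset.mem_univ i) hi

variable (R M) (ι) in
/-- Tuples of elements of `R[M]`, of `R` and of maps into `M`. -/
noncomputable def tupleCoeff : GCoeff.{u} G where
  obj T := (ι → (algPres R M).mackey.obj T) × (ι → R.obj T) × (ι → (T →[G] M))
  res f y := (fun i => (algPres R M).mackey.res f (y.1 i), fun i => R.res f (y.2.1 i),
    fun i => (y.2.2 i).comp f)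
  res_id _ := Prod.ext (funext fun _ => MackeyFunctor.res_id _ _)
    (Prod.ext (funext fun _ => R.res_id _) rfl)
  res_comp _ _ _ := Prod.ext (funext fun _ => MackeyFunctor.res_comp _ _ _ _)
    (Prod.ext (funext fun _ => R.res_comp _ _ _) rfl)

/-- A pairing which takes elements of `R[M]` in the variables of `J` and generators `r · x` of
`R[M]` in the other variables, and which extends `φ`. -/
structure IsPartialDesc (φ : ∀ T : FinGSet G, (ι → R.obj T) → (ι → (T →[G] M)) → N.obj T)
    (J : Finset ι) (ψ : ∀ T : FinGSet G, (ι → (algPres R M).mackey.obj T) → (ι → R.obj T) →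
      (ι → (T →[G] M)) → N.obj T) : Prop where
  nat : ∀ {S T : FinGSet G} (h : S →[G] T) (a r x),
    ψ S (fun i => (algPres R M).mackey.res h (a i)) (fun i => R.res h (r i))
      (fun i => (x i).comp h) = N.res h (ψ T a r x)
  add : ∀ {T : FinGSet G} (a r x), ∀ i ∈ J, ∀ b c : (algPres R M).mackey.obj T,
    ψ T (Function.update a i (b + c)) r x =
      ψ T (Function.update a i b) r x + ψ T (Function.update a i c) r x
  tr : ∀ {T' T : FinGSet G} (h : T' →[G] T) (a r x), ∀ i ∈ J,
    ∀ b : (algPres R M).mackey.obj T',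
    ψ T (Function.update a i ((algPres R M).mackey.tr h b)) r x =
      N.tr h (ψ T' (Function.update (fun j => (algPres R M).mackey.res h (a j)) i b)
        (fun j => R.res h (r j)) fun j => (x j).comp h)
  add_coeff : ∀ {T : FinGSet G} (a r x), ∀ i ∉ J, ∀ b c : R.obj T,
    ψ T a (Function.update r i (b + c)) x =
      ψ T a (Function.update r i b) x + ψ T a (Function.update r i c) x
  tr_coeff : ∀ {T' T : FinGSet G} (h : T' →[G] T) (a r x), ∀ i ∉ J, ∀ b : R.obj T',
    ψ T a (Function.update r i (R.tr h b)) x =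
      N.tr h (ψ T' (fun j => (algPres R M).mackey.res h (a j))
        (Function.update (fun j => R.res h (r j)) i b) fun j => (x j).comp h)
  base : ∀ {T : FinGSet G} (a r x), ∀ i ∉ J, x i = zeroMap M T → ψ T a r x = 0
  val : ∀ {T : FinGSet G} (a r x r' x'), (∀ i ∈ J, a i = algElt (r' i) (x' i)) →
    (∀ i ∉ J, r i = r' i) → (∀ i ∉ J, x i = x' i) → ψ T a r x = φ T r' x'

variable {φ : ∀ T : FinGSet G, (ι → R.obj T) → (ι → (T →[G] M)) → N.obj T} {J : Finset ι}
  {ψ : ∀ T : FinGSet G, (ι → (algPres R M).mackey.obj T) → (ι → R.obj T) →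
      (ι → (T →[G] M)) → N.obj T}

/-- The pairing `ψ` with the generator in the variable `i` singled out. -/
def splitVar (ψ : ∀ T : FinGSet G, (ι → (algPres R M).mackey.obj T) → (ι → R.obj T) →
      (ι → (T →[G] M)) → N.obj T) (i : ι) (T : FinGSet G) (y : (tupleCoeff ι R M).obj T)
    (d : (algPres R M).D.obj T) : N.obj T :=
  ψ T y.1 (Function.update y.2.1 i d.1) (Function.update y.2.2 i d.2)

lemma IsPartialDesc.splitVar_res (H : IsPartialDesc φ J ψ) (i : ι) {S T : FinGSet G} (h : S →[G] T)
    (y : (tupleCoeff ι R M).obj T) (d : (algPres R M).D.obj T) :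
    splitVar ψ i S ((tupleCoeff ι R M).res h y) ((algPres R M).D.res h d) =
      N.res h (splitVar ψ i T y d) := by
  refine Eq.trans ?_ (H.nat h y.1 (Function.update y.2.1 i d.1) (Function.update y.2.2 i d.2))
  rw [comp_update_apply (R.res h), comp_update_apply fun z : T →[G] M => z.comp h]
  rfl

/-- The three kinds of relations of `R[M]` in the variable `i` are exactly the axioms `add_coeff`,
`tr_coeff` and `base` for a variable outside `J`; they are what allows this variable to be extended
to all of `R[M]`. -/
lemma IsPartialDesc.splitVar_rel (H : IsPartialDesc φ J ψ) {i : ι} (hi : i ∉ J) {T : FinGSet G}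
    (y : (tupleCoeff ι R M).obj T) (e) (he : (algPres R M).E T e) :
    ev (D := algCoeff R M)
      (fun V k d => N.tr k (splitVar ψ i V ((tupleCoeff ι R M).res k y) d)) e = 0 := by
  have hy := (tupleCoeff ι R M).res_id y
  cases he with
  | add r s x =>
    rw [map_sub, map_sub, sub_sub, sub_eq_zero, ev_algGen, ev_algGen, ev_algGen,
      N.tr_id, N.tr_id, N.tr_id, hy]
    exact H.add_coeff _ _ _ i hi r s
  | tr h r x =>
    rw [map_sub, sub_eq_zero, ev_algGen, ev_algGen, N.tr_id, hy]
    refine (H.tr_coeff h y.1 y.2.1 _ i hi r).trans ?_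
    rw [comp_update_apply fun z : T →[G] M => z.comp h]
    rfl
  | base r =>
    rw [ev_algGen, N.tr_id, hy]
    exact H.base _ _ _ i hi (Function.update_self _ _ _)

/-- The extension of a partial pairing to one more variable. -/
noncomputable def IsPartialDesc.extend (H : IsPartialDesc φ J ψ) {i : ι} (hi : i ∉ J)
    (T : FinGSet G) (a : ι → (algPres R M).mackey.obj T) (r : ι → R.obj T)
    (x : ι → (T →[G] M)) : N.obj T :=
  -- The entry `a i` is the argument and not part of the parameter. It is overwritten by `0` in the
  -- parameter, so that the value depends on `a i` through the last argument only and is additive in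
  -- it.
  pdesc (Q := algPres R M) (Y := tupleCoeff ι R M) (splitVar ψ i) (H.splitVar_res i)
    (H.splitVar_rel hi) (Function.update a i 0, r, x) (a i)

end
end BoxOfMonoidAlgebras

/-! ### Extension of pairings from generators of `R[M]`, one variable at a time. -/

section BoxOfMonoidAlgebras

open GCoeff Presentation

variable {G : Type} [Group G] {ι : Type} [DecidableEq ι]
variable {R : GreenFunctor.{u} G} {M : PointedGMonoid.{u} G} {N : MackeyFunctor.{u} G}

variable {φ : ∀ T : FinGSet G, (ι → R.obj T) → (ι → (T →[G] M)) → N.obj T} {J : Finset ι}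
  {ψ : ∀ T : FinGSet G, (ι → (algPres R M).mackey.obj T) → (ι → R.obj T) →
      (ι → (T →[G] M)) → N.obj T}

lemma res_update_zero {S T : FinGSet G} (h : S →[G] T) (a : ι → (algPres R M).mackey.obj T)
    (i : ι) : (fun j => (algPres R M).mackey.res h (Function.update a i 0 j)) =
      Function.update (fun j => (algPres R M).mackey.res h (a j)) i 0 := by
  rw [comp_update_apply ((algPres R M).mackey.res h), map_zero]

lemma MackeyFunctor.res_fst_res (P : MackeyFunctor.{u} G) {V T T' : FinGSet G} (f : V →[G] T)
    (h : T' →[G] T) (a : P.obj T) : P.res (FinGSet.fst f h) (P.res f a) =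
      P.res (FinGSet.snd f h) (P.res h a) := by
  rw [← P.res_comp, ← P.res_comp]
  exact P.res_eq FinGSet.pb_comm a

lemma comp_fst_update {V T T' : FinGSet G} (f : V →[G] T) (h : T' →[G] T) (x : ι → (T →[G] M))
    (i : ι) (z : V →[G] M) :
    (fun j => (Function.update (fun j => (x j).comp f) i z j).comp (FinGSet.fst f h)) =
      Function.update (fun j => ((x j).comp h).comp (FinGSet.snd f h)) i
        (z.comp (FinGSet.fst f h)) := by
  rw [comp_update_apply fun z : V →[G] M => z.comp (FinGSet.fst f h)]
  refine congrArg (fun y : ι → (FinGSet.pb f h →[G] M) =>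
    Function.update y i (z.comp (FinGSet.fst f h))) ?_
  funext j
  exact MulActionHom.ext fun w => congrArg (x j) (FinGSet.pb_comm w)

lemma res_fst_update (P : MackeyFunctor.{u} G) {V T T' : FinGSet G} (f : V →[G] T)
    (h : T' →[G] T) (r : ι → P.obj T) (i : ι) (z : P.obj V) :
    (fun j => P.res (FinGSet.fst f h) (Function.update (fun j => P.res f (r j)) i z j)) =
      Function.update (fun j => P.res (FinGSet.snd f h) (P.res h (r j))) i
        (P.res (FinGSet.fst f h) z) := by
  rw [comp_update_apply (P.res (FinGSet.fst f h))]
  simp only [P.res_fst_res]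

/-- The induction step. In the new variable `i` the axioms hold because `pdesc` is additive and
satisfies Frobenius reciprocity; in any other variable they are inherited from `ψ`, where
`pdesc_add`, `pdesc_frobenius` and `pdesc_zero` reduce them to generators in the variable `i`. -/
lemma IsPartialDesc.isPartialDesc_extend (H : IsPartialDesc φ J ψ) {i : ι} (hi : i ∉ J) :
    IsPartialDesc φ (insert i J) (H.extend hi) where
  nat {S T} h a r x := by
    refine Eq.trans ?_ (pdesc_res (Q := algPres R M) (splitVar ψ i) (H.splitVar_res i)
      (H.splitVar_rel hi) h (Function.update a i 0, r, x) (a i))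
    rw [IsPartialDesc.extend, ← res_update_zero]
    rfl
  add {T} a r x l hl b c := by
    rcases eq_or_ne l i with rfl | hli
    · simp only [IsPartialDesc.extend, Function.update_idem, Function.update_self, map_add]
    · have hlJ : l ∈ J := (Finset.mem_insert.mp hl).resolve_left hli
      simp only [IsPartialDesc.extend, Function.update_of_ne hli.symm, Function.update_comm hli]
      refine pdesc_add (Q := algPres R M) (Y := tupleCoeff ι R M) _ _ _ (fun {V} f d => ?_) (a i)
      have h (z) : splitVar ψ i V ((tupleCoeff ι R M).res f
          (Function.update (Function.update a i 0) l z, r, x)) d =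
          ψ V (Function.update (fun j => (algPres R M).mackey.res f (Function.update a i 0 j)) l
            ((algPres R M).mackey.res f z)) (Function.update (fun j => R.res f (r j)) i d.1)
            (Function.update (fun j => (x j).comp f) i d.2) :=
        congrArg (fun y => ψ V y _ _) (comp_update_apply ((algPres R M).mackey.res f) _ l z)
      rw [h, h, h, map_add]
      exact H.add _ _ _ l hlJ _ _
  tr {T' T} h a r x l hl b := by
    rcases eq_or_ne l i with rfl | hli
    · simp only [IsPartialDesc.extend, Function.update_idem, Function.update_self]
      refine (pdesc_tr (Q := algPres R M) (Y := tupleCoeff ι R M) _ _ _ h _ b).trans ?_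
      rw [← res_update_zero]
      rfl
    · have hlJ : l ∈ J := (Finset.mem_insert.mp hl).resolve_left hli
      simp only [IsPartialDesc.extend, Function.update_of_ne hli.symm, Function.update_comm hli]
      refine pdesc_frobenius (Q := algPres R M) (Y := tupleCoeff ι R M) _ _ _ h
        (fun {V} f d => ?_) (a i)
      -- Passing to a generator over `f` restricts the transferred entry along `f`. The double coset
      -- formula rewrites this restriction as a transfer along the first projection of the pullback,
      -- to which the axiom for `ψ` applies.
      have h₁ : splitVar ψ i V ((tupleCoeff ι R M).res f
          (Function.update (Function.update a i 0) l ((algPres R M).mackey.tr h b), r, x)) d =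
          ψ V (Function.update (fun j => (algPres R M).mackey.res f (Function.update a i 0 j)) l
            ((algPres R M).mackey.tr (FinGSet.fst f h) ((algPres R M).mackey.res (FinGSet.snd f h)
              b))) (Function.update (fun j => R.res f (r j)) i d.1)
            (Function.update (fun j => (x j).comp f) i d.2) := by
        rw [← (algPres R M).mackey.mackey (isPb_pb f h).symm]
        exact congrArg (fun y => ψ V y _ _) (comp_update_apply ((algPres R M).mackey.res f) _ l _)
      rw [h₁, H.tr _ _ _ _ _ hlJ, comp_fst_update, res_fst_update, ← res_update_zero]
      simp only [MackeyFunctor.res_fst_res]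
      exact congrArg (fun y => N.tr _ (ψ _ y _ _))
        (comp_update_apply ((algPres R M).mackey.res (FinGSet.snd f h)) _ l _).symm
  add_coeff {T} a r x l hl b c := by
    have hli : l ≠ i := fun h => hl (h ▸ Finset.mem_insert_self _ _)
    have hlJ : l ∉ J := fun h => hl (Finset.mem_insert_of_mem h)
    refine pdesc_add (Q := algPres R M) (Y := tupleCoeff ι R M) _ _ _ (fun {V} f d => ?_) (a i)
    have h (z) : splitVar ψ i V ((tupleCoeff ι R M).res f
        (Function.update a i 0, Function.update r l z, x)) d =
        ψ V (fun j => (algPres R M).mackey.res f (Function.update a i 0 j))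
          (Function.update (Function.update (fun j => R.res f (r j)) i d.1) l (R.res f z))
          (Function.update (fun j => (x j).comp f) i d.2) := by
      refine congrArg (fun y => ψ V _ y _) ?_
      rw [Function.update_comm hli.symm, ← comp_update_apply (R.res f)]
      rfl
    rw [h, h, h, map_add]
    exact H.add_coeff _ _ _ l hlJ _ _
  tr_coeff {T' T} h a r x l hl b := by
    have hli : l ≠ i := fun h => hl (h ▸ Finset.mem_insert_self _ _)
    have hlJ : l ∉ J := fun h => hl (Finset.mem_insert_of_mem h)
    refine pdesc_frobenius (Q := algPres R M) (Y := tupleCoeff ι R M) _ _ _ h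
      (fun {V} f d => ?_) (a i)
    -- The same double coset argument as for entries in `R[M]`, now for a transferred coefficient in
    -- `R`.
    have h₁ : splitVar ψ i V ((tupleCoeff ι R M).res f
        (Function.update a i 0, Function.update r l (R.tr h b), x)) d =
        ψ V (fun j => (algPres R M).mackey.res f (Function.update a i 0 j))
          (Function.update (Function.update (fun j => R.res f (r j)) i d.1) l
            (R.tr (FinGSet.fst f h) (R.res (FinGSet.snd f h) b)))
          (Function.update (fun j => (x j).comp f) i d.2) := by
      rw [← R.mackey (isPb_pb f h).symm]
      refine congrArg (fun y => ψ V _ y _) ?_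
      rw [Function.update_comm hli.symm, ← comp_update_apply (R.res f)]
      rfl
    rw [h₁, H.tr_coeff _ _ _ _ _ hlJ, comp_fst_update, res_fst_update, ← res_update_zero]
    simp only [MackeyFunctor.res_fst_res]
    refine congrArg (fun y => N.tr _ (ψ _ _ y _)) ?_
    rw [Function.update_comm hli.symm]
    exact congrArg (fun y => Function.update y i _)
      (comp_update_apply (R.res (FinGSet.snd f h)) _ l _).symm
  base {T} a r x l hl hx := by
    have hli : l ≠ i := fun h => hl (h ▸ Finset.mem_insert_self _ _)
    have hlJ : l ∉ J := fun h => hl (Finset.mem_insert_of_mem h)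
    refine pdesc_zero (Q := algPres R M) (Y := tupleCoeff ι R M) _ _ _ (fun {V} f d => ?_) (a i)
    refine H.base _ _ _ l hlJ ((Function.update_of_ne hli _ _).trans ?_)
    show (x l).comp f = zeroMap M V
    rw [hx]
    rfl
  val {T} a r x r' x' ha hr hx := by
    rw [IsPartialDesc.extend, ha i (Finset.mem_insert_self _ _)]
    refine (pdesc_ιelt (Q := algPres R M) (Y := tupleCoeff ι R M) _ _ _ _ _).trans
      (H.val _ _ _ r' x' (fun j hj => ?_) (fun j hj => ?_) fun j hj => ?_)
    · have hji : j ≠ i := fun h => hi (h ▸ hj)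
      exact (Function.update_of_ne hji _ _).trans (ha j (Finset.mem_insert_of_mem hj))
    · rcases eq_or_ne j i with rfl | hji
      · exact Function.update_self _ _ _
      · exact (Function.update_of_ne hji _ _).trans (hr j (by simp [hji, hj]))
    · rcases eq_or_ne j i with rfl | hji
      · exact Function.update_self _ _ _
      · exact (Function.update_of_ne hji _ _).trans (hx j (by simp [hji, hj]))

/-- Only finitely many variables have to be extended. The induction starts from `φ` itself, for
which no entry in `R[M]` is read and the axioms in `J` are empty. -/
lemma exists_isPartialDesc (φ : ∀ T : FinGSet G, (ι → R.obj T) → (ι → (T →[G] M)) → N.obj T)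
    (nat : ∀ {S T : FinGSet G} (h : S →[G] T) (r x),
      φ S (fun i => R.res h (r i)) (fun i => (x i).comp h) = N.res h (φ T r x))
    (add : ∀ {T : FinGSet G} (r x) (i : ι) (b c : R.obj T), φ T (Function.update r i (b + c)) x =
      φ T (Function.update r i b) x + φ T (Function.update r i c) x)
    (tr : ∀ {T' T : FinGSet G} (h : T' →[G] T) (r x) (i : ι) (b : R.obj T'),
      φ T (Function.update r i (R.tr h b)) x =
        N.tr h (φ T' (Function.update (fun j => R.res h (r j)) i b) fun j => (x j).comp h))
    (base : ∀ {T : FinGSet G} (r x) (i : ι), x i = zeroMap M T → φ T r x = 0) (J : Finset ι) :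
    ∃ ψ, IsPartialDesc φ J ψ := by
  induction J using Finset.induction_on with
  | empty =>
    exact ⟨fun T _ r x => φ T r x,
      { nat := fun h _ r x => nat h r x
        add := fun _ _ _ i hi => absurd hi (Finset.notMem_empty i)
        tr := fun _ _ _ _ i hi => absurd hi (Finset.notMem_empty i)
        add_coeff := fun _ r x i _ => add r x i
        tr_coeff := fun h _ r x i _ => tr h r x i
        base := fun _ r x i _ => base r x i
        val := fun _ r x r' x' _ hr hx => by
          rw [funext fun i => hr i (Finset.notMem_empty i),
            funext fun i => hx i (Finset.notMem_empty i)] }⟩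
  | insert i J hi ih =>
    obtain ⟨ψ, H⟩ := ih
    exact ⟨_, H.isPartialDesc_extend hi⟩

/-- A morphism out of a box power of `R[M]` can be prescribed on the tensors `□ (r_i · x_i)`. -/
lemma exists_algBox_desc [Fintype ι]
    (φ : ∀ T : FinGSet G, (ι → R.obj T) → (ι → (T →[G] M)) → N.obj T)
    (nat : ∀ {S T : FinGSet G} (h : S →[G] T) (r x),
      φ S (fun i => R.res h (r i)) (fun i => (x i).comp h) = N.res h (φ T r x))
    (add : ∀ {T : FinGSet G} (r x) (i : ι) (b c : R.obj T), φ T (Function.update r i (b + c)) x =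
      φ T (Function.update r i b) x + φ T (Function.update r i c) x)
    (tr : ∀ {T' T : FinGSet G} (h : T' →[G] T) (r x) (i : ι) (b : R.obj T'),
      φ T (Function.update r i (R.tr h b)) x =
        N.tr h (φ T' (Function.update (fun j => R.res h (r j)) i b) fun j => (x j).comp h))
    (base : ∀ {T : FinGSet G} (r x) (i : ι), x i = zeroMap M T → φ T r x = 0) :
    ∃ Φ : (bigBox fun _ : ι => (algPres R M).mackey) ⟶ N,
      ∀ (T : FinGSet G) (r : ι → R.obj T) (x : ι → (T →[G] M)),
        Φ.app T (boxTmul (M := fun _ : ι => (algPres R M).mackey) fun i => algElt (r i) (x i)) =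
          φ T r x := by
  -- Once all variables have been extended, `val` no longer constrains the generator slots, and
  -- constant values are put there. The values `0` and `zeroMap` are chosen because they are stable
  -- under restriction, as naturality and Frobenius reciprocity require.
  obtain ⟨ψ, H⟩ := exists_isPartialDesc φ nat add tr base Finset.univ
  have h0 {S T : FinGSet G} (h : S →[G] T) :
      (fun _ : ι => R.res h 0) = fun _ : ι => (0 : R.obj S) := funext fun _ => map_zero _
  refine ⟨boxDesc (M := fun _ : ι => (algPres R M).mackey)
    (fun T a => ψ T a (fun _ => 0) fun _ => zeroMap M T)
    (fun {S T} h a => ?_) (fun a i b c => H.add _ _ _ i (Finset.mem_univ i) b c)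
    (fun {T T'} h a i b => ?_), fun T r x => (boxDesc_tmul _ _ _ _ _).trans
    (H.val _ _ _ r x (fun _ _ => rfl) (fun i hi => absurd (Finset.mem_univ i) hi)
      fun i hi => absurd (Finset.mem_univ i) hi)⟩
  · have := H.nat h a (fun _ => 0) fun _ => zeroMap M T
    rw [h0] at this
    exact this
  · have := H.tr h a (fun _ => 0) (fun _ => zeroMap M T) i (Finset.mem_univ i) b
    rw [h0] at this
    exact this

end BoxOfMonoidAlgebras

/-! ### Coordinates on smash powers. -/

section SmashRepresentatives

variable {G : Type} [CommGroup G] {k : ℕ}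

lemma PointedGMonoid.smul_eq_zero_iff_eq_zero (M : PointedGMonoid.{u} G) (a : G) (x : M) :
    a • x = 0 ↔ x = 0 :=
  ⟨fun h => by rw [← inv_smul_smul a x, h, M.smul_zero], fun h => by rw [h, M.smul_zero]⟩

open Classical in
/-- The coordinates of a point of a smash power, which are zero at the base point. -/
noncomputable def smashRep (M : PointedGMonoid.{u} G) (i : Fin (k + 1)) : smashPow M k →[G] M where
  toFun := Quotient.lift (s := smashSetoid M k) (fun x => if ∃ j, x j = 0 then 0 else x i)
    fun x y h => by
      rcases h with rfl | h
      · rfl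
      · rw [if_pos h.1, if_pos h.2]
  map_smul' a q := by
    induction q using Quotient.inductionOn' with
    | h x =>
      show (if ∃ j, a • x j = 0 then (0 : M) else a • x i) = a • if ∃ j, x j = 0 then (0 : M) else x i
      simp only [M.smul_eq_zero_iff_eq_zero]
      split_ifs
      · exact (M.smul_zero a).symm
      · rfl

lemma smashRep_mk {M : PointedGMonoid.{u} G} {x : Fin (k + 1) → M} (h : ∀ j, x j ≠ 0)
    (i : Fin (k + 1)) : smashRep M i (smashMk M x) = x i := by
  classical
  exact if_neg (not_exists.mpr h)

lemma smashRep_mk_eq_zero {M : PointedGMonoid.{u} G} {x : Fin (k + 1) → M} {j : Fin (k + 1)}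
    (h : x j = 0) (i : Fin (k + 1)) : smashRep M i (smashMk M x) = 0 := by
  classical
  exact if_pos ⟨j, h⟩

lemma smashMk_rep {M : PointedGMonoid.{u} G} (q : smashPow M k) :
    smashMk M (fun i => smashRep M i q) = q := by
  induction q using Quotient.inductionOn' with
  | h x =>
    by_cases h : ∃ j, x j = 0
    · obtain ⟨j, hj⟩ := h
      exact Quotient.sound' (s₁ := smashSetoid M k)
        (Or.inr ⟨⟨0, smashRep_mk_eq_zero hj 0⟩, j, hj⟩)
    · exact congrArg (smashMk M) (funext fun i => smashRep_mk (not_exists.mp h) i)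

/-- The map into a smash power given by its coordinates. -/
def smashTuple {M : PointedGMonoid.{u} G} {T : FinGSet G} (x : Fin (k + 1) → (T →[G] M)) :
    T →[G] smashPow M k where
  toFun t := smashMk M fun i => x i t
  map_smul' a t := congrArg (smashMk M) (funext fun i => map_smul (x i) a t)

/-- The coordinates recover the point even at the base point, where they are all zero. The opposite
composite changes a tuple in which some but not all entries vanish; only its tensor is unchanged. -/
lemma smashTuple_rep {M : PointedGMonoid.{u} G} {T : FinGSet G} (x : T →[G] smashPow M k) :
    smashTuple (fun i => (smashRep M i).comp x) = x :=
  MulActionHom.ext fun t => smashMk_rep (x t)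

lemma smashTuple_base {M : PointedGMonoid.{u} G} {T : FinGSet G} {x : Fin (k + 1) → (T →[G] M)}
    {i : Fin (k + 1)} (h : x i = zeroMap M T) :
    smashTuple x = constMap T (smashPow M k).base (smashPow M k).smul_base :=
  MulActionHom.ext fun t => Quotient.sound' (s₁ := smashSetoid M k)
    (Or.inr ⟨⟨i, DFunLike.congr_fun h t⟩, 0, rfl⟩)

/-- The tensor `□ (r_i · x_i)` depends only on the `r_i` and the point of the smash power
given by the `x_i`. -/
lemma boxTmul_algElt_rep {R : GreenFunctor.{u} G} {M : PointedGMonoid.{u} G} {T : FinGSet G}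
    (r : Fin (k + 1) → R.obj T) (x : Fin (k + 1) → (T →[G] M)) :
    boxTmul (M := fun _ : Fin (k + 1) => (algPres R M).mackey)
        (fun i => algElt (r i) ((smashRep M i).comp (smashTuple x))) =
      boxTmul (M := fun _ : Fin (k + 1) => (algPres R M).mackey) fun i => algElt (r i) (x i) := by
  -- Around a point with a vanishing coordinate `i`, the stable set where `x i` vanishes is used:
  -- there the factor `i` of both tensors is zero. Around any other point, the stable set where no
  -- coordinate vanishes is used: there the chosen coordinates are the given ones. Both sets are
  -- stable because `G` fixes zero.
  refine MackeyFunctor.ext_of_cover _ _ le_rfl fun t => ?_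
  by_cases h : ∃ i, x i t = 0
  · obtain ⟨i, hi⟩ := h
    let E : SubMulAction G T := stable (fun t => x i t = 0) fun a t ht => by
      rw [map_smul, ht]; exact M.smul_zero a
    have hE (w) : x i (FinGSet.incl E w) = 0 := FinGSet.incl_mem E w
    refine ⟨E, hi, ?_⟩
    rw [res_boxTmul, res_boxTmul, boxTmul_eq_zero _ i, boxTmul_eq_zero _ i]
    · rw [res_algElt, show (x i).comp (FinGSet.incl E) = zeroMap M _ from MulActionHom.ext hE,
        algElt_zero]
    · rw [res_algElt, show ((smashRep M i).comp (smashTuple x)).comp (FinGSet.incl E) =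
        zeroMap M _ from MulActionHom.ext fun w => smashRep_mk_eq_zero (hE w) i, algElt_zero]
  · let E : SubMulAction G T := stable (fun t => ∀ i, x i t ≠ 0) fun a t ht i => by
      rw [map_smul]; exact fun h => ht i ((M.smul_eq_zero_iff_eq_zero a _).mp h)
    have hE (w) (i) : x i (FinGSet.incl E w) ≠ 0 := FinGSet.incl_mem E w i
    refine ⟨E, not_exists.mp h, ?_⟩
    rw [res_boxTmul, res_boxTmul]
    refine congrArg boxTmul (funext fun i => ?_)
    rw [res_algElt, res_algElt]
    exact congrArg (algElt _) (MulActionHom.ext fun w => smashRep_mk (hE w) i)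

end SmashRepresentatives

/-! ### The isomorphism between `R[M]^{□(k+1)}` and `R^{□(k+1)} □ A_{M^{∧(k+1)}} / A_∗`. -/

section BoxOfMonoidAlgebras

open GCoeff Presentation

variable {G : Type} [CommGroup G] {k : ℕ}

/-- The contravariant set-valued functor underlying a Mackey functor. -/
def MackeyFunctor.toGCoeff (P : MackeyFunctor.{u} G) : GCoeff.{u} G where
  obj T := P.obj T
  res f := P.res f
  res_id := P.res_id
  res_comp := P.res_comp

/-- The box power `R^{□(k+1)}`. -/
noncomputable abbrev boxPow (R : GreenFunctor.{u} G) (k : ℕ) : MackeyFunctor.{u} G :=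
  bigBox fun _ : Fin (k + 1) => R.toMackeyFunctor

/-- The tensor `□ r_i` in a box power. -/
noncomputable abbrev powTmul {R : GreenFunctor.{u} G} {T : FinGSet G} (r : Fin (k + 1) → R.obj T) :
    (boxPow R k).obj T :=
  boxTmul (M := fun _ : Fin (k + 1) => R.toMackeyFunctor) r

/-- The box power `R[M]^{□(k+1)}`. -/
noncomputable abbrev algPow (R : GreenFunctor.{u} G) (M : PointedGMonoid.{u} G) (k : ℕ) :
    MackeyFunctor.{u} G :=
  bigBox fun _ : Fin (k + 1) => (algPres R M).mackey

/-- The tensor `□ (r_i · x_i)`. -/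
noncomputable abbrev algTmul {R : GreenFunctor.{u} G} {M : PointedGMonoid.{u} G} {T : FinGSet G}
    (r : Fin (k + 1) → R.obj T) (x : Fin (k + 1) → (T →[G] M)) : (algPow R M k).obj T :=
  boxTmul (M := fun _ : Fin (k + 1) => (algPres R M).mackey) fun i => algElt (r i) (x i)

variable {R : GreenFunctor.{u} G} {M : PointedGMonoid.{u} G}

lemma res_algTmul {S T : FinGSet G} (h : S →[G] T) (r : Fin (k + 1) → R.obj T)
    (x : Fin (k + 1) → (T →[G] M)) : (algPow R M k).res h (algTmul r x) =
      algTmul (fun i => R.res h (r i)) fun i => (x i).comp h :=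
  (res_boxTmul _ _).trans (congrArg boxTmul (funext fun _ => res_algElt _ _ _))

lemma algElt_update {T : FinGSet G} (r : Fin (k + 1) → R.obj T) (x : Fin (k + 1) → (T →[G] M))
    (i : Fin (k + 1)) (b : R.obj T) : (fun j => algElt (Function.update r i b j) (x j)) =
      Function.update (fun j => algElt (r j) (x j)) i (algElt b (x i)) := by
  funext j
  rcases eq_or_ne j i with rfl | hj
  · simp
  · simp [hj]

lemma algTmul_add {T : FinGSet G} (r : Fin (k + 1) → R.obj T) (x : Fin (k + 1) → (T →[G] M))
    (i : Fin (k + 1)) (b c : R.obj T) : algTmul (Function.update r i (b + c)) x =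
      algTmul (Function.update r i b) x + algTmul (Function.update r i c) x := by
  rw [algTmul, algTmul, algTmul, algElt_update, algElt_update, algElt_update, algElt_add,
    boxTmul_add]

lemma algTmul_tr {T T' : FinGSet G} (h : T' →[G] T) (r : Fin (k + 1) → R.obj T)
    (x : Fin (k + 1) → (T →[G] M)) (i : Fin (k + 1)) (b : R.obj T') :
    algTmul (Function.update r i (R.tr h b)) x = (algPow R M k).tr h
      (algTmul (Function.update (fun j => R.res h (r j)) i b) fun j => (x j).comp h) := by
  rw [algTmul, algTmul, algElt_update, algElt_update, algElt_tr, boxTmul_tr]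
  simp only [res_algElt]

lemma algTmul_eq_zero {T : FinGSet G} (r : Fin (k + 1) → R.obj T)
    (x : Fin (k + 1) → (T →[G] M)) (i : Fin (k + 1)) (h : x i = zeroMap M T) :
    algTmul r x = 0 := by
  refine boxTmul_eq_zero _ i ?_
  rw [h, algElt_zero]

/-- The tensor `□ (r_i · x_i)` in terms of the point `x` of the smash power. -/
noncomputable def repTmul (T : FinGSet G) (x : (mapCoeff (smashPow M k)).obj T)
    (r : (boxCoeff fun _ : Fin (k + 1) => R.toMackeyFunctor).obj T) : (algPow R M k).obj T :=
  algTmul r fun i => (smashRep M i).comp (show T →[G] smashPow M k from x)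

lemma repTmul_res {S T : FinGSet G} (h : S →[G] T) (x : (mapCoeff (smashPow M k)).obj T)
    (r : (boxCoeff fun _ : Fin (k + 1) => R.toMackeyFunctor).obj T) :
    repTmul S ((mapCoeff (smashPow M k)).res h x)
        ((boxCoeff fun _ : Fin (k + 1) => R.toMackeyFunctor).res h r) =
      (algPow R M k).res h (repTmul T x r) :=
  (res_algTmul h r fun i => (smashRep M i).comp (show T →[G] smashPow M k from x)).symm

/-- With the point `x` fixed, `□ r_i ↦ □ (r_i · x_i)` is multilinear and satisfies Frobenius
reciprocity in the coefficients, hence respects the relations of `R^{□(k+1)}`. -/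
lemma repTmul_rel {T : FinGSet G} (x : (mapCoeff (smashPow M k)).obj T) (e)
    (he : BoxRel (fun _ : Fin (k + 1) => R.toMackeyFunctor) T e) :
    ev (D := boxCoeff fun _ : Fin (k + 1) => R.toMackeyFunctor) (fun V f r =>
      (algPow R M k).tr f (repTmul V ((mapCoeff (smashPow M k)).res f x) r)) e = 0 := by
  cases he with
  | add r i a b =>
    rw [map_sub, map_sub, sub_sub, sub_eq_zero, ev_boxGen, ev_boxGen, ev_boxGen,
      MackeyFunctor.tr_id, MackeyFunctor.tr_id, MackeyFunctor.tr_id]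
    exact algTmul_add _ _ i a b
  | frobenius h r i a =>
    rw [map_sub, sub_eq_zero, ev_boxGen, ev_boxGen, MackeyFunctor.tr_id]
    exact algTmul_tr h r _ i a

/-- The homomorphism `□ r_i ↦ □ (r_i · x_i)`. -/
noncomputable def repHom (T : FinGSet G) (x : T →[G] smashPow M k) :
    (boxPow R k).obj T →+ (algPow R M k).obj T :=
  pdesc (Q := boxPres fun _ : Fin (k + 1) => R.toMackeyFunctor) (Y := mapCoeff (smashPow M k))
    (N := algPow R M k) repTmul repTmul_res repTmul_rel x

lemma repHom_tmul {T : FinGSet G} (x : T →[G] smashPow M k) (r : Fin (k + 1) → R.obj T) :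
    repHom T x (powTmul r) = algTmul r fun i => (smashRep M i).comp x :=
  pdesc_ιelt (Q := boxPres fun _ : Fin (k + 1) => R.toMackeyFunctor)
    repTmul repTmul_res repTmul_rel x r

lemma repHom_res {S T : FinGSet G} (h : S →[G] T) (x : T →[G] smashPow M k)
    (p : (boxPow R k).obj T) : repHom S (x.comp h) ((boxPow R k).res h p) =
      (algPow R M k).res h (repHom T x p) :=
  pdesc_res (Q := boxPres fun _ : Fin (k + 1) => R.toMackeyFunctor)
    repTmul repTmul_res repTmul_rel h x p

lemma repHom_tr {S T : FinGSet G} (h : S →[G] T) (x : T →[G] smashPow M k)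
    (p : (boxPow R k).obj S) : repHom T x ((boxPow R k).tr h p) =
      (algPow R M k).tr h (repHom S (x.comp h) p) :=
  pdesc_tr (Q := boxPres fun _ : Fin (k + 1) => R.toMackeyFunctor)
    repTmul repTmul_res repTmul_rel h x p

/-- All coordinates of the base point are zero, so already the first factor of each tensor vanishes.
This is the relation needed to pass from `A_X` to `A_X / A_∗`. -/
lemma repHom_base {T : FinGSet G} (p : (boxPow R k).obj T) :
    repHom T (constMap T (smashPow M k).base (smashPow M k).smul_base) p = 0 :=
  pdesc_zero (Q := boxPres fun _ : Fin (k + 1) => R.toMackeyFunctor)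
    repTmul repTmul_res repTmul_rel (fun _ r => algTmul_eq_zero r _ 0 (MulActionHom.ext fun _ =>
      smashRep_mk_eq_zero (x := fun _ => (0 : M)) (j := 0) rfl 0)) p

/-- The pairing `(□ r_i, x) ↦ □ (r_i · x_i)` on generators of the second variable. -/
noncomputable def repVal (T : FinGSet G) (p : (boxPow R k).toGCoeff.obj T)
    (x : (reprPres (smashPow M k)).D.obj T) : (algPow R M k).obj T :=
  repHom T x p

lemma repVal_res {S T : FinGSet G} (h : S →[G] T) (p : (boxPow R k).toGCoeff.obj T)
    (x : (reprPres (smashPow M k)).D.obj T) :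
    repVal S ((boxPow R k).toGCoeff.res h p) ((reprPres (smashPow M k)).D.res h x) =
      (algPow R M k).res h (repVal T p x) := repHom_res h x p

lemma repVal_rel {T : FinGSet G} (p : (boxPow R k).toGCoeff.obj T) (e)
    (he : (reprPres (smashPow M k)).E T e) :
    ev (fun V f x => (algPow R M k).tr f (repVal V ((boxPow R k).toGCoeff.res f p) x)) e = 0 := by
  cases he
  refine (ev_gen (D := mapCoeff (smashPow M k)) _ _ _).trans ?_
  exact (congrArg _ (repHom_base _)).trans (map_zero _)

/-- The pairing `(□ r_i, x) ↦ □ (r_i · x_i)`. -/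
noncomputable def repPairing (T : FinGSet G) (p : (boxPow R k).obj T) :
    (reprObj (smashPow M k)).obj T →+ (algPow R M k).obj T :=
  pdesc (Q := reprPres (smashPow M k)) (Y := (boxPow R k).toGCoeff) (N := algPow R M k)
    repVal repVal_res repVal_rel p

variable (k R M) in
/-- The morphism `R^{□(k+1)} □ A_{M^{∧(k+1)}} / A_∗ ⟶ R[M]^{□(k+1)}`,
`(□ r_i) □ x ↦ □ (r_i · x_i)`. -/
noncomputable def assembly :
    bigBox (pair (boxPow R k) (reprObj (smashPow M k))) ⟶ algPow R M k :=
  boxHom repPairing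
    (fun h p q => pdesc_res repVal repVal_res repVal_rel h p q)
    (fun p p' q => pdesc_add repVal repVal_res repVal_rel
      (fun {V} f x => (congrArg (repHom V x) (map_add ((boxPow R k).res f) p p')).trans
        (map_add (repHom V x) _ _)) q)
    -- A transfer in `R^{□(k+1)}` restricted along `f` is expanded by the double coset formula, and
    -- `repHom` commutes with the resulting transfer.
    (fun h p q => pdesc_frobenius repVal repVal_res repVal_rel h (fun {V} f x =>
      (congrArg (repHom V x) ((boxPow R k).mackey (isPb_pb f h).symm p)).trans
        (repHom_tr _ _ _)) q)
    (fun h p q => pdesc_tr repVal repVal_res repVal_rel h p q)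

lemma assembly_tmul {T : FinGSet G} (r : Fin (k + 1) → R.obj T) (x : T →[G] smashPow M k) :
    (assembly k R M).app T (tmul (powTmul r) (reprElt x)) =
      algTmul r fun i => (smashRep M i).comp x :=
  (boxHom_tmul _ _ _ _ _ _ _).trans ((pdesc_ιelt repVal repVal_res repVal_rel _ x).trans (repHom_tmul x r))

/-- A morphism out of `R^{□(k+1)} □ A_X / A_∗` is determined on the tensors `(□ r_i) □ x`. -/
lemma box_repr_hom_ext {X : PointedGSet.{u} G} {N : MackeyFunctor.{u} G}
    {φ ψ : bigBox (pair (boxPow R k) (reprObj X)) ⟶ N}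
    (h : ∀ (T : FinGSet G) (r : Fin (k + 1) → R.obj T) (x : T →[G] X),
      φ.app T (tmul (powTmul r) (reprElt x)) = ψ.app T (tmul (powTmul r) (reprElt x))) :
    φ = ψ := by
  have h₁ (T : FinGSet G) (p : (boxPow R k).obj T) (x : T →[G] X) :
      φ.app T (tmul p (reprElt x)) = ψ.app T (tmul p (reprElt x)) := by
    -- Fixing one factor gives a homomorphism in the other. It is determined on generators, whose
    -- transfers leave the tensor by Frobenius reciprocity; the argument is applied first to the
    -- factor `R^{□(k+1)}` and then to `A_X / A_∗`.
    let F (χ : bigBox (pair (boxPow R k) (reprObj X)) ⟶ N) : (boxPow R k).obj T →+ N.obj T :=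
      AddMonoidHom.mk' (fun p => χ.app T (tmul p (reprElt x))) fun p p' =>
        (congrArg (χ.app T) (tmul_add_left p p' _)).trans (map_add _ _ _)
    refine DFunLike.congr_fun (f := F φ) (g := F ψ) (elt_hom_ext
      (Q := boxPres fun _ : Fin (k + 1) => R.toMackeyFunctor) fun V f r => ?_) p
    have hχ (χ : bigBox (pair (boxPow R k) (reprObj X)) ⟶ N) : F χ (elt f r) =
        N.tr f (χ.app V (tmul (powTmul r) (reprElt (x.comp f)))) := by
      refine (congrArg (F χ) (elt_eq_tr f r)).trans ((congrArg (χ.app T)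
        (tmul_tr_left f _ _)).trans ((χ.app_tr _ _).trans ?_))
      exact congrArg (fun y => N.tr f (χ.app V (tmul _ y)))
        (res_ιelt (Q := reprPres X) f x)
    exact (hχ φ).trans ((congrArg (N.tr f) (h V r (x.comp f))).trans (hχ ψ).symm)
  refine box_hom_ext fun T p q => ?_
  let F (χ : bigBox (pair (boxPow R k) (reprObj X)) ⟶ N) : (reprObj X).obj T →+ N.obj T :=
    AddMonoidHom.mk' (fun q => χ.app T (tmul p q)) fun q q' =>
      (congrArg (χ.app T) (tmul_add_right p q q')).trans (map_add _ _ _)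
  refine DFunLike.congr_fun (f := F φ) (g := F ψ) (elt_hom_ext (Q := reprPres X)
    fun V f x => ?_) q
  have hχ (χ : bigBox (pair (boxPow R k) (reprObj X)) ⟶ N) : F χ (elt f x) =
      N.tr f (χ.app V (tmul ((boxPow R k).res f p) (reprElt x))) :=
    (congrArg (F χ) (elt_eq_tr f x)).trans ((congrArg (χ.app T)
      (tmul_tr_right f _ _)).trans (χ.app_tr _ _))
  exact (hχ φ).trans ((congrArg (N.tr f) (h₁ V _ x)).trans (hχ ψ).symm)

lemma reprElt_res {X : PointedGSet.{u} G} {S T : FinGSet G} (h : S →[G] T) (x : T →[G] X) :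
    (reprObj X).res h (reprElt x) = reprElt (x.comp h) := res_ιelt (Q := reprPres X) h x

/-- The tensor `(□ r_i) □ x`. -/
noncomputable def powReprTmul (T : FinGSet G) (r : Fin (k + 1) → R.obj T)
    (x : Fin (k + 1) → (T →[G] M)) :
    (bigBox (pair (boxPow R k) (reprObj (smashPow M k)))).obj T :=
  tmul (powTmul r) (reprElt (smashTuple x))

lemma powReprTmul_res {S T : FinGSet G} (h : S →[G] T) (r : Fin (k + 1) → R.obj T)
    (x : Fin (k + 1) → (T →[G] M)) :
    powReprTmul S (fun i => R.res h (r i)) (fun i => (x i).comp h) =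
      (bigBox (pair (boxPow R k) (reprObj (smashPow M k)))).res h (powReprTmul T r x) := by
  refine Eq.trans ?_ (res_tmul h (powTmul r) (reprElt (smashTuple x))).symm
  exact congrArg₂ tmul (res_boxTmul h r).symm (reprElt_res h (smashTuple x)).symm

lemma powReprTmul_add {T : FinGSet G} (r : Fin (k + 1) → R.obj T) (x : Fin (k + 1) → (T →[G] M))
    (i : Fin (k + 1)) (b c : R.obj T) : powReprTmul T (Function.update r i (b + c)) x =
      powReprTmul T (Function.update r i b) x + powReprTmul T (Function.update r i c) x :=
  (congrArg (fun p => tmul p (reprElt (smashTuple x)))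
    (boxTmul_add (M := fun _ : Fin (k + 1) => R.toMackeyFunctor) r i b c)).trans
      (tmul_add_left _ _ _)

lemma powReprTmul_tr {T' T : FinGSet G} (h : T' →[G] T) (r : Fin (k + 1) → R.obj T)
    (x : Fin (k + 1) → (T →[G] M)) (i : Fin (k + 1)) (b : R.obj T') :
    powReprTmul T (Function.update r i (R.tr h b)) x =
      (bigBox (pair (boxPow R k) (reprObj (smashPow M k)))).tr h
        (powReprTmul T' (Function.update (fun j => R.res h (r j)) i b) fun j => (x j).comp h) := by
  refine (congrArg (fun p => tmul p (reprElt (smashTuple x)))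
    (boxTmul_tr (M := fun _ : Fin (k + 1) => R.toMackeyFunctor) h r i b)).trans ?_
  refine (tmul_tr_left h (powTmul (Function.update (fun j => R.res h (r j)) i b))
    (reprElt (smashTuple x))).trans ?_
  exact congrArg (fun q => MackeyFunctor.tr _ h (tmul _ q)) (reprElt_res h (smashTuple x))

/-- A tuple with one zero coordinate represents the base point of the smash power, which is zero in
`A_X / A_∗`. -/
lemma powReprTmul_base {T : FinGSet G} (r : Fin (k + 1) → R.obj T) (x : Fin (k + 1) → (T →[G] M))
    (i : Fin (k + 1)) (hx : x i = zeroMap M T) : powReprTmul T r x = 0 := by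
  rw [powReprTmul, smashTuple_base hx, reprElt_base]
  have := tmul_add_right (powTmul r) (0 : (reprObj (smashPow M k)).obj T) 0
  rw [add_zero] at this
  exact left_eq_add.mp this

variable (k R M) in
/-- The morphism `□ (r_i · x_i) ↦ (□ r_i) □ x`. -/
noncomputable def disassembly :
    algPow R M k ⟶ bigBox (pair (boxPow R k) (reprObj (smashPow M k))) :=
  (exists_algBox_desc powReprTmul powReprTmul_res powReprTmul_add
    powReprTmul_tr powReprTmul_base).choose

lemma disassembly_tmul {T : FinGSet G} (r : Fin (k + 1) → R.obj T)
    (x : Fin (k + 1) → (T →[G] M)) : (disassembly k R M).app T (algTmul r x) =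
      tmul (powTmul r) (reprElt (smashTuple x)) :=
  (exists_algBox_desc powReprTmul powReprTmul_res powReprTmul_add
    powReprTmul_tr powReprTmul_base).choose_spec T r x

variable (k R M) in
/-- The isomorphism `R[M]^{□(k+1)} ≅ R^{□(k+1)} □ A_{M^{∧(k+1)}} / A_∗`. -/
noncomputable def algPowIso :
    algPow R M k ≅ bigBox (pair (boxPow R k) (reprObj (smashPow M k))) where
  hom := disassembly k R M
  inv := assembly k R M
  hom_inv_id := algBox_hom_ext fun T r x => by
    -- The round trip replaces `x` by the coordinates of its class in the smash power, which may be
    -- a different tuple; the tensor is unchanged by `boxTmul_algElt_rep`.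
    refine (congrArg ((assembly k R M).app T) (disassembly_tmul r x)).trans ?_
    exact (assembly_tmul r _).trans (boxTmul_algElt_rep r x)
  inv_hom_id := box_repr_hom_ext fun T r x => by
    refine (congrArg ((disassembly k R M).app T) (assembly_tmul r x)).trans ?_
    exact (disassembly_tmul r _).trans (congrArg (fun y => tmul _ (reprElt y)) (smashTuple_rep x))

end BoxOfMonoidAlgebras

/-! ### Compatibility with the cyclic operators, and the comparison map. -/

section CyclicBarOfMonoidAlgebras

open Presentation Opposite

variable {G : Type} [CommGroup G] {k m : ℕ}

attribute [local instance] mapMonoid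

/-- Precomposition with a translation. -/
def translEnd (g : G) (T : FinGSet G) (M : PointedGMonoid.{u} G) : (T →[G] M) →* (T →[G] M) where
  toFun x := x.comp (transl g T)
  map_one' := rfl
  map_mul' _ _ := rfl

/-- The multiplicative map `(r, x) ↦ r · x`. -/
noncomputable def algEltHom (R : GreenFunctor.{u} G) (M : PointedGMonoid.{u} G) (T : FinGSet G) :
    R.obj T × (T →[G] M) →* (monoidAlgebraObj R M).obj T where
  toFun d := (algElt d.1 d.2 : (algPres R M).mackey.obj T)
  map_one' := rfl
  map_mul' d d' := (algElt_mul d.1 d'.1 d.2 d'.2).symm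

variable {R : GreenFunctor.{u} G} {M : PointedGMonoid.{u} G}

/-- The map `(r, x) ↦ r · x` is multiplicative and commutes with the twists, so it commutes with the
cyclic operators; on a product of monoids these operators act componentwise. -/
lemma cyc_algElt (g : G) (θ : Fin (m + 1) →o Fin (k + 1)) {T : FinGSet G}
    (r : Fin (k + 1) → R.obj T) (x : Fin (k + 1) → (T →[G] M)) :
    cyc (twist (monoidAlgebraObj R M) g T) θ (fun i => algEltHom R M T (r i, x i)) =
      fun j => algEltHom R M T (cyc (twist R g T) θ r j, cyc (translEnd g T M) θ x j) := by
  let φ : R.obj T × (T →[G] M) →* R.obj T × (T →[G] M) := (twist R g T).prodMap (translEnd g T M)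
  refine (map_cyc (algEltHom R M T) φ (twist (monoidAlgebraObj R M) g T) (fun d => ?_) θ
    fun i => (r i, x i)).trans (funext fun j => congrArg (algEltHom R M T) (Prod.ext ?_ ?_))
  · exact (res_algElt (transl g T) d.1 d.2).symm
  · exact (congrFun (map_cyc (MonoidHom.fst _ _) φ (twist R g T) (fun _ => rfl) θ
      fun i => (r i, x i)) j).symm
  · exact (congrFun (map_cyc (MonoidHom.snd _ _) φ (translEnd g T M) (fun _ => rfl) θ
      fun i => (r i, x i)) j).symm

/-- Evaluation at a point `t` is a homomorphism of monoids. Since `x (g • t) = g • x t`, it carries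
translation of the finite `G`-set to the action of `g` on `M`, and so it matches the two twisted
operators. -/
lemma smashTuple_cyc (g : G) (θ : Fin (m + 1) →o Fin (k + 1)) {T : FinGSet G}
    (x : Fin (k + 1) → (T →[G] M)) : smashTuple (cyc (translEnd g T M) θ x) =
      (PointedGSet.Hom.toFun (ncycMap g M θ)).comp (smashTuple x) := by
  refine MulActionHom.ext fun t => congrArg (smashMk M) ?_
  let ψ : (T →[G] M) →* M := { toFun := fun x => x t, map_one' := rfl, map_mul' := fun _ _ => rfl }
  exact (map_cyc ψ (translEnd g T M) (actEnd M g) (fun x => map_smul x g t) θ x).symm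

lemma hcMap_algTmul (g : G) (θ : Fin (m + 1) →o Fin (k + 1)) {T : FinGSet G}
    (r : Fin (k + 1) → R.obj T) (x : Fin (k + 1) → (T →[G] M)) :
    (hcMap g (monoidAlgebraObj R M) θ).app T (algTmul r x) =
      algTmul (cyc (twist R g T) θ r) (cyc (translEnd g T M) θ x) :=
  (hcMap_tmul g (monoidAlgebraObj R M) θ fun i => algEltHom R M T (r i, x i)).trans
    (congrArg (boxTmul (M := fun _ : Fin (m + 1) => (algPres R M).mackey)) (cyc_algElt g θ r x))

variable (R M) in
/-- The diagonal of the box product of the cyclic bar construction and the cyclic nerve. -/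
noncomputable def hcNcyc (g : G) : SimplicialObject (MackeyFunctor.{u} G) :=
  (diagProd (box G)).obj
    ((hcFunctor g).obj R, ((SimplicialObject.whiskering _ _).obj (repr G)).obj ((Ncyc g).obj M))

lemma box_map_tmul {P P' Q Q' : MackeyFunctor.{u} G} (φ : P ⟶ P') (ψ : Q ⟶ Q') {T : FinGSet G}
    (p : P.obj T) (q : Q.obj T) :
    MackeyFunctor.Hom.app (((box G).map φ).app Q ≫ ((box G).obj P').map ψ) T (tmul p q) =
      tmul (φ.app T p) (ψ.app T q) :=
  (congrArg (MackeyFunctor.Hom.app (((box G).obj P').map ψ) T) (box_map_app_tmul φ Q p q)).trans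
    (box_obj_map_tmul P' ψ _ q)

/-- Both composites send `□ (r_i · x_i)` to the tensor of the operator applied to the `r_i` and the
operator applied to the `x_i`, and such elements determine a morphism. -/
lemma disassembly_naturality (g : G) (θ : Fin (m + 1) →o Fin (k + 1)) :
    hcMap g (monoidAlgebraObj R M) θ ≫ disassembly m R M =
      disassembly k R M ≫ ((box G).map (hcMap g R θ)).app (reprObj (smashPow M k)) ≫
        ((box G).obj (boxPow R m)).map (reprMap (ncycMap g M θ)) := by
  refine algBox_hom_ext fun T r x => ?_
  refine (congrArg ((disassembly m R M).app T) (hcMap_algTmul g θ r x)).trans ?_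
  refine (disassembly_tmul _ _).trans ?_
  refine Eq.trans ?_ (congrArg (MackeyFunctor.Hom.app (((box G).map (hcMap g R θ)).app
    (reprObj (smashPow M k)) ≫ ((box G).obj (boxPow R m)).map (reprMap (ncycMap g M θ))) T)
    (disassembly_tmul r x)).symm
  refine Eq.trans ?_ (box_map_tmul _ _ _ _).symm
  refine congrArg₂ tmul (hcMap_tmul g R θ r).symm ?_
  rw [reprMap_elt, smashTuple_cyc]

variable (R M) in
/-- The cyclic bar construction of `R[M]`. -/
noncomputable def hcAlgIso (g : G) : hcSimplicial g (monoidAlgebraObj R M) ≅ hcNcyc R M g :=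
  NatIso.ofComponents (fun n => algPowIso n.unop.len R M)
    fun f => disassembly_naturality g f.unop.toOrderHom

/-- Naturality in `R` and `M` is likewise checked on the tensors `□ (r_i · x_i)`, where both maps
act on coefficients and on monoid elements separately. -/
lemma disassembly_map {R' : GreenFunctor.{u} G} {M' : PointedGMonoid.{u} G} (φ : R ⟶ R')
    (ψ : M ⟶ M') :
    (bigBoxMap fun _ => GreenFunctor.forget.map (monoidAlgebraMap φ ψ)) ≫ disassembly k R' M' =
      disassembly k R M ≫ ((box G).map (bigBoxMap fun _ => GreenFunctor.forget.map φ)).app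
        (reprObj (smashPow M k)) ≫ ((box G).obj (boxPow R' k)).map (reprMap (smashMap ψ k)) := by
  refine algBox_hom_ext fun T r x => ?_
  refine (congrArg ((disassembly k R' M').app T) ((bigBoxMap_tmul _ _).trans
    (congrArg boxTmul (funext fun i => monoidAlgebraMap_elt φ ψ (r i) (x i))))).trans ?_
  refine (disassembly_tmul _ _).trans ?_
  refine Eq.trans ?_ (congrArg (MackeyFunctor.Hom.app (((box G).map (bigBoxMap fun _ =>
    GreenFunctor.forget.map φ)).app (reprObj (smashPow M k)) ≫
      ((box G).obj (boxPow R' k)).map (reprMap (smashMap ψ k))) T) (disassembly_tmul r x)).symm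
  refine Eq.trans ?_ (box_map_tmul _ _ _ _).symm
  refine congrArg₂ tmul (bigBoxMap_tmul _ r).symm ?_
  rw [reprMap_elt]
  rfl

/-- The twisted cyclic bar construction of a pointed monoid algebra. -/
noncomputable def hcMonoidAlgebraIso (g : G) : monoidAlgebra.{u} G ⋙ hcFunctor g ≅
    Functor.prod (hcFunctor g) (Ncyc g ⋙ (SimplicialObject.whiskering _ _).obj (repr G)) ⋙
      diagProd (box G) :=
  NatIso.ofComponents (fun X => hcAlgIso X.1 X.2 g) fun τ =>
    NatTrans.ext (funext fun _ => disassembly_map τ.1 τ.2)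

/-- The map of chain complexes
`HC(R) □ C(Ncyc M) ⟶ HC(R[M])`. -/
noncomputable def monoidAlgebraHC (g : G) :
    Functor.prod (HC.{u} g) (Ncyc.{u} g ⋙ cellularChains.{u} G) ⋙
        Functor.uncurry.obj (chainBox.{u} G) ⟶ monoidAlgebra.{u} G ⋙ HC.{u} g :=
  Functor.whiskerLeft
      (Functor.prod (hcFunctor g) (Ncyc g ⋙ (SimplicialObject.whiskering _ _).obj (repr G)))
      (eilenbergZilberNormalized (box G)) ≫
    Functor.whiskerRight (hcMonoidAlgebraIso g).inv (AlgebraicTopology.normalizedMooreComplex _)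

/-- The Eilenberg–Zilber map for the box product is a quasi-isomorphism, and the normalized complex
of a simplicial isomorphism is an isomorphism. -/
lemma quasiIso_monoidAlgebraHC (g : G) (X : GreenFunctor.{u} G × PointedGMonoid.{u} G) :
    QuasiIso ((monoidAlgebraHC g).app X) := by
  have h₁ : QuasiIso ((eilenbergZilberNormalized (box G)).app
    ((Functor.prod (hcFunctor g)
      (Ncyc g ⋙ (SimplicialObject.whiskering _ _).obj (repr G))).obj X)) := inferInstance
  have h₂ : QuasiIso ((AlgebraicTopology.normalizedMooreComplex _).map
    ((hcMonoidAlgebraIso.{u} g).inv.app X)) := inferInstance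
  exact quasiIso_comp _ _ (hφ := h₁) (hφ' := h₂)

end CyclicBarOfMonoidAlgebras

end EquivariantHH

theorem mainTheorem7 (G : Type) [CommGroup G] [Finite G] (g : G)
    (hg : ∀ x : G, x ∈ Subgroup.zpowers g) :
    ∃ η : Functor.prod (EquivariantHH.HC.{u} g)
            (EquivariantHH.Ncyc.{u} g ⋙ EquivariantHH.cellularChains.{u} G) ⋙
          Functor.uncurry.obj (EquivariantHH.chainBox.{u} G) ⟶
        EquivariantHH.monoidAlgebra.{u} G ⋙ EquivariantHH.HC.{u} g,
      ∀ X : EquivariantHH.GreenFunctor.{u} G × EquivariantHH.PointedGMonoid.{u} G,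
        QuasiIso (η.app X) :=
  ⟨EquivariantHH.monoidAlgebraHC g, EquivariantHH.quasiIso_monoidAlgebraHC g⟩
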